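/- Let $\mathcal X,\mathcal Y_1,\mathcal Y_2,\mathcal Z_1$ be finite alphabets, let $P_{XY_1Y_2Z_1}$ be a joint pmf on their product, and let $R$ be a rate. Under hypothesis $\mathcal H=0$ the tuple $(X^n,Y_1^n,Y_2^n,Z_1^n)$ is i.i.d. according to $P_{XY_1Y_2Z_1}$, and under $\mathcal H=1$ it is i.i.d. according to $P_{XZ_1}P_{Y_1|Z_1}P_{Y_2}$. All logarithms are to base $2$, and $\log 0=-\infty$. A code of blocklength $n$ consists of a possibly stochastic encoder $\phi^{(n)}:\mathcal X^n\to\{0,\dots,\lfloor 2^{nR}\rfloor\}$ and deterministic decision functions $g_1^{(n)}:\mathcal Y_1^n\times\mathcal Z_1^n\times\{0,\dots,\lfloor 2^{nR}\rfloor\}\to\{0,1\}$ and $g_2^{(n)}:\mathcal Y_2^n\times\{0,\dots,\lfloor 2^{nR}\rfloor\}\to\{0,1\}$. With $M=\phi^{(n)}(X^n)$, $\hat{\mathcal H}_1=g_1^{(n)}(Y_1^n,Z_1^n,M)$ and $\hat{\mathcal H}_2=g_2^{(n)}(Y_2^n,M)$, put $\alpha_{i,n}=\Pr[\hat{\mathcal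 H}_i=1\mid\mathcal H=0]$ and $\beta_{i,n}=\Pr[\hat{\mathcal H}_i=0\mid\mathcal H=1]$ for $i\in\{1,2\}$. For $\epsilon\in(0,1)$, the tuple $(\theta_1,\theta_2,R)$ is $\epsilon$-achievable if there is a sequence of codes, one for each $n$, such that for $i\in\{1,2\}$ one has $\alpha_{i,n}\le\epsilon$ for all sufficiently large $n$, and $-\varlimsup_{n\to\infty}\frac1n\log\beta_{i,n}\ge\theta_i$. Let $\mathcal E_{\mathrm{HB}}(R)$ be the closure in $\mathbb R^2$ of the set of all pairs $(\theta_1,\theta_2)$ with $\theta_1,\theta_2\ge 0$ for which $(\theta_1,\theta_2,R)$ is $\epsilon$-achievable for every $\epsilon\in(0,1)$. Let $\mathcal E_{\mathrm{HB}}^{\mathrm{in}}(R)$ be the set of all pairs $(\theta_1,\theta_2)$ with $\theta_1,\theta_2\ge 0$ for which there are random variables $U_0,U_1$ on finite alphabets, jointly distributed with $(X,Y_1,Y_2,Z_1)\sim P_{XY_1Y_2Z_1}$, such that $(U_0,U_1)\to X\to(Y_1,Y_2,Z_1)$ is a Markov chain and $$\theta_1\le I(U_0,U_1;Y_1\mid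 Z_1),\qquad \theta_2\le I(U_0;Y_2),\qquad R\ge I(U_0;X)+I(U_1;X\mid U_0,Z_1).$$ Then $\mathcal E_{\mathrm{HB}}^{\mathrm{in}}(R)\subseteq\mathcal E_{\mathrm{HB}}(R)$. -/

import Mathlib

open Finset Filter Topology

noncomputable section

namespace HeegardBerger

/-! ### Finite random variables

A pmf on a finite type `Ω` is an element of `stdSimplex ℝ Ω`; a random variable on the finite
probability space `(Ω, Q)` is a function on `Ω`. -/

section Information

variable {Ω A B C : Type*} [Fintype Ω] [Fintype A] [Fintype B] [Fintype C]

open scoped Classical in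
/-- The law (pmf) of the random variable `f` on the finite probability space `(Ω, Q)`. -/
def law (Q : Ω → ℝ) (f : Ω → A) (a : A) : ℝ :=
  ∑ ω, if f ω = a then Q ω else 0

/-- The mutual information `I(f; g)` in bits. A summand with `P(a, b) = 0` is zero; otherwise
the denominator is positive. -/
def mutualInfo (Q : Ω → ℝ) (f : Ω → A) (g : Ω → B) : ℝ :=
  ∑ a, ∑ b, law Q (fun ω => (f ω, g ω)) (a, b) *
    Real.logb 2 (law Q (fun ω => (f ω, g ω)) (a, b) / (law Q f a * law Q g b))

/-- The conditional mutual information `I(f; g | h)` in bits, i.e. the expectation of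
`log₂ (P(a, b | c) / (P(a | c) P(b | c)))`. A summand with `P(a, b, c) = 0` is zero; otherwise
the denominator is positive. -/
def condMutualInfo (Q : Ω → ℝ) (f : Ω → A) (g : Ω → B) (h : Ω → C) : ℝ :=
  ∑ a, ∑ b, ∑ c, law Q (fun ω => (f ω, g ω, h ω)) (a, b, c) *
    Real.logb 2 (law Q h c * law Q (fun ω => (f ω, g ω, h ω)) (a, b, c) /
      (law Q (fun ω => (f ω, h ω)) (a, c) * law Q (fun ω => (g ω, h ω)) (b, c)))

/-- The Markov chain `f → g → h`: `f` and `h` are conditionally independent given `g`. -/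
def IsMarkovChain (Q : Ω → ℝ) (f : Ω → A) (g : Ω → B) (h : Ω → C) : Prop :=
  ∀ a b c, law Q (fun ω => (f ω, g ω, h ω)) (a, b, c) * law Q g b =
    law Q (fun ω => (f ω, g ω)) (a, b) * law Q (fun ω => (g ω, h ω)) (b, c)

/-- The pmf of `n` i.i.d. copies of a random variable with pmf `P`. -/
def iidPmf (P : A → ℝ) (n : ℕ) (w : Fin n → A) : ℝ :=
  ∏ i, P (w i)

end Information

/-! ### The hypothesis testing problem -/

variable {X Y₁ Y₂ Z₁ : Type*} [Fintype X] [Fintype Y₁] [Fintype Y₂] [Fintype Z₁]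

/-- The single-letter pmf `P_{X Z₁} · P_{Y₁ | Z₁} · P_{Y₂}` under the alternative hypothesis.
Where `P_{Z₁}` vanishes, so does `P_{X Z₁}`, and the value is zero. -/
def altPmf (P : X × Y₁ × Y₂ × Z₁ → ℝ) : X × Y₁ × Y₂ × Z₁ → ℝ :=
  fun (x, y₁, y₂, z₁) =>
    law P (fun (x, _, _, z₁) => (x, z₁)) (x, z₁) *
    (law P (fun (_, y₁, _, z₁) => (y₁, z₁)) (y₁, z₁) / law P (fun (_, _, _, z₁) => z₁) z₁) *
    law P (fun (_, _, y₂, _) => y₂) y₂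

/-- The set `{0, …, ⌊2 ^ (n R)⌋}` of messages. -/
abbrev Message (R : ℝ) (n : ℕ) : Type :=
  Fin (⌊(2 : ℝ) ^ ((n : ℝ) * R)⌋₊ + 1)

/-- A code of rate `R` and blocklength `n`: a stochastic encoding function (`enc x m` is the
probability that the message `m` is sent when `x` is observed) and the two decision functions. -/
structure Code (X Y₁ Y₂ Z₁ : Type*) (R : ℝ) (n : ℕ) where
  enc : (Fin n → X) → Message R n → ℝ
  enc_mem : ∀ x, enc x ∈ stdSimplex ℝ (Message R n)
  dec₁ : (Fin n → Y₁) → (Fin n → Z₁) → Message R n → Fin 2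
  dec₂ : (Fin n → Y₂) → Message R n → Fin 2

/-- The probability that Receiver 1 decides for `h` when the observations are i.i.d. `D`. -/
def Code.prob₁ {R : ℝ} {n : ℕ} (c : Code X Y₁ Y₂ Z₁ R n) (D : X × Y₁ × Y₂ × Z₁ → ℝ)
    (h : Fin 2) : ℝ :=
  ∑ w : Fin n → X × Y₁ × Y₂ × Z₁, iidPmf D n w *
    ∑ m, if c.dec₁ (fun i => (w i).2.1) (fun i => (w i).2.2.2) m = h
      then c.enc (fun i => (w i).1) m else 0

/-- The probability that Receiver 2 decides for `h` when the observations are i.i.d. `D`. -/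
def Code.prob₂ {R : ℝ} {n : ℕ} (c : Code X Y₁ Y₂ Z₁ R n) (D : X × Y₁ × Y₂ × Z₁ → ℝ)
    (h : Fin 2) : ℝ :=
  ∑ w : Fin n → X × Y₁ × Y₂ × Z₁, iidPmf D n w *
    ∑ m, if c.dec₂ (fun i => (w i).2.2.1) m = h
      then c.enc (fun i => (w i).1) m else 0

/-- The exponent `- limsup (1 / n) log₂ β_n`, with `log₂ 0 = -∞`. -/
def errorExponent (β : ℕ → ℝ) : EReal :=
  - limsup (fun n : ℕ => ((1 / (n : ℝ) : ℝ) : EReal) *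
      (ENNReal.log (ENNReal.ofReal (β n)) / ((Real.log 2 : ℝ) : EReal))) atTop

/-- The tuple `(θ₁, θ₂, R)` is `ε`-achievable: for some sequence of codes, the type-I error
probabilities are eventually at most `ε` and the type-II error exponents are at least `θ₁`, `θ₂`. -/
def Achievable (P : X × Y₁ × Y₂ × Z₁ → ℝ) (ε θ₁ θ₂ R : ℝ) : Prop :=
  ∃ c : ∀ n : ℕ, Code X Y₁ Y₂ Z₁ R n,
    (∀ᶠ n in atTop, (c n).prob₁ P 1 ≤ ε ∧ (c n).prob₂ P 1 ≤ ε) ∧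
    (θ₁ : EReal) ≤ errorExponent (fun n => (c n).prob₁ (altPmf P) 0) ∧
    (θ₂ : EReal) ≤ errorExponent (fun n => (c n).prob₂ (altPmf P) 0)

/-- The exponents region `E_HB(R)`. -/
def exponentsRegion (P : X × Y₁ × Y₂ × Z₁ → ℝ) (R : ℝ) : Set (ℝ × ℝ) :=
  closure {θ | 0 ≤ θ.1 ∧ 0 ≤ θ.2 ∧
    ∀ ε ∈ Set.Ioo (0 : ℝ) 1, Achievable P ε θ.1 θ.2 R}

/-- The region `E_HB^in(R)`. The auxiliary random variables `U₀`, `U₁` range over arbitrary finite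
alphabets; `Q` is the joint pmf of `((U₀, U₁), (X, Y₁, Y₂, Z₁))`. -/
def innerRegion (P : X × Y₁ × Y₂ × Z₁ → ℝ) (R : ℝ) : Set (ℝ × ℝ) :=
  {θ | 0 ≤ θ.1 ∧ 0 ≤ θ.2 ∧
    ∃ (k₀ k₁ : ℕ) (Q : (Fin k₀ × Fin k₁) × (X × Y₁ × Y₂ × Z₁) → ℝ),
      Q ∈ stdSimplex ℝ ((Fin k₀ × Fin k₁) × (X × Y₁ × Y₂ × Z₁)) ∧
      let rU₀ := fun ω : (Fin k₀ × Fin k₁) × (X × Y₁ × Y₂ × Z₁) => ω.1.1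
      let rU₁ := fun ω : (Fin k₀ × Fin k₁) × (X × Y₁ × Y₂ × Z₁) => ω.1.2
      let rX := fun ω : (Fin k₀ × Fin k₁) × (X × Y₁ × Y₂ × Z₁) => ω.2.1
      let rY₁ := fun ω : (Fin k₀ × Fin k₁) × (X × Y₁ × Y₂ × Z₁) => ω.2.2.1
      let rY₂ := fun ω : (Fin k₀ × Fin k₁) × (X × Y₁ × Y₂ × Z₁) => ω.2.2.2.1
      let rZ₁ := fun ω : (Fin k₀ × Fin k₁) × (X × Y₁ × Y₂ × Z₁) => ω.2.2.2.2
      law Q (fun ω => (rX ω, rY₁ ω, rY₂ ω, rZ₁ ω)) = P ∧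
      IsMarkovChain Q (fun ω => (rU₀ ω, rU₁ ω)) rX (fun ω => (rY₁ ω, rY₂ ω, rZ₁ ω)) ∧
      θ.1 ≤ condMutualInfo Q (fun ω => (rU₀ ω, rU₁ ω)) rY₁ rZ₁ ∧
      θ.2 ≤ mutualInfo Q rU₀ rY₂ ∧
      mutualInfo Q rU₀ rX + condMutualInfo Q rU₁ rX (fun ω => (rU₀ ω, rZ₁ ω)) ≤ R}

end HeegardBerger

end

set_option linter.unusedSectionVars false

namespace HeegardBerger

noncomputable section

/-! The proof treats blocks of fixed length b as single letters, so that i.i.d. arguments across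
blocks replace conditional typicality. On one block, a superposition quantizer gives the source word
labels `f₀` and `f₁`, with about 2^(b I(U₀;X)) and 2^(b I(U₁;X|U₀)) values, such that the
position-averaged joint law of codeword symbols and observations (`avgLaw`) is as close to Q as
desired (`exists_quantizer`, `abs_avgLaw_sub_le`). Over k blocks the labels `f₀` are sent in full,
and the sequence of labels `f₁` is hashed into about 2^(kr) bins with r ≈ b I(U₁;X|U₀,Z₁).

Both receivers threshold products of densities with mean at most one under the alternative, so
type-II errors follow from Markov's inequality; type-I errors follow from the weak law, because the
expected logarithms under the null are the exponents. Receiver 2 uses P(y₂|u₀)/P(y₂) multiplied over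
positions, and receiver 1 uses `d`, the product of P(y₁|u₀,u₁,z₁)/P(y₁|z₁).

Receiver 1 must also resist wrong labels in the announced bin. For this it uses a second density e =
d·g whose sum over all second labels still has mean at most one, at the price of an exponent E₁ - r.
Random binning contributes 2^(-kr), which restores E₁ (`exists_binning`,
`BlockScheme.exists_tests`). Two facts make e work. Given the words of X and Z₁, `d` has alternative
mean at most one for every second label, correct or not (`exists_density₁`). The density g counts
plausible labels, and its expected logarithm is controlled by a lower bound on the entropy of `f₀`
together with the word of Z₁ (`le_ent_label`, `exists_binDensity`).

For general blocklength N, as many blocks are used as the message set permits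
(`BlockScheme.achievable`). The part of the word left unused and the slack in the exponents vanish
as δ → 0, and the closure in the definition of the region absorbs them. -/

open scoped Classical in
/-- The real-valued indicator of a proposition. -/
def ind (p : Prop) : ℝ := if p then 1 else 0

lemma ind_of {p : Prop} (h : p) : ind p = 1 := if_pos h

lemma ind_of_not {p : Prop} (h : ¬p) : ind p = 0 := if_neg h

lemma ind_nonneg (p : Prop) : 0 ≤ ind p := by
  unfold ind; split_ifs <;> norm_num

lemma ind_le_one (p : Prop) : ind p ≤ 1 := by
  unfold ind; split_ifs <;> norm_num

lemma ind_mono {p q : Prop} (h : p → q) : ind p ≤ ind q := by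
  unfold ind; split_ifs <;> first | (exfalso; tauto) | norm_num

lemma ind_and (p q : Prop) : ind (p ∧ q) = ind p * ind q := by
  unfold ind; split_ifs <;> first | (exfalso; tauto) | norm_num

lemma ind_not (p : Prop) : ind (¬p) = 1 - ind p := by
  unfold ind; split_ifs <;> norm_num

lemma ind_or_le (p q : Prop) : ind (p ∨ q) ≤ ind p + ind q := by
  unfold ind; split_ifs <;> first | (exfalso; tauto) | norm_num

lemma ind_exists_le {ι : Type*} [Fintype ι] (p : ι → Prop) : ind (∃ i, p i) ≤ ∑ i, ind (p i) := by
  by_cases h : ∃ i, p i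
  · obtain ⟨i, hi⟩ := h
    rw [ind_of ⟨i, hi⟩, ← ind_of hi]
    exact single_le_sum (f := fun i => ind (p i)) (fun i _ => ind_nonneg _) (mem_univ i)
  · rw [ind_of_not h]
    exact sum_nonneg fun i _ => ind_nonneg _

lemma prod_ind {ι : Type*} [Fintype ι] (p : ι → Prop) : ∏ i, ind (p i) = ind (∀ i, p i) := by
  by_cases h : ∀ i, p i
  · rw [ind_of h]; exact prod_eq_one fun i _ => ind_of (h i)
  · rw [ind_of_not h]; push Not at h
    obtain ⟨i, hi⟩ := h
    exact prod_eq_zero (mem_univ i) (ind_of_not hi)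

lemma sum_mul_ind_eq {A : Type*} [Fintype A] (h : A → ℝ) (a : A) :
    ∑ x, h x * ind (a = x) = h a := by
  rw [sum_eq_single a]
  · rw [ind_of rfl, mul_one]
  · intro b _ hb; rw [ind_of_not (Ne.symm hb), mul_zero]
  · simp

/-! ### Laws and marginals of finite random variables. -/

section Law

variable {Ω A B C : Type*} [Fintype Ω] [Fintype A] [Fintype B] [Fintype C] {Q : Ω → ℝ}

lemma law_eq (Q : Ω → ℝ) (f : Ω → A) (a : A) : law Q f a = ∑ ω, Q ω * ind (f ω = a) := by
  unfold law ind
  refine sum_congr rfl fun ω _ => ?_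
  split_ifs <;> simp

lemma sum_law_mul (Q : Ω → ℝ) (f : Ω → A) (h : A → ℝ) :
    ∑ a, law Q f a * h a = ∑ ω, Q ω * h (f ω) := by
  simp_rw [law_eq, sum_mul]
  rw [sum_comm]
  refine sum_congr rfl fun ω _ => ?_
  rw [← sum_mul_ind_eq h (f ω), mul_sum]
  exact sum_congr rfl fun a _ => by ring

lemma sum_law (Q : Ω → ℝ) (f : Ω → A) : ∑ a, law Q f a = ∑ ω, Q ω := by
  simpa using sum_law_mul Q f fun _ => 1

lemma law_nonneg (hQ : ∀ ω, 0 ≤ Q ω) (f : Ω → A) (a : A) : 0 ≤ law Q f a := by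
  rw [law_eq]; exact sum_nonneg fun ω _ => mul_nonneg (hQ ω) (ind_nonneg _)

lemma le_law (hQ : ∀ ω, 0 ≤ Q ω) (f : Ω → A) (ω : Ω) : Q ω ≤ law Q f (f ω) := by
  rw [law_eq]
  have := single_le_sum (f := fun ω' => Q ω' * ind (f ω' = f ω))
    (fun i _ => mul_nonneg (hQ i) (ind_nonneg _)) (mem_univ ω)
  simpa [ind_of] using this

lemma law_pos (hQ : ∀ ω, 0 ≤ Q ω) (f : Ω → A) {ω : Ω} (h : 0 < Q ω) : 0 < law Q f (f ω) :=
  h.trans_le (le_law hQ f ω)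

lemma law_law (Q : Ω → ℝ) (f : Ω → A) (g : A → B) :
    law (law Q f) g = law Q (fun ω => g (f ω)) := by
  ext b
  rw [law_eq, law_eq, sum_law_mul Q f fun a => ind (g a = b)]

lemma law_id (Q : Ω → ℝ) : law Q (fun ω => ω) = Q := by
  ext a
  rw [law_eq]
  simpa only [eq_comm] using sum_mul_ind_eq Q a

lemma law_mem (hQ : Q ∈ stdSimplex ℝ Ω) (f : Ω → A) : law Q f ∈ stdSimplex ℝ A :=
  ⟨law_nonneg hQ.1 f, by rw [sum_law, hQ.2]⟩

lemma law_fst (Q : Ω → ℝ) (f : Ω → A) (g : Ω → B) (a : A) :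
    ∑ b, law Q (fun ω => (f ω, g ω)) (a, b) = law Q f a := by
  simp_rw [law_eq]
  rw [sum_comm]
  refine sum_congr rfl fun ω _ => ?_
  rw [← mul_sum]
  simp_rw [Prod.mk.injEq, ind_and]
  rw [sum_mul_ind_eq (fun _ => ind (f ω = a)) (g ω)]

lemma law_snd (Q : Ω → ℝ) (f : Ω → A) (g : Ω → B) (b : B) :
    ∑ a, law Q (fun ω => (f ω, g ω)) (a, b) = law Q g b := by
  simp_rw [law_eq]
  rw [sum_comm]
  refine sum_congr rfl fun ω _ => ?_
  rw [← mul_sum]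
  simp_rw [Prod.mk.injEq, ind_and, mul_comm (ind (f ω = _))]
  rw [sum_mul_ind_eq (fun _ => ind (g ω = b)) (f ω)]

lemma law_comp_injective (Q : Ω → ℝ) (f : Ω → A) {e : A → B} (he : Function.Injective e) (a : A) :
    law Q (fun ω => e (f ω)) (e a) = law Q f a := by
  simp_rw [law_eq, he.eq_iff]

end Law

/-! ### I.i.d. words: sums along fibres, Chebyshev's inequality, weak law of large numbers. -/

section Product

variable {ι A B : Type*} [Fintype ι] [DecidableEq ι] [Fintype A] [Fintype B]

/-- Once the projected word is fixed, the sum over its fibre factors over positions, even though `φ`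
and every `h x i` may depend on the whole projected word. This allows letterwise computation with
encoders that see an entire block. -/
lemma sum_prod_fiber (π : A → B) (φ : (ι → B) → ℝ) (h : (ι → B) → ι → A → ℝ) :
    ∑ v : ι → A, φ (fun i => π (v i)) * ∏ i, h (fun i => π (v i)) i (v i) =
      ∑ x : ι → B, φ x * ∏ i, ∑ a, h x i a * ind (π a = x i) := by
  have h1 : ∀ x : ι → B, ∏ i, ∑ a, h x i a * ind (π a = x i) =
      ∑ v : ι → A, ∏ i, (h x i (v i) * ind (π (v i) = x i)) := fun x => by
    rw [prod_univ_sum, Fintype.piFinset_univ]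
  simp_rw [h1, mul_sum, prod_mul_distrib, prod_ind]
  rw [sum_comm]
  refine sum_congr rfl fun v _ => ?_
  rw [← sum_mul_ind_eq (fun x => φ x * ∏ i, h x i (v i)) (fun i => π (v i))]
  refine sum_congr rfl fun x _ => ?_
  rw [mul_assoc, funext_iff]

lemma sum_prod_eq (h : ι → A → ℝ) : ∑ v : ι → A, ∏ i, h i (v i) = ∏ i, ∑ a, h i a := by
  rw [prod_univ_sum, Fintype.piFinset_univ]

variable {P : A → ℝ} {n : ℕ}

lemma iidPmf_nonneg (hP : ∀ a, 0 ≤ P a) (w : Fin n → A) : 0 ≤ iidPmf P n w :=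
  prod_nonneg fun _ _ => hP _

lemma iidPmf_mem (hP : P ∈ stdSimplex ℝ A) (n : ℕ) : iidPmf P n ∈ stdSimplex ℝ (Fin n → A) := by
  refine ⟨iidPmf_nonneg hP.1, ?_⟩
  unfold iidPmf
  rw [sum_prod_eq fun _ => P, hP.2]
  simp

lemma pos_of_iidPmf_pos (hP : ∀ a, 0 ≤ P a) {w : Fin n → A} (h : 0 < iidPmf P n w) (i : Fin n) :
    0 < P (w i) := by
  refine lt_of_le_of_ne (hP _) fun h0 => h.ne' ?_
  exact prod_eq_zero (mem_univ i) h0.symm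

lemma sum_iidPmf_fiber (P : A → ℝ) (π : A → B) (φ : (Fin n → B) → ℝ) :
    ∑ v, iidPmf P n v * φ (fun i => π (v i)) = ∑ x, iidPmf (law P π) n x * φ x := by
  have := sum_prod_fiber (ι := Fin n) π φ fun _ _ => P
  simp_rw [← law_eq] at this
  unfold iidPmf
  simp_rw [mul_comm _ (φ _)]
  exact this

/-- The second moment of a sum of centered i.i.d. random variables. -/
lemma sum_iidPmf_mul_sq (hP : ∑ a, P a = 1) {g : A → ℝ} (hg : ∑ a, P a * g a = 0) (n : ℕ) :
    ∑ w, iidPmf P n w * (∑ i, g (w i)) = 0 ∧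
    ∑ w, iidPmf P n w * (∑ i, g (w i)) ^ 2 = n * ∑ a, P a * g a ^ 2 := by
  induction n with
  | zero => simp [iidPmf]
  | succ n ih =>
    have key : ∀ F : (Fin (n + 1) → A) → ℝ, ∑ w, F w = ∑ a, ∑ w : Fin n → A, F (Fin.cons a w) :=
      fun F => by
        rw [← (Fin.consEquiv fun _ => A).sum_comp, Fintype.sum_prod_type]
        rfl
    have hs : ∑ w, iidPmf P n w = 1 := by
      unfold iidPmf; rw [sum_prod_eq fun _ => P, hP]; simp
    have e1 : ∀ (a : A) (w : Fin n → A), iidPmf P (n + 1) (Fin.cons a w) = P a * iidPmf P n w :=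
      fun a w => by simp [iidPmf, Fin.prod_univ_succ]
    rw [key, key]
    simp_rw [e1, Fin.sum_univ_succ, Fin.cons_zero, Fin.cons_succ]
    constructor
    · have : ∀ a, ∑ w, P a * iidPmf P n w * (g a + ∑ i, g (w i)) =
          P a * g a * ∑ w, iidPmf P n w + P a * ∑ w, iidPmf P n w * ∑ i, g (w i) := fun a => by
        rw [mul_sum, mul_sum, ← sum_add_distrib]
        exact sum_congr rfl fun w _ => by ring
      simp_rw [this, ih.1, hs]
      simpa using hg
    · have : ∀ a, ∑ w, P a * iidPmf P n w * (g a + ∑ i, g (w i)) ^ 2 =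
          P a * g a ^ 2 * ∑ w, iidPmf P n w + 2 * P a * g a * ∑ w, iidPmf P n w * ∑ i, g (w i) +
            P a * ∑ w, iidPmf P n w * (∑ i, g (w i)) ^ 2 := fun a => by
        rw [mul_sum, mul_sum, mul_sum, ← sum_add_distrib, ← sum_add_distrib]
        exact sum_congr rfl fun w _ => by ring
      simp_rw [this, ih.1, hs, ih.2, mul_one, mul_zero, add_zero, sum_add_distrib, ← sum_mul, hP]
      push_cast; ring

/-- Chebyshev's inequality for i.i.d. sums. -/
lemma sum_iidPmf_deviation_le (hP : P ∈ stdSimplex ℝ A) (g : A → ℝ) {δ : ℝ} (hδ : 0 < δ) (n : ℕ) :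
    ∑ w, iidPmf P n w * ind (n * δ < |∑ i, g (w i) - n * ∑ a, P a * g a|) ≤
      (∑ a, P a * (g a - ∑ a, P a * g a) ^ 2) / (n * δ ^ 2) := by
  set E := ∑ a, P a * g a with hE
  have h0 : ∑ a, P a * (g a - E) = 0 := by
    simp_rw [mul_sub, sum_sub_distrib, ← sum_mul, hP.2]; simp [hE]
  have h2 := (sum_iidPmf_mul_sq hP.2 h0 n).2
  -- For n = 0 both sides are zero, the right one because division by zero gives zero.
  rcases Nat.eq_zero_or_pos n with rfl | hn
  · simp [ind]
  have hn' : (0 : ℝ) < n := by exact_mod_cast hn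
  rw [le_div_iff₀ (by positivity), sum_mul]
  refine le_of_mul_le_mul_left ?_ hn'
  rw [← h2, mul_sum]
  refine sum_le_sum fun w _ => ?_
  have hw := iidPmf_nonneg hP.1 w
  have e : ∑ i, (g (w i) - E) = ∑ i, g (w i) - n * E := by simp [sum_sub_distrib]
  rw [e]
  by_cases h : n * δ < |∑ i, g (w i) - n * E|
  · rw [ind_of h]
    have : (n * δ) ^ 2 ≤ (∑ i, g (w i) - n * E) ^ 2 := by
      rw [← sq_abs (∑ i, g (w i) - n * E)]
      exact pow_le_pow_left₀ (by positivity) h.le 2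
    calc _ = iidPmf P n w * (n * δ) ^ 2 := by ring
      _ ≤ _ := mul_le_mul_of_nonneg_left this hw
  · rw [ind_of_not h]
    have : 0 ≤ iidPmf P n w * (∑ i, g (w i) - n * E) ^ 2 := by positivity
    simpa using this

/-- The weak law of large numbers for finitely many functions of i.i.d. random variables. -/
lemma tendsto_sum_iidPmf_deviation {J : Type*} [Fintype J] (hP : P ∈ stdSimplex ℝ A)
    (g : J → A → ℝ) {δ : ℝ} (hδ : 0 < δ) :
    Tendsto (fun n : ℕ => ∑ w, iidPmf P n w *
      ind (∃ j, n * δ < |∑ i, g j (w i) - n * ∑ a, P a * g j a|)) atTop (𝓝 0) := by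
  refine squeeze_zero (g := fun n : ℕ =>
    ∑ j, ((∑ a, P a * (g j a - ∑ a, P a * g j a) ^ 2) / δ ^ 2) / n) ?_ ?_ ?_
  · exact fun n => sum_nonneg fun w _ => mul_nonneg (iidPmf_nonneg hP.1 w) (ind_nonneg _)
  · intro n
    calc _ ≤ ∑ w, iidPmf P n w *
            ∑ j, ind (n * δ < |∑ i, g j (w i) - n * ∑ a, P a * g j a|) :=
          sum_le_sum fun w _ =>
            mul_le_mul_of_nonneg_left (ind_exists_le _) (iidPmf_nonneg hP.1 w)
      _ = ∑ j, ∑ w, iidPmf P n w * ind (n * δ < |∑ i, g j (w i) - n * ∑ a, P a * g j a|) := by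
          simp_rw [mul_sum]; rw [sum_comm]
      _ ≤ _ := sum_le_sum fun j _ => by
          refine (sum_iidPmf_deviation_le hP (g j) hδ n).trans_eq ?_
          rw [div_div, mul_comm (n : ℝ)]
  · rw [show (0 : ℝ) = ∑ _j : J, 0 by simp]
    exact tendsto_finsetSum _ fun j _ => tendsto_const_div_atTop_nhds_zero_nat _

end Product

/-! ### Gibbs' inequality, entropy, and Markov chains in entropy form. -/

/-- Gibbs' inequality. -/
lemma sum_mul_logb_nonpos {Ω : Type*} [Fintype Ω] {P r : Ω → ℝ} (hP : P ∈ stdSimplex ℝ Ω)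
    (hr : ∀ ω, 0 < P ω → 0 < r ω) (h : ∑ ω, P ω * r ω ≤ 1) :
    ∑ ω, P ω * Real.logb 2 (r ω) ≤ 0 := by
  have h2 : 0 < Real.log 2 := Real.log_pos (by norm_num)
  have : ∑ ω, P ω * Real.log (r ω) ≤ 0 := by
    calc _ ≤ ∑ ω, (P ω * r ω - P ω) := sum_le_sum fun ω _ => by
            rcases (hP.1 ω).eq_or_lt with h0 | h0
            · simp [← h0]
            · have := mul_le_mul_of_nonneg_left (Real.log_le_sub_one_of_pos (hr ω h0)) h0.le
              linarith
      _ ≤ 0 := by rw [sum_sub_distrib, hP.2]; linarith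
  simp_rw [Real.logb, ← mul_div_assoc, ← sum_div]
  exact div_nonpos_of_nonpos_of_nonneg this h2.le

section Entropy

variable {Ω A B C D : Type*} [Fintype Ω] [Fintype A] [Fintype B] [Fintype C] [Fintype D]
  {Q : Ω → ℝ}

/-- The entropy of the random variable `f` in bits. -/
def ent (Q : Ω → ℝ) (f : Ω → A) : ℝ := -∑ ω, Q ω * Real.logb 2 (law Q f (f ω))

lemma ent_eq (Q : Ω → ℝ) (f : Ω → A) : ent Q f = (∑ a, (law Q f a).negMulLog) / Real.log 2 := by
  unfold ent
  rw [← sum_law_mul Q f fun a => Real.logb 2 (law Q f a), sum_div, ← sum_neg_distrib]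
  refine sum_congr rfl fun a _ => ?_
  rw [Real.negMulLog, Real.logb]; ring

/-- The form with `negMulLog` is continuous also where probabilities vanish. Continuity is what
transfers exponents from Q to the nearby law realized by a quantizer. -/
lemma continuous_ent (f : Ω → A) : Continuous fun Q : Ω → ℝ => ent Q f := by
  simp_rw [ent_eq, law_eq]
  refine Continuous.div_const (continuous_finsetSum _ fun a _ => ?_) _
  exact Real.continuous_negMulLog.comp (by fun_prop)

lemma ent_comp_injective (Q : Ω → ℝ) (f : Ω → A) {e : A → B} (he : Function.Injective e) :
    ent Q (fun ω => e (f ω)) = ent Q f := by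
  unfold ent
  simp_rw [law_comp_injective Q f he]

lemma ent_law (Q : Ω → ℝ) (f : Ω → A) (g : A → B) :
    ent (law Q f) g = ent Q (fun ω => g (f ω)) := by
  unfold ent
  rw [law_law, sum_law_mul Q f fun a => Real.logb 2 (law Q (fun ω => g (f ω)) (g a))]

lemma condMutualInfo_eq_sum (Q : Ω → ℝ) (f : Ω → A) (g : Ω → B) (h : Ω → C) :
    condMutualInfo Q f g h = ∑ ω, Q ω * Real.logb 2
      (law Q h (h ω) * law Q (fun ω => (f ω, g ω, h ω)) (f ω, g ω, h ω) /
        (law Q (fun ω => (f ω, h ω)) (f ω, h ω) * law Q (fun ω => (g ω, h ω)) (g ω, h ω))) := by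
  unfold condMutualInfo
  rw [← sum_law_mul Q (fun ω => (f ω, g ω, h ω)) fun t => Real.logb 2
    (law Q h t.2.2 * law Q (fun ω => (f ω, g ω, h ω)) t /
        (law Q (fun ω => (f ω, h ω)) (t.1, t.2.2) * law Q (fun ω => (g ω, h ω)) t.2)),
    Fintype.sum_prod_type]
  simp_rw [Fintype.sum_prod_type]

lemma mutualInfo_eq_sum (Q : Ω → ℝ) (f : Ω → A) (g : Ω → B) :
    mutualInfo Q f g = ∑ ω, Q ω * Real.logb 2
      (law Q (fun ω => (f ω, g ω)) (f ω, g ω) / (law Q f (f ω) * law Q g (g ω))) := by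
  unfold mutualInfo
  rw [← sum_law_mul Q (fun ω => (f ω, g ω)) fun t => Real.logb 2
    (law Q (fun ω => (f ω, g ω)) t / (law Q f t.1 * law Q g t.2)), Fintype.sum_prod_type]

lemma condMutualInfo_eq (hQ : ∀ ω, 0 ≤ Q ω) (f : Ω → A) (g : Ω → B) (h : Ω → C) :
    condMutualInfo Q f g h = ent Q (fun ω => (f ω, h ω)) + ent Q (fun ω => (g ω, h ω)) -
      ent Q h - ent Q (fun ω => (f ω, g ω, h ω)) := by
  rw [condMutualInfo_eq_sum]
  unfold ent
  rw [sub_eq_add_neg, sub_eq_add_neg, neg_neg, neg_neg, ← neg_add, ← sum_add_distrib,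
    ← sum_neg_distrib, ← sum_add_distrib, ← sum_add_distrib]
  refine sum_congr rfl fun ω _ => ?_
  rcases (hQ ω).eq_or_lt with h0 | h0
  · simp [← h0]
  have h1 := (law_pos hQ h h0).ne'
  have h2 := (law_pos hQ (fun ω => (f ω, g ω, h ω)) h0).ne'
  have h3 := (law_pos hQ (fun ω => (f ω, h ω)) h0).ne'
  have h4 := (law_pos hQ (fun ω => (g ω, h ω)) h0).ne'
  rw [Real.logb_div (mul_ne_zero h1 h2) (mul_ne_zero h3 h4), Real.logb_mul h1 h2,
    Real.logb_mul h3 h4]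
  ring

lemma mutualInfo_eq (hQ : ∀ ω, 0 ≤ Q ω) (f : Ω → A) (g : Ω → B) :
    mutualInfo Q f g = ent Q f + ent Q g - ent Q (fun ω => (f ω, g ω)) := by
  rw [mutualInfo_eq_sum]
  unfold ent
  rw [sub_eq_add_neg, neg_neg, ← neg_add, ← sum_add_distrib, ← sum_neg_distrib, ← sum_add_distrib]
  refine sum_congr rfl fun ω _ => ?_
  rcases (hQ ω).eq_or_lt with h0 | h0
  · simp [← h0]
  have h2 := (law_pos hQ (fun ω => (f ω, g ω)) h0).ne'
  have h3 := (law_pos hQ f h0).ne'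
  have h4 := (law_pos hQ g h0).ne'
  rw [Real.logb_div h2 (mul_ne_zero h3 h4), Real.logb_mul h3 h4]
  ring

/-- Gibbs' inequality for the reciprocal of the information density: its mean is at most the sum
over (a, b, c) of P(a,c)P(b,c)/P(c), which collapses to the total mass of the law of `h`. -/
lemma condMutualInfo_nonneg (hQ : Q ∈ stdSimplex ℝ Ω) (f : Ω → A) (g : Ω → B) (h : Ω → C) :
    0 ≤ condMutualInfo Q f g h := by
  rw [condMutualInfo_eq_sum]
  set lh := law Q h with hlh
  set lt := law Q (fun ω => (f ω, g ω, h ω)) with hlt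
  set lf := law Q (fun ω => (f ω, h ω)) with hlf
  set lg := law Q (fun ω => (g ω, h ω)) with hlg
  have key := sum_mul_logb_nonpos (r := fun ω => lf (f ω, h ω) * lg (g ω, h ω) /
    (lh (h ω) * lt (f ω, g ω, h ω))) hQ ?_ ?_
  · rw [← neg_nonpos, ← sum_neg_distrib]
    refine le_trans (le_of_eq (sum_congr rfl fun ω _ => ?_)) key
    rw [← mul_neg, ← Real.logb_inv, inv_div]
  · intro ω h0
    have h1 := law_pos hQ.1 h h0
    have h2 := law_pos hQ.1 (fun ω => (f ω, g ω, h ω)) h0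
    have h3 := law_pos hQ.1 (fun ω => (f ω, h ω)) h0
    have h4 := law_pos hQ.1 (fun ω => (g ω, h ω)) h0
    positivity
  · rw [← sum_law_mul Q (fun ω => (f ω, g ω, h ω)) fun t =>
      lf (t.1, t.2.2) * lg t.2 / (lh t.2.2 * lt t)]
    have nh : ∀ c, 0 ≤ lh c := law_nonneg hQ.1 _
    have nt : ∀ c, 0 ≤ lt c := law_nonneg hQ.1 _
    have nf : ∀ c, 0 ≤ lf c := law_nonneg hQ.1 _
    have ng : ∀ c, 0 ≤ lg c := law_nonneg hQ.1 _
    calc _ ≤ ∑ t : A × B × C, lf (t.1, t.2.2) * lg t.2 / lh t.2.2 := by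
          refine sum_le_sum fun t _ => ?_
          rcases (nt t).eq_or_lt with h0 | h0
          · rw [← hlt, ← h0, zero_mul]
            exact div_nonneg (mul_nonneg (nf _) (ng _)) (nh _)
          · rw [← hlt]
            refine le_of_eq ?_
            rw [mul_comm (lh _), ← div_div]
            field_simp
      _ = ∑ c, lh c * lh c / lh c := by
          rw [Fintype.sum_prod_type]
          simp_rw [Fintype.sum_prod_type]
          rw [sum_congr rfl fun a _ => sum_comm, sum_comm]
          refine sum_congr rfl fun c _ => ?_
          simp_rw [← sum_div, ← mul_sum, ← sum_mul]
          rw [hlf, hlg, law_snd, law_snd]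
      _ = ∑ c, lh c := sum_congr rfl fun c _ => mul_self_div_self _
      _ ≤ 1 := by rw [hlh, sum_law, hQ.2]

lemma ent_const (hQ : ∑ ω, Q ω = 1) : ent Q (fun _ => ()) = 0 := by
  have : ∀ a, law Q (fun _ => ()) a = 1 := fun a => by simp [law_eq, ind, hQ]
  simp [ent, this]

lemma mutualInfo_nonneg (hQ : Q ∈ stdSimplex ℝ Ω) (f : Ω → A) (g : Ω → B) :
    0 ≤ mutualInfo Q f g := by
  have h := condMutualInfo_nonneg hQ f g fun _ => ()
  rw [condMutualInfo_eq hQ.1, ent_const hQ.2] at h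
  have h1 := ent_comp_injective Q f (e := fun a => (a, ())) fun a b h => (Prod.mk.inj h).1
  have h2 := ent_comp_injective Q g (e := fun a => (a, ())) fun a b h => (Prod.mk.inj h).1
  have h3 := ent_comp_injective Q (fun ω => (f ω, g ω))
    (e := fun a => (a.1, a.2, ())) fun a b h => by simpa [Prod.ext_iff] using h
  rw [mutualInfo_eq hQ.1]
  simp only at h1 h2 h3
  linarith

/-- In this form the Markov property is a linear relation between entropies, so later information
identities reduce to linear arithmetic. -/
lemma IsMarkovChain.ent_eq {f : Ω → A} {g : Ω → B} {h : Ω → C} (hQ : ∀ ω, 0 ≤ Q ω)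
    (hM : IsMarkovChain Q f g h) :
    ent Q (fun ω => (f ω, g ω, h ω)) + ent Q g =
      ent Q (fun ω => (f ω, g ω)) + ent Q (fun ω => (g ω, h ω)) := by
  unfold ent
  rw [← neg_add, ← neg_add, ← sum_add_distrib, ← sum_add_distrib]
  refine congrArg _ (sum_congr rfl fun ω _ => ?_)
  rcases (hQ ω).eq_or_lt with h0 | h0
  · simp [← h0]
  have h1 := (law_pos hQ g h0).ne'
  have h2 := (law_pos hQ (fun ω => (f ω, g ω, h ω)) h0).ne'
  have h3 := (law_pos hQ (fun ω => (f ω, g ω)) h0).ne'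
  have h4 := (law_pos hQ (fun ω => (g ω, h ω)) h0).ne'
  rw [← mul_add, ← mul_add, ← Real.logb_mul h2 h1, ← Real.logb_mul h3 h4, hM]

lemma IsMarkovChain.comp_right {f : Ω → A} {g : Ω → B} {h : Ω → C} (hM : IsMarkovChain Q f g h)
    (ψ : C → D) : IsMarkovChain Q f g (fun ω => ψ (h ω)) := by
  intro a b d
  have e1 : law Q (fun ω => (f ω, g ω, ψ (h ω))) (a, b, d) =
      ∑ c, law Q (fun ω => (f ω, g ω, h ω)) (a, b, c) * ind (ψ c = d) := by
    simp_rw [law_eq, sum_mul]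
    rw [sum_comm]
    refine sum_congr rfl fun ω _ => ?_
    simp_rw [Prod.mk.injEq, ind_and]
    rw [← sum_mul_ind_eq (fun c => ind (ψ c = d)) (h ω), mul_sum, mul_sum, mul_sum]
    exact sum_congr rfl fun c _ => by ring
  have e2 : law Q (fun ω => (g ω, ψ (h ω))) (b, d) =
      ∑ c, law Q (fun ω => (g ω, h ω)) (b, c) * ind (ψ c = d) := by
    simp_rw [law_eq, sum_mul]
    rw [sum_comm]
    refine sum_congr rfl fun ω _ => ?_
    simp_rw [Prod.mk.injEq, ind_and]
    rw [← sum_mul_ind_eq (fun c => ind (ψ c = d)) (h ω), mul_sum, mul_sum]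
    exact sum_congr rfl fun c _ => by ring
  rw [e1, e2, sum_mul, mul_sum]
  refine sum_congr rfl fun c _ => ?_
  rw [mul_right_comm, hM]; ring

lemma IsMarkovChain.comp_left {f : Ω → A} {g : Ω → B} {h : Ω → C} (hM : IsMarkovChain Q f g h)
    (ψ : A → D) : IsMarkovChain Q (fun ω => ψ (f ω)) g h := by
  intro d b c
  have e1 : law Q (fun ω => (ψ (f ω), g ω, h ω)) (d, b, c) =
      ∑ a, law Q (fun ω => (f ω, g ω, h ω)) (a, b, c) * ind (ψ a = d) := by
    simp_rw [law_eq, sum_mul]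
    rw [sum_comm]
    refine sum_congr rfl fun ω _ => ?_
    simp_rw [Prod.mk.injEq, ind_and]
    rw [← sum_mul_ind_eq (fun a => ind (ψ a = d)) (f ω), sum_mul, mul_sum]
    exact sum_congr rfl fun a _ => by ring
  have e2 : law Q (fun ω => (ψ (f ω), g ω)) (d, b) =
      ∑ a, law Q (fun ω => (f ω, g ω)) (a, b) * ind (ψ a = d) := by
    simp_rw [law_eq, sum_mul]
    rw [sum_comm]
    refine sum_congr rfl fun ω _ => ?_
    simp_rw [Prod.mk.injEq, ind_and]
    rw [← sum_mul_ind_eq (fun a => ind (ψ a = d)) (f ω), sum_mul, mul_sum]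
    exact sum_congr rfl fun a _ => by ring
  rw [e1, e2, sum_mul, sum_mul]
  refine sum_congr rfl fun a _ => ?_
  rw [mul_right_comm, hM]; ring

end Entropy

/-! ### One-shot covering by random codebooks. -/

section Covering

variable {A U U₀ U₁ : Type*} [Fintype A] [Fintype U] [Fintype U₀] [Fintype U₁]

lemma exists_le_of_sum_mul_le {C : Type*} [Fintype C] {w : C → ℝ} (hw : w ∈ stdSimplex ℝ C)
    {F : C → ℝ} {K : ℝ} (h : ∑ c, w c * F c ≤ K) : ∃ c, F c ≤ K := by
  by_contra! hF
  have h1 : ∑ c, w c * (F c - K) ≤ 0 := by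
    simp_rw [mul_sub, sum_sub_distrib, ← sum_mul, hw.2]; linarith
  have h2 := (sum_eq_zero_iff_of_nonneg fun c _ =>
    mul_nonneg (hw.1 c) (sub_nonneg.2 (hF c).le)).1
    (le_antisymm h1 (sum_nonneg fun c _ => mul_nonneg (hw.1 c) (sub_nonneg.2 (hF c).le)))
  have h3 : ∀ c, w c = 0 := fun c =>
    (mul_eq_zero.1 (h2 c (mem_univ c))).resolve_right (sub_pos.2 (hF c)).ne'
  have := hw.2
  simp [h3] at this

/-- Bound 1 - p by exp(-αw), then use convexity: as a function of w on [0, 1], exp(-mαw) lies below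
the chord joining its endpoint values 1 and exp(-mα). -/
lemma one_sub_pow_le {p w α : ℝ} (hw : w ∈ Set.Icc (0 : ℝ) 1) (hp1 : p ≤ 1)
    (hp : α * w ≤ p) (m : ℕ) : (1 - p) ^ m ≤ 1 - w + Real.exp (-(m * α)) := by
  have h1 : (1 - p) ^ m ≤ Real.exp (-(α * w)) ^ m := by
    refine pow_le_pow_left₀ (by linarith) ?_ m
    have := Real.add_one_le_exp (-(α * w))
    linarith
  have h2 : Real.exp (-(α * w)) ^ m = Real.exp ((1 - w) • (0 : ℝ) + w • (-(m * α))) := by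
    rw [← Real.exp_nat_mul]; congr 1; simp; ring
  have h3 := convexOn_exp.2 (Set.mem_univ (0 : ℝ)) (Set.mem_univ (-(m * α)))
    (sub_nonneg.2 hw.2) hw.1 (by ring)
  simp only [Real.exp_zero, smul_eq_mul] at h3 h2
  rw [h2] at h1
  have h4 : w * Real.exp (-(m * α)) ≤ Real.exp (-(m * α)) :=
    mul_le_of_le_one_left (Real.exp_pos _).le hw.2
  linarith

/-- The one-shot covering lemma: some codebook of size `m` covers most of the mass of `μ`. -/
lemma exists_codebook [Nonempty U] {μ : A → ℝ} (hμ : ∀ x, 0 ≤ μ x) {q : U → ℝ}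
    (hq : ∀ u, 0 ≤ q u) (hq1 : ∑ u, q u ≤ 1) {W : A → U → ℝ} (hW : ∀ x u, 0 ≤ W x u)
    (hW1 : ∀ x, ∑ u, W x u ≤ 1) {T : A → U → Prop} {α : ℝ}
    (hT : ∀ x u, T x u → α * W x u ≤ q u) (m : ℕ) :
    ∃ c : Fin m → U, ∑ x, μ x * ind (∀ j, ¬T x (c j)) ≤
      ∑ x, μ x * (1 - ∑ u, W x u * ind (T x u) + Real.exp (-(m * α))) := by
  -- Drawing codewords needs a genuine pmf. The missing mass of `q` goes to one arbitrary symbol,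
  -- which preserves the lower bounds supplied by `hT`.
  obtain ⟨q', hq', hqq'⟩ : ∃ q' ∈ stdSimplex ℝ U, ∀ u, q u ≤ q' u := by
    classical
    obtain ⟨u₀⟩ := ‹Nonempty U›
    refine ⟨fun u => q u + (1 - ∑ u, q u) * ind (u₀ = u), ⟨fun u => ?_, ?_⟩, fun u => ?_⟩
    · have := mul_nonneg (sub_nonneg.2 hq1) (ind_nonneg (u₀ = u))
      have := hq u
      positivity
    · rw [sum_add_distrib, sum_mul_ind_eq (fun _ => 1 - ∑ u, q u)]; ring
    · have := mul_nonneg (sub_nonneg.2 hq1) (ind_nonneg (u₀ = u))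
      linarith
  refine exists_le_of_sum_mul_le (iidPmf_mem hq' m) ?_
  simp_rw [mul_sum]
  rw [sum_comm]
  refine sum_le_sum fun x _ => ?_
  -- The codewords are independent, so the probability that all of them miss `x` is an m-th power.
  have h1 : ∑ c, iidPmf q' m c * (μ x * ind (∀ j, ¬T x (c j))) =
      μ x * (1 - ∑ u, q' u * ind (T x u)) ^ m := by
    simp_rw [mul_left_comm _ (μ x), ← mul_sum]
    congr 1
    have h2 : 1 - ∑ u, q' u * ind (T x u) = ∑ u, q' u * ind (¬T x u) := by
      simp_rw [ind_not, mul_sub, sum_sub_distrib, mul_one, hq'.2]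
    rw [h2, Fintype.sum_pow]
    refine sum_congr rfl fun c _ => ?_
    rw [prod_mul_distrib, prod_ind]; rfl
  rw [h1]
  refine mul_le_mul_of_nonneg_left (one_sub_pow_le ⟨?_, ?_⟩ ?_ ?_ m) (hμ x)
  · exact sum_nonneg fun u _ => mul_nonneg (hW x u) (ind_nonneg _)
  · exact (sum_le_sum fun u _ => mul_le_of_le_one_right (hW x u) (ind_le_one _)).trans (hW1 x)
  · rw [← hq'.2]
    exact sum_le_sum fun u _ => mul_le_of_le_one_right (hq'.1 u) (ind_le_one _)
  · rw [mul_sum]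
    refine sum_le_sum fun u _ => ?_
    by_cases h : T x u
    · rw [ind_of h, mul_one, mul_one]; exact (hT x u h).trans (hqq' u)
    · simp [ind_of_not h]

/-- The one-shot covering lemma for superposition codebooks. -/
lemma exists_superposition_codebook [Nonempty U₀] [Nonempty U₁] {p : A → ℝ}
    (hp : p ∈ stdSimplex ℝ A) {q₀ : U₀ → ℝ} (hq₀ : ∀ u, 0 ≤ q₀ u) (hq₀1 : ∑ u, q₀ u ≤ 1)
    {q₁ : U₀ → U₁ → ℝ} (hq₁ : ∀ u v, 0 ≤ q₁ u v) (hq₁1 : ∀ u, ∑ v, q₁ u v ≤ 1)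
    {K₀ : A → U₀ → ℝ} (hK₀ : ∀ x u, 0 ≤ K₀ x u) (hK₀1 : ∀ x, ∑ u, K₀ x u ≤ 1)
    {K₁ : A → U₀ → U₁ → ℝ} (hK₁ : ∀ x u v, 0 ≤ K₁ x u v) (hK₁1 : ∀ x u, ∑ v, K₁ x u v ≤ 1)
    {T₀ : A → U₀ → Prop} {T₁ : A → U₀ → U₁ → Prop} {α₀ α₁ η : ℝ} (hη : 0 < η) (hη1 : η ≤ 1)
    (hT₀ : ∀ x u, T₀ x u → α₀ * K₀ x u ≤ q₀ u)
    (hT₁ : ∀ x u v, T₁ x u v → α₁ * K₁ x u v ≤ q₁ u v)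
    (hmass : 1 - η ^ 2 ≤ ∑ x, ∑ u, ∑ v, p x * K₀ x u * K₁ x u v * ind (T₀ x u ∧ T₁ x u v))
    {m₀ m₁ : ℕ} (hm₀ : 0 < m₀) (hm₁ : 0 < m₁) :
    ∃ (c₀ : Fin m₀ → U₀) (c₁ : Fin m₀ → Fin m₁ → U₁) (f₀ : A → Fin m₀) (f₁ : A → Fin m₁),
      ∑ x, p x * ind (¬T₁ x (c₀ (f₀ x)) (c₁ (f₀ x) (f₁ x))) ≤
        2 * η + Real.exp (-(m₀ * α₀)) + Real.exp (-(m₁ * α₁)) := by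
  classical
  set g : A → U₀ → ℝ := fun x u => ∑ v, K₁ x u v * ind (T₁ x u v) with hg
  have hg1 : ∀ x u, g x u ≤ 1 := fun x u =>
    (sum_le_sum fun v _ => mul_le_of_le_one_right (hK₁ x u v) (ind_le_one _)).trans (hK₁1 x u)
  set T : A → U₀ → Prop := fun x u => T₀ x u ∧ 1 - η ≤ g x u with hTdef
  set M : ℝ := ∑ x, p x * ∑ u, K₀ x u * ind (T x u) with hM
  -- A pair outside `T` keeps at most the fraction 1 - η of its mass, so the hypothesis gives 1 - η²
  -- ≤ (1 - η) + ηM; this is why it is stated with η².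
  have hM1 : 1 - η ≤ M := by
    have h1 : ∑ x, ∑ u, ∑ v, p x * K₀ x u * K₁ x u v * ind (T₀ x u ∧ T₁ x u v) ≤
        ∑ x, ∑ u, p x * K₀ x u * ((1 - η) + η * ind (T x u)) := by
      refine sum_le_sum fun x _ => sum_le_sum fun u _ => ?_
      simp_rw [ind_and, mul_assoc, ← mul_sum]
      refine mul_le_mul_of_nonneg_left (mul_le_mul_of_nonneg_left ?_ (hK₀ x u)) (hp.1 x)
      simp_rw [mul_left_comm (K₁ x u _), ← mul_sum]
      change ind (T₀ x u) * g x u ≤ _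
      have hg0 : 0 ≤ g x u := sum_nonneg fun v _ => mul_nonneg (hK₁ x u v) (ind_nonneg _)
      by_cases h : T x u
      · rw [ind_of h, ind_of h.1]; linarith [hg1 x u]
      · rw [ind_of_not h]
        by_cases h0 : T₀ x u
        · rw [ind_of h0]
          have : ¬(1 - η ≤ g x u) := fun h' => h ⟨h0, h'⟩
          linarith
        · rw [ind_of_not h0]
          linarith
    have h2 : ∑ x, ∑ u, p x * K₀ x u * ((1 - η) + η * ind (T x u)) =
        (1 - η) * (∑ x, p x * ∑ u, K₀ x u) + η * M := by
      rw [hM, mul_sum, mul_sum, ← sum_add_distrib]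
      refine sum_congr rfl fun x _ => ?_
      simp_rw [mul_sum, ← sum_add_distrib]
      exact sum_congr rfl fun u _ => by ring
    have h3 : ∑ x, p x * ∑ u, K₀ x u ≤ 1 := by
      rw [← hp.2]
      exact sum_le_sum fun x _ => mul_le_of_le_one_right (hp.1 x) (hK₀1 x)
    have h4 := mul_le_mul_of_nonneg_left h3 (sub_nonneg.2 hη1)
    have h5 : η * (1 - η) ≤ η * M := by nlinarith [hmass, h1, h2, h4]
    exact le_of_mul_le_mul_left h5 hη
  set e₀ := Real.exp (-(m₀ * α₀)) with he₀
  set e₁ := Real.exp (-(m₁ * α₁)) with he₁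
  obtain ⟨c₀, hc₀⟩ := exists_codebook hp.1 hq₀ hq₀1 hK₀ hK₀1 (T := T) (fun x u h => hT₀ x u h.1) m₀
  have hc₀' : ∑ x, p x * ind (∀ i, ¬T x (c₀ i)) ≤ η + e₀ := by
    have : ∑ x, p x * (1 - ∑ u, K₀ x u * ind (T x u) + e₀) = 1 - M + e₀ := by
      simp_rw [mul_add, mul_sub, sum_add_distrib, sum_sub_distrib, ← sum_mul, mul_one, hp.2, one_mul]
      rfl
    rw [this] at hc₀
    linarith
  obtain ⟨f₀, hf₀T⟩ : ∃ f₀ : A → Fin m₀, ∀ x, (∃ i, T x (c₀ i)) → T x (c₀ (f₀ x)) :=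
    ⟨fun x => if h : ∃ i, T x (c₀ i) then h.choose else ⟨0, hm₀⟩,
      fun x h => by simp only [dif_pos h]; exact h.choose_spec⟩
  -- The satellite codebook of cloud center i only has to serve the source points that selected i
  -- successfully. These weights sum over i to at most `p x`, so the failures add up without a
  -- factor m₀.
  set μ : Fin m₀ → A → ℝ := fun i x => p x * ind (f₀ x = i ∧ T x (c₀ i)) with hμ
  have hμ0 : ∀ i x, 0 ≤ μ i x := fun i x => mul_nonneg (hp.1 x) (ind_nonneg _)
  choose c₁ hc₁ using fun i => exists_codebook (hμ0 i) (hq₁ (c₀ i)) (hq₁1 (c₀ i))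
    (fun x => hK₁ x (c₀ i)) (fun x => hK₁1 x (c₀ i)) (T := fun x => T₁ x (c₀ i))
    (fun x => hT₁ x (c₀ i)) m₁
  have hc₁' : ∀ i, ∑ x, μ i x * ind (∀ j, ¬T₁ x (c₀ i) (c₁ i j)) ≤ ∑ x, μ i x * (η + e₁) :=
    fun i => (hc₁ i).trans <| sum_le_sum fun x _ => by
      by_cases h : T x (c₀ i)
      · refine mul_le_mul_of_nonneg_left ?_ (hμ0 i x)
        have : 1 - η ≤ ∑ v, K₁ x (c₀ i) v * ind (T₁ x (c₀ i) v) := h.2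
        linarith
      · simp [hμ, ind_of_not (fun h' : f₀ x = i ∧ T x (c₀ i) => h h'.2)]
  obtain ⟨f₁, hf₁T⟩ : ∃ f₁ : A → Fin m₁, ∀ x, (∃ j, T₁ x (c₀ (f₀ x)) (c₁ (f₀ x) j)) →
      T₁ x (c₀ (f₀ x)) (c₁ (f₀ x) (f₁ x)) :=
    ⟨fun x => if h : ∃ j, T₁ x (c₀ (f₀ x)) (c₁ (f₀ x) j) then h.choose else ⟨0, hm₁⟩,
      fun x h => by simp only [dif_pos h]; exact h.choose_spec⟩
  refine ⟨c₀, c₁, f₀, f₁, ?_⟩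
  calc _ ≤ ∑ x, (p x * ind (∀ i, ¬T x (c₀ i)) +
          ∑ i, μ i x * ind (∀ j, ¬T₁ x (c₀ i) (c₁ i j))) := by
        refine sum_le_sum fun x _ => ?_
        have hnn : ∀ i, 0 ≤ μ i x * ind (∀ j, ¬T₁ x (c₀ i) (c₁ i j)) := fun i =>
          mul_nonneg (hμ0 i x) (ind_nonneg _)
        have hp0 := mul_nonneg (hp.1 x) (ind_nonneg (∀ i, ¬T x (c₀ i)))
        have hle := mul_le_mul_of_nonneg_left
          (ind_le_one (¬T₁ x (c₀ (f₀ x)) (c₁ (f₀ x) (f₁ x)))) (hp.1 x)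
        have hs := sum_nonneg fun i (_ : i ∈ univ) => hnn i
        by_cases h : ∃ i, T x (c₀ i)
        · by_cases h' : ∃ j, T₁ x (c₀ (f₀ x)) (c₁ (f₀ x) j)
          · rw [ind_of_not (not_not.2 (hf₁T x h')), mul_zero]
            exact add_nonneg hp0 hs
          · have h1 := single_le_sum (fun i _ => hnn i) (mem_univ (f₀ x))
            have h2 : μ (f₀ x) x = p x := by
              change p x * ind (f₀ x = f₀ x ∧ T x (c₀ (f₀ x))) = p x
              rw [ind_of ⟨rfl, hf₀T x h⟩, mul_one]
            rw [h2, ind_of (by push Not at h'; exact h')] at h1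
            linarith
        · rw [ind_of (p := ∀ i, ¬T x (c₀ i)) (by push Not at h; exact h)]
          linarith
    _ ≤ (η + e₀) + ∑ x, ∑ i, μ i x * (η + e₁) := by
        rw [sum_add_distrib]
        refine add_le_add hc₀' ?_
        rw [sum_comm, sum_comm (s := univ (α := A))]
        exact sum_le_sum fun i _ => hc₁' i
    _ ≤ (η + e₀) + ∑ x, p x * (η + e₁) := by
        refine add_le_add le_rfl (sum_le_sum fun x _ => ?_)
        have he : 0 ≤ η + e₁ := add_nonneg hη.le (Real.exp_pos _).le
        rw [← sum_mul]
        refine mul_le_mul_of_nonneg_right ?_ he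
        calc _ ≤ ∑ i, p x * ind (f₀ x = i) := sum_le_sum fun i _ =>
              mul_le_mul_of_nonneg_left (ind_mono fun h => h.1) (hp.1 x)
          _ = p x := sum_mul_ind_eq (fun _ => p x) _
    _ = _ := by rw [← sum_mul, hp.2]; ring

end Covering

/-! ### Products and logarithms; blockwise quantizers. -/

lemma rpow_sum_logb {ι : Type*} [Fintype ι] {r : ι → ℝ} (hr : ∀ i, 0 < r i) :
    (2 : ℝ) ^ (∑ i, Real.logb 2 (r i)) = ∏ i, r i := by
  rw [Real.rpow_sum_of_pos (by norm_num)]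
  exact prod_congr rfl fun i _ => Real.rpow_logb (by norm_num) (by norm_num) (hr i)

lemma logb_prod {ι : Type*} [Fintype ι] {r : ι → ℝ} (hr : ∀ i, 0 < r i) :
    Real.logb 2 (∏ i, r i) = ∑ i, Real.logb 2 (r i) := by
  rw [← rpow_sum_logb hr, Real.logb_rpow (by norm_num) (by norm_num)]

lemma rpow_neg_mul_prod_le {ι : Type*} [Fintype ι] {a c : ι → ℝ} (ha : ∀ i, 0 < a i)
    (hc : ∀ i, 0 < c i) {K : ℝ} (h : ∑ i, Real.logb 2 (a i / c i) ≤ K) :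
    (2 : ℝ) ^ (-K) * ∏ i, a i ≤ ∏ i, c i := by
  have h1 := rpow_sum_logb fun i => div_pos (ha i) (hc i)
  have h2 : ∏ i, a i = (∏ i, a i / c i) * ∏ i, c i := by
    rw [← prod_mul_distrib]
    exact prod_congr rfl fun i _ => (div_mul_cancel₀ _ (hc i).ne').symm
  have h3 : 0 ≤ ∏ i, c i := prod_nonneg fun i _ => (hc i).le
  rw [h2, ← h1, ← mul_assoc, ← Real.rpow_add (by norm_num)]
  refine mul_le_of_le_one_left h3 (Real.rpow_le_one_of_one_le_of_nonpos (by norm_num) ?_)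
  linarith

lemma sum_prod_le_one {ι V : Type*} [Fintype ι] [DecidableEq ι] [Fintype V] (k : ι → V → ℝ)
    (h0 : ∀ i v, 0 ≤ k i v) (h1 : ∀ i, ∑ v, k i v ≤ 1) : ∑ u : ι → V, ∏ i, k i (u i) ≤ 1 := by
  rw [sum_prod_eq]
  exact prod_le_one (fun i _ => sum_nonneg fun v _ => h0 i v) fun i _ => h1 i

section Quantizer

variable {A U₀ U₁ : Type*} [Fintype A] [Fintype U₀] [Fintype U₁]

lemma sum_iidPmf_triple {b : ℕ} {Q : (U₀ × U₁) × A → ℝ} {p : A → ℝ} {k₀ : A → U₀ → ℝ}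
    {k₁ : A → U₀ → U₁ → ℝ} (h : ∀ x u v, p x * k₀ x u * k₁ x u v = Q ((u, v), x))
    (φ : (Fin b → A) → (Fin b → U₀) → (Fin b → U₁) → ℝ) :
    ∑ x, ∑ u, ∑ v, iidPmf p b x * (∏ i, k₀ (x i) (u i)) * (∏ i, k₁ (x i) (u i) (v i)) * φ x u v =
      ∑ t, iidPmf Q b t * φ (fun i => (t i).2) (fun i => (t i).1.1) (fun i => (t i).1.2) := by
  let e : (Fin b → (U₀ × U₁) × A) ≃ (Fin b → A) × (Fin b → U₀) × (Fin b → U₁) :=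
    { toFun := fun t => (fun i => (t i).2, fun i => (t i).1.1, fun i => (t i).1.2)
      invFun := fun s i => ((s.2.1 i, s.2.2 i), s.1 i)
      left_inv := fun t => rfl
      right_inv := fun s => rfl }
  simp_rw [← Fintype.sum_prod_type' (f := fun u v => _ * φ _ u v)]
  rw [← Fintype.sum_prod_type' (f := fun x (s : (Fin b → U₀) × (Fin b → U₁)) =>
    iidPmf p b x * (∏ i, k₀ (x i) (s.1 i)) * (∏ i, k₁ (x i) (s.1 i) (s.2 i)) * φ x s.1 s.2),
    ← e.sum_comp]
  refine sum_congr rfl fun t _ => ?_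
  unfold iidPmf
  rw [← prod_mul_distrib, ← prod_mul_distrib]
  congr 1
  exact prod_congr rfl fun i _ => h _ _ _

/-- The codebook size is the ceiling of 2^(b(I + 2δ)). Rounding costs one bit, absorbed by 1 ≤ bδ;
the excess over the exponent b(I + δ) makes the covering failure exp(-2^(bδ)). -/
lemma exists_card_of_rate {b : ℕ} {I δ : ℝ} (hI : 0 ≤ I) (hδ : 0 < δ) (hb : 1 ≤ b * δ) :
    ∃ m : ℕ, 0 < m ∧ Real.logb 2 m ≤ b * (I + 3 * δ) ∧
      (2 : ℝ) ^ (b * δ) ≤ m * (2 : ℝ) ^ (-(b * I + b * δ)) := by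
  have h1 : 1 ≤ (2 : ℝ) ^ (b * I + b * (2 * δ)) :=
    Real.one_le_rpow (by norm_num) (by positivity)
  have h2 := Nat.ceil_lt_add_one (zero_le_one.trans h1)
  have h3 := Nat.le_ceil ((2 : ℝ) ^ (b * I + b * (2 * δ)))
  refine ⟨⌈(2 : ℝ) ^ (b * I + b * (2 * δ))⌉₊, Nat.ceil_pos.2 (by linarith), ?_, ?_⟩
  · rw [Real.logb_le_iff_le_rpow (by norm_num) (by linarith)]
    calc _ ≤ (2 : ℝ) ^ (b * I + b * (2 * δ)) * 2 := by linarith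
      _ = (2 : ℝ) ^ (b * I + b * (2 * δ) + 1) := by rw [Real.rpow_add_one (by norm_num)]
      _ ≤ _ := Real.rpow_le_rpow_of_exponent_le (by norm_num) (by linarith)
  · calc (2 : ℝ) ^ (b * δ) = (2 : ℝ) ^ (b * I + b * (2 * δ)) * (2 : ℝ) ^ (-(b * I + b * δ)) := by
          rw [← Real.rpow_add (by norm_num)]; congr 1; ring
      _ ≤ _ := mul_le_mul_of_nonneg_right h3 (by positivity)

lemma eventually_exp_neg_rpow_le {δ η : ℝ} (hδ : 0 < δ) (hη : 0 < η) :
    ∀ᶠ b : ℕ in atTop, Real.exp (-(2 : ℝ) ^ (b * δ)) ≤ η := by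
  have h1 : Tendsto (fun b : ℕ => (2 : ℝ) ^ (b * δ)) atTop atTop := by
    have := tendsto_pow_atTop_atTop_of_one_lt
      (Real.one_lt_rpow (x := 2) (by norm_num) hδ)
    refine this.congr fun b => ?_
    rw [← Real.rpow_natCast, ← Real.rpow_mul (by norm_num), mul_comm]
  exact (Real.tendsto_exp_neg_atTop_nhds_zero.comp h1).eventually_le_const hη

/-- The random-coding construction behind `exists_quantizer`, for a given factorization of `Q`. -/
lemma exists_quantizer_of_factorization [Nonempty U₀] [Nonempty U₁] {Q : (U₀ × U₁) × A → ℝ}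
    (hQ : Q ∈ stdSimplex ℝ ((U₀ × U₁) × A)) {pX : A → ℝ} (hpX : pX ∈ stdSimplex ℝ A)
    {p₀ : U₀ → ℝ} (hp₀ : p₀ ∈ stdSimplex ℝ U₀)
    {k₀ : A → U₀ → ℝ} (nk₀ : ∀ x u, 0 ≤ k₀ x u) (sk₀ : ∀ x, ∑ u, k₀ x u ≤ 1)
    {k₁ : A → U₀ → U₁ → ℝ} (nk₁ : ∀ x u v, 0 ≤ k₁ x u v) (sk₁ : ∀ x u, ∑ v, k₁ x u v ≤ 1)
    {q₁ : U₀ → U₁ → ℝ} (nq₁ : ∀ u v, 0 ≤ q₁ u v) (sq₁ : ∀ u, ∑ v, q₁ u v ≤ 1)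
    (hfac : ∀ x u v, pX x * k₀ x u * k₁ x u v = Q ((u, v), x))
    (hQpos : ∀ ω, 0 < Q ω → 0 < k₀ ω.2 ω.1.1 ∧ 0 < p₀ ω.1.1 ∧ 0 < k₁ ω.2 ω.1.1 ω.1.2 ∧
      0 < q₁ ω.1.1 ω.1.2)
    {I₀ I₁ : ℝ} (hI₀0 : 0 ≤ I₀) (hI₁0 : 0 ≤ I₁)
    (hI₀ : ∑ ω, Q ω * Real.logb 2 (k₀ ω.2 ω.1.1 / p₀ ω.1.1) = I₀)
    (hI₁ : ∑ ω, Q ω * Real.logb 2 (k₁ ω.2 ω.1.1 ω.1.2 / q₁ ω.1.1 ω.1.2) = I₁)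
    {ε η : ℝ} (hε0 : 0 < ε) (hη0 : 0 < η) (hη1 : η ≤ 1) :
    ∃ (b m₀ m₁ : ℕ) (c₀ : Fin m₀ → Fin b → U₀) (c₁ : Fin m₀ → Fin m₁ → Fin b → U₁)
      (f₀ : (Fin b → A) → Fin m₀) (f₁ : (Fin b → A) → Fin m₁),
      0 < b ∧ 0 < m₀ ∧ 0 < m₁ ∧ Real.logb 2 m₀ ≤ b * (I₀ + 3 * ε) ∧
      Real.logb 2 m₁ ≤ b * (I₁ + 3 * ε) ∧
      ∀ t, |∑ x, iidPmf pX b x *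
        ∑ i, ind (((c₀ (f₀ x) i, c₁ (f₀ x) (f₁ x) i), x i) = t) - b * Q t| ≤
          b * ε + b * (4 * η) := by
  -- The two information densities and the letter counts form one family, so a single law of large
  -- numbers controls them all.
  let g : Bool ⊕ ((U₀ × U₁) × A) → (U₀ × U₁) × A → ℝ := fun j ω => match j with
    | .inl true => Real.logb 2 (k₀ ω.2 ω.1.1 / p₀ ω.1.1)
    | .inl false => Real.logb 2 (k₁ ω.2 ω.1.1 ω.1.2 / q₁ ω.1.1 ω.1.2)
    | .inr t => ind (ω = t)
  have g₀ : ∑ ω, Q ω * g (.inl true) ω = I₀ := hI₀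
  have g₁ : ∑ ω, Q ω * g (.inl false) ω = I₁ := hI₁
  have gt : ∀ t, ∑ ω, Q ω * g (.inr t) ω = Q t := fun t => by
    simp only [g, ← law_eq Q (fun ω => ω)]; rw [law_id]
  have hlln := (tendsto_sum_iidPmf_deviation hQ g hε0).eventually_le_const
    (show (0 : ℝ) < η ^ 2 by positivity)
  have hlarge : ∀ᶠ b : ℕ in atTop, 1 ≤ b * ε := by
    have : Tendsto (fun b : ℕ => (b : ℝ) * ε) atTop atTop :=
      tendsto_natCast_atTop_atTop.atTop_mul_const hε0
    exact this.eventually_ge_atTop 1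
  obtain ⟨b, hb, hbε, hbexp, hbpos⟩ := (hlln.and (hlarge.and
    ((eventually_exp_neg_rpow_le hε0 hη0).and (eventually_gt_atTop 0)))).exists
  obtain ⟨m₀, hm₀, hm₀r, hm₀l⟩ := exists_card_of_rate hI₀0 hε0 hbε
  obtain ⟨m₁, hm₁, hm₁r, hm₁l⟩ := exists_card_of_rate hI₁0 hε0 hbε
  have hbR : (0 : ℝ) < b := by exact_mod_cast hbpos
  let T₀ : (Fin b → A) → (Fin b → U₀) → Prop := fun x u =>
    (2 : ℝ) ^ (-(b * I₀ + b * ε)) * ∏ i, k₀ (x i) (u i) ≤ ∏ i, p₀ (u i)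
  let T₁ : (Fin b → A) → (Fin b → U₀) → (Fin b → U₁) → Prop := fun x u v =>
    (2 : ℝ) ^ (-(b * I₁ + b * ε)) * ∏ i, k₁ (x i) (u i) (v i) ≤ ∏ i, q₁ (u i) (v i) ∧
    ∀ t, |∑ i, ind (((u i, v i), x i) = t) - b * Q t| ≤ b * ε
  have hpb := iidPmf_mem hpX b
  have hmass : 1 - η ^ 2 ≤ ∑ x, ∑ u, ∑ v, iidPmf pX b x * (∏ i, k₀ (x i) (u i)) *
      (∏ i, k₁ (x i) (u i) (v i)) * ind (T₀ x u ∧ T₁ x u v) := by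
    rw [sum_iidPmf_triple hfac fun x u v => ind (T₀ x u ∧ T₁ x u v)]
    have h1 : ∑ t, iidPmf Q b t = 1 := (iidPmf_mem hQ b).2
    refine (sub_le_sub_left hb 1).trans ?_
    rw [← h1, ← sum_sub_distrib]
    refine sum_le_sum fun t _ => ?_
    rcases (iidPmf_nonneg hQ.1 t).eq_or_lt with h0 | h0
    · simp [← h0]
    rw [← mul_one_sub, ← ind_not]
    refine mul_le_mul_of_nonneg_left (ind_mono fun hdev => ?_) h0.le
    push Not at hdev
    have hpos := pos_of_iidPmf_pos hQ.1 h0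
    have d0 := (abs_le.1 (hdev (.inl true))).2
    have d1 := (abs_le.1 (hdev (.inl false))).2
    rw [g₀] at d0
    rw [g₁] at d1
    have hpos' := fun i => hQpos _ (hpos i)
    refine ⟨rpow_neg_mul_prod_le (fun i => (hpos' i).1) (fun i => (hpos' i).2.1) ?_,
      rpow_neg_mul_prod_le (fun i => (hpos' i).2.2.1) (fun i => (hpos' i).2.2.2) ?_, fun s => ?_⟩
    · exact sub_le_iff_le_add'.1 d0
    · exact sub_le_iff_le_add'.1 d1
    · have := hdev (.inr s)
      rwa [gt] at this
  have s₀ : ∑ u : Fin b → U₀, ∏ i, p₀ (u i) ≤ 1 :=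
    sum_prod_le_one (fun _ => p₀) (fun _ => hp₀.1) fun _ => hp₀.2.le
  have s₁ : ∀ u : Fin b → U₀, ∑ v : Fin b → U₁, ∏ i, q₁ (u i) (v i) ≤ 1 := fun u =>
    sum_prod_le_one (fun i => q₁ (u i)) (fun i => nq₁ (u i)) fun i => sq₁ (u i)
  have s₂ : ∀ x : Fin b → A, ∑ u : Fin b → U₀, ∏ i, k₀ (x i) (u i) ≤ 1 := fun x =>
    sum_prod_le_one (fun i => k₀ (x i)) (fun i => nk₀ (x i)) fun i => sk₀ (x i)
  have s₃ : ∀ (x : Fin b → A) (u : Fin b → U₀),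
      ∑ v : Fin b → U₁, ∏ i, k₁ (x i) (u i) (v i) ≤ 1 := fun x u =>
    sum_prod_le_one (fun i => k₁ (x i) (u i)) (fun i => nk₁ (x i) (u i)) fun i => sk₁ (x i) (u i)
  have hT₀ : ∀ x u, T₀ x u →
      (2 : ℝ) ^ (-(b * I₀ + b * ε)) * ∏ i, k₀ (x i) (u i) ≤ ∏ i, p₀ (u i) := fun x u h => h
  have hT₁ : ∀ x u v, T₁ x u v → (2 : ℝ) ^ (-(b * I₁ + b * ε)) * ∏ i, k₁ (x i) (u i) (v i) ≤
      ∏ i, q₁ (u i) (v i) := fun x u v h => h.1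
  have hT₁' : ∀ x u v, T₁ x u v → ∀ t, |∑ i, ind (((u i, v i), x i) = t) - b * Q t| ≤ b * ε :=
    fun x u v h => h.2
  clear_value T₀ T₁
  obtain ⟨c₀, c₁, f₀, f₁, hf⟩ := exists_superposition_codebook
    (A := Fin b → A) (U₀ := Fin b → U₀) (U₁ := Fin b → U₁) hpb
    (q₀ := fun u => ∏ i, p₀ (u i)) (fun u => prod_nonneg fun i _ => hp₀.1 _) s₀
    (q₁ := fun u v => ∏ i, q₁ (u i) (v i)) (fun u v => prod_nonneg fun i _ => nq₁ _ _) s₁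
    (K₀ := fun x u => ∏ i, k₀ (x i) (u i)) (fun x u => prod_nonneg fun i _ => nk₀ _ _) s₂
    (K₁ := fun x u v => ∏ i, k₁ (x i) (u i) (v i))
    (fun x u v => prod_nonneg fun i _ => nk₁ _ _ _) s₃
    hη0 hη1 hT₀ hT₁ hmass hm₀ hm₁
  refine ⟨b, m₀, m₁, c₀, c₁, f₀, f₁, hbpos, hm₀, hm₁, hm₀r, hm₁r, fun t => ?_⟩
  -- When quantization fails, the trivial bound `b` is used: the count and its target both lie in
  -- [0, b].
  have hx : ∀ x, |∑ i, ind (((c₀ (f₀ x) i, c₁ (f₀ x) (f₁ x) i), x i) = t) - b * Q t| ≤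
      b * ε + b * ind (¬T₁ x (c₀ (f₀ x)) (c₁ (f₀ x) (f₁ x))) := fun x => by
    by_cases h : T₁ x (c₀ (f₀ x)) (c₁ (f₀ x) (f₁ x))
    · rw [ind_of_not (not_not.2 h), mul_zero, add_zero]
      exact hT₁' _ _ _ h t
    · rw [ind_of h, mul_one]
      have s0 : 0 ≤ ∑ i, ind (((c₀ (f₀ x) i, c₁ (f₀ x) (f₁ x) i), x i) = t) :=
        sum_nonneg fun i _ => ind_nonneg _
      have s1 : ∑ i, ind (((c₀ (f₀ x) i, c₁ (f₀ x) (f₁ x) i), x i) = t) ≤ b := by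
        calc _ ≤ ∑ i : Fin b, (1 : ℝ) := sum_le_sum fun i _ => ind_le_one _
          _ = b := by simp
      have q0 := mul_nonneg hbR.le (hQ.1 t)
      have q1 : b * Q t ≤ b := mul_le_of_le_one_right hbR.le
        (hQ.2 ▸ single_le_sum (fun i _ => hQ.1 i) (mem_univ t))
      have := mul_pos hbR hε0
      rw [abs_le]; constructor <;> linarith
  calc _ = |∑ x, iidPmf pX b x *
        (∑ i, ind (((c₀ (f₀ x) i, c₁ (f₀ x) (f₁ x) i), x i) = t) - b * Q t)| := by
        simp_rw [mul_sub, sum_sub_distrib, ← sum_mul, hpb.2, one_mul]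
    _ ≤ ∑ x, iidPmf pX b x *
        (b * ε + b * ind (¬T₁ x (c₀ (f₀ x)) (c₁ (f₀ x) (f₁ x)))) := by
        refine (abs_sum_le_sum_abs _ _).trans (sum_le_sum fun x _ => ?_)
        rw [abs_mul, abs_of_nonneg (hpb.1 x)]
        exact mul_le_mul_of_nonneg_left (hx x) (hpb.1 x)
    _ = b * ε + b * ∑ x, iidPmf pX b x * ind (¬T₁ x (c₀ (f₀ x)) (c₁ (f₀ x) (f₁ x))) := by
        simp_rw [mul_add, sum_add_distrib, ← sum_mul, hpb.2, one_mul, mul_sum]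
        congr 1
        exact sum_congr rfl fun x _ => by ring
    -- The covering lemma gives 2η plus two exponentials, each at most η.
    _ ≤ b * ε + b * (4 * η) := by
        have e0 : Real.exp (-(m₀ * (2 : ℝ) ^ (-(b * I₀ + b * ε)))) ≤ η :=
          (Real.exp_le_exp.2 (neg_le_neg hm₀l)).trans hbexp
        have e1 : Real.exp (-(m₁ * (2 : ℝ) ^ (-(b * I₁ + b * ε)))) ≤ η :=
          (Real.exp_le_exp.2 (neg_le_neg hm₁l)).trans hbexp
        have := mul_le_mul_of_nonneg_left (hf.trans (by linarith : _ ≤ 4 * η)) hbR.le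
        linarith

/-- Blockwise superposition quantizers whose expected joint type is close to `Q`. -/
lemma exists_quantizer {Q : (U₀ × U₁) × A → ℝ} (hQ : Q ∈ stdSimplex ℝ ((U₀ × U₁) × A))
    {δ : ℝ} (hδ : 0 < δ) :
    ∃ (b m₀ m₁ : ℕ) (c₀ : Fin m₀ → Fin b → U₀) (c₁ : Fin m₀ → Fin m₁ → Fin b → U₁)
      (f₀ : (Fin b → A) → Fin m₀) (f₁ : (Fin b → A) → Fin m₁),
      0 < b ∧ 0 < m₀ ∧ 0 < m₁ ∧
      Real.logb 2 m₀ ≤ b * (mutualInfo Q (fun ω => ω.1.1) (fun ω => ω.2) + δ) ∧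
      Real.logb 2 m₁ ≤ b * (condMutualInfo Q (fun ω => ω.1.2) (fun ω => ω.2)
        (fun ω => ω.1.1) + δ) ∧
      ∀ t, |∑ x, iidPmf (law Q fun ω => ω.2) b x *
        ∑ i, ind (((c₀ (f₀ x) i, c₁ (f₀ x) (f₁ x) i), x i) = t) - b * Q t| ≤ b * δ := by
  obtain ⟨⟨⟨u₀', u₁'⟩, x'⟩⟩ : Nonempty ((U₀ × U₁) × A) := by
    by_contra h
    rw [not_nonempty_iff] at h
    simpa using hQ.2
  have : Nonempty U₀ := ⟨u₀'⟩
  have : Nonempty U₁ := ⟨u₁'⟩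
  set I₀ := mutualInfo Q (fun ω => ω.1.1) (fun ω => ω.2) with hI₀
  set I₁ := condMutualInfo Q (fun ω => ω.1.2) (fun ω => ω.2) (fun ω => ω.1.1) with hI₁
  have hI₀0 : 0 ≤ I₀ := mutualInfo_nonneg hQ _ _
  have hI₁0 : 0 ≤ I₁ := condMutualInfo_nonneg hQ _ _ _
  set pX := law Q (fun ω => ω.2) with hpX
  set p₀ := law Q (fun ω => ω.1.1) with hp₀
  set p0X := law Q (fun ω => (ω.1.1, ω.2)) with hp0X
  set p10 := law Q (fun ω => (ω.1.2, ω.1.1)) with hp10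
  have nX : ∀ a, 0 ≤ pX a := law_nonneg hQ.1 _
  have n0 : ∀ a, 0 ≤ p₀ a := law_nonneg hQ.1 _
  have n0X : ∀ a, 0 ≤ p0X a := law_nonneg hQ.1 _
  have n10 : ∀ a, 0 ≤ p10 a := law_nonneg hQ.1 _
  -- Conditional laws are quotients that vanish where the conditioning event has no mass. Their rows
  -- therefore sum only to at most one, which is why the construction admits sub-stochastic kernels.
  set k₀ : A → U₀ → ℝ := fun x u => p0X (u, x) / pX x with hk₀
  set k₁ : A → U₀ → U₁ → ℝ := fun x u v => Q ((u, v), x) / p0X (u, x) with hk₁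
  set q₁ : U₀ → U₁ → ℝ := fun u v => p10 (v, u) / p₀ u with hq₁
  have nk₀ : ∀ x u, 0 ≤ k₀ x u := fun x u => div_nonneg (n0X _) (nX _)
  have nk₁ : ∀ x u v, 0 ≤ k₁ x u v := fun x u v => div_nonneg (hQ.1 _) (n0X _)
  have nq₁ : ∀ u v, 0 ≤ q₁ u v := fun u v => div_nonneg (n10 _) (n0 _)
  have sk₀ : ∀ x, ∑ u, k₀ x u ≤ 1 := fun x => by
    rw [← sum_div, law_snd]; exact div_self_le_one _
  have hperm : ∀ u v x, law Q (fun ω => (ω.1.2, ω.1.1, ω.2)) (v, u, x) = Q ((u, v), x) :=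
    fun u v x => by
      have := law_comp_injective Q (fun ω => ω) (e := fun ω : (U₀ × U₁) × A => (ω.1.2, ω.1.1, ω.2))
        (fun a c h => by simp only [Prod.mk.injEq] at h; ext <;> simp [h]) ((u, v), x)
      rwa [law_id] at this
  have sk₁ : ∀ x u, ∑ v, k₁ x u v ≤ 1 := fun x u => by
    rw [← sum_div]
    simp_rw [← hperm]
    rw [law_snd Q (fun ω => ω.1.2) (fun ω => (ω.1.1, ω.2))]; exact div_self_le_one _
  have sq₁ : ∀ u, ∑ v, q₁ u v ≤ 1 := fun u => by
    rw [← sum_div, law_snd]; exact div_self_le_one _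
  have hfac : ∀ x u v, pX x * k₀ x u * k₁ x u v = Q ((u, v), x) := fun x u v => by
    rcases (hQ.1 ((u, v), x)).eq_or_lt with h0 | h0
    · rw [hk₁]; simp [← h0]
    · have h1 := (law_pos hQ.1 (fun ω => ω.2) h0).ne'
      have h2 := (law_pos hQ.1 (fun ω => (ω.1.1, ω.2)) h0).ne'
      simp only [hk₀, hk₁]
      rw [mul_div_cancel₀ _ h1, mul_div_cancel₀ _ h2]
  have g₀ : ∑ ω, Q ω * Real.logb 2 (k₀ ω.2 ω.1.1 / p₀ ω.1.1) = I₀ := by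
    rw [hI₀, mutualInfo_eq_sum]
    refine sum_congr rfl fun ω _ => ?_
    simp only [hk₀]
    rw [div_div, mul_comm (pX _)]
  have g₁ : ∑ ω, Q ω * Real.logb 2 (k₁ ω.2 ω.1.1 ω.1.2 / q₁ ω.1.1 ω.1.2) = I₁ := by
    rw [hI₁, condMutualInfo_eq_sum]
    refine sum_congr rfl fun ω _ => ?_
    simp only [hk₁, hq₁]
    have e1 : law Q (fun ω => (ω.1.2, ω.2, ω.1.1)) (ω.1.2, ω.2, ω.1.1) = Q ω := by
      have := law_comp_injective Q (fun ω => ω)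
        (e := fun ω : (U₀ × U₁) × A => (ω.1.2, ω.2, ω.1.1))
        (fun a c h => by simp only [Prod.mk.injEq] at h; ext <;> simp [h]) ω
      rwa [law_id] at this
    have e2 : law Q (fun ω => (ω.2, ω.1.1)) (ω.2, ω.1.1) = p0X (ω.1.1, ω.2) :=
      law_comp_injective Q (fun ω => (ω.1.1, ω.2)) (e := Prod.swap) Prod.swap_injective
        (ω.1.1, ω.2)
    rw [e1, e2, div_div_div_eq]
    exact congrArg (fun y => Q ω * Real.logb 2 y)
      (congrArg₂ (· / ·) (mul_comm _ _) (mul_comm _ _))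
  have hQpos : ∀ ω, 0 < Q ω → 0 < k₀ ω.2 ω.1.1 ∧ 0 < p₀ ω.1.1 ∧ 0 < k₁ ω.2 ω.1.1 ω.1.2 ∧
      0 < q₁ ω.1.1 ω.1.2 := fun ω h0 => by
    have h1 := law_pos hQ.1 (fun ω => (ω.1.1, ω.2)) h0
    have h2 := law_pos hQ.1 (fun ω => ω.1.1) h0
    have h3 := law_pos hQ.1 (fun ω => (ω.1.2, ω.1.1)) h0
    have h4 := law_pos hQ.1 (fun ω => ω.2) h0
    exact ⟨div_pos h1 h4, h2, div_pos h0 h1, div_pos h3 h2⟩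
  -- The rates lose 3δ/4 and the joint type loses at most δ/4 + 4·δ/16, all below δ.
  obtain ⟨b, m₀, m₁, c₀, c₁, f₀, f₁, hb, hm₀, hm₁, h₀, h₁, ht⟩ :=
    exists_quantizer_of_factorization hQ (law_mem hQ _) (law_mem hQ _) nk₀ sk₀ nk₁ sk₁ nq₁ sq₁
      hfac hQpos hI₀0 hI₁0 g₀ g₁ (ε := δ / 4) (η := min (δ / 16) 1) (by positivity)
      (by positivity) (min_le_right _ _)
  have hbR : (0 : ℝ) ≤ b := b.cast_nonneg
  have hη : min (δ / 16) 1 ≤ δ / 16 := min_le_left _ _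
  refine ⟨b, m₀, m₁, c₀, c₁, f₀, f₁, hb, hm₀, hm₁, h₀.trans ?_, h₁.trans ?_, fun t =>
    (ht t).trans ?_⟩
  · exact mul_le_mul_of_nonneg_left (by linarith) hbR
  · exact mul_le_mul_of_nonneg_left (by linarith) hbR
  · rw [← mul_add]
    exact mul_le_mul_of_nonneg_left (by linarith) hbR

end Quantizer

/-! ### Integration against the alternative pmf. -/

section Alt

variable {X Y₁ Y₂ Z₁ : Type*} [Fintype X] [Fintype Y₁] [Fintype Y₂] [Fintype Z₁]
  {P : X × Y₁ × Y₂ × Z₁ → ℝ}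

lemma altPmf_apply (P : X × Y₁ × Y₂ × Z₁ → ℝ) (w : X × Y₁ × Y₂ × Z₁) :
    altPmf P w = law P (fun w => (w.1, w.2.2.2)) (w.1, w.2.2.2) *
      (law P (fun w => (w.2.1, w.2.2.2)) (w.2.1, w.2.2.2) / law P (fun w => w.2.2.2) w.2.2.2) *
      law P (fun w => w.2.2.1) w.2.2.1 := rfl

lemma altPmf_nonneg (hP : ∀ w, 0 ≤ P w) (w : X × Y₁ × Y₂ × Z₁) : 0 ≤ altPmf P w := by
  rw [altPmf_apply]
  exact mul_nonneg (mul_nonneg (law_nonneg hP _ _) (div_nonneg (law_nonneg hP _ _)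
    (law_nonneg hP _ _))) (law_nonneg hP _ _)

/-- Integration of functions of product form against the alternative pmf. -/
lemma sum_altPmf_mul (P : X × Y₁ × Y₂ × Z₁ → ℝ) (g : X → Z₁ → ℝ) (r₁ : Y₁ → Z₁ → ℝ)
    (r₂ : Y₂ → ℝ) :
    ∑ w, altPmf P w * (g w.1 w.2.2.2 * r₁ w.2.1 w.2.2.2 * r₂ w.2.2.1) =
      (∑ x, ∑ z, law P (fun w => (w.1, w.2.2.2)) (x, z) * g x z *
        ∑ y, law P (fun w => (w.2.1, w.2.2.2)) (y, z) / law P (fun w => w.2.2.2) z * r₁ y z) *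
      ∑ y, law P (fun w => w.2.2.1) y * r₂ y := by
  simp_rw [altPmf_apply, Fintype.sum_prod_type, sum_mul, mul_sum]
  refine sum_congr rfl fun x _ => ?_
  rw [sum_congr rfl fun y₁ _ => sum_comm, sum_comm]
  refine sum_congr rfl fun z _ => ?_
  rw [sum_comm]
  refine sum_congr rfl fun y₂ _ => ?_
  rw [sum_mul]
  exact sum_congr rfl fun y₁ _ => by ring

/-- The alternative keeps the law of (X, Z₁), draws Y₁ from P(·|z₁) whatever x is, and draws Y₂
independently. Factors with conditional mean at most one can therefore be dropped, leaving an
expectation under P. -/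
lemma sum_altPmf_mul_le (hP : ∀ w, 0 ≤ P w) {g : X → Z₁ → ℝ} (hg : ∀ x z, 0 ≤ g x z)
    {r₁ : Y₁ → Z₁ → ℝ} {r₂ : Y₂ → ℝ} (hr₂0 : ∀ y, 0 ≤ r₂ y)
    (hr₁ : ∀ z, ∑ y, law P (fun w => (w.2.1, w.2.2.2)) (y, z) /
      law P (fun w => w.2.2.2) z * r₁ y z ≤ 1)
    (hr₂ : ∑ y, law P (fun w => w.2.2.1) y * r₂ y ≤ 1) :
    ∑ w, altPmf P w * (g w.1 w.2.2.2 * r₁ w.2.1 w.2.2.2 * r₂ w.2.2.1) ≤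
      ∑ w, P w * g w.1 w.2.2.2 := by
  rw [sum_altPmf_mul]
  have h0 : 0 ≤ ∑ y, law P (fun w => w.2.2.1) y * r₂ y :=
    sum_nonneg fun y _ => mul_nonneg (law_nonneg hP _ _) (hr₂0 y)
  have h2 := sum_law_mul P (fun w => (w.1, w.2.2.2)) fun s => g s.1 s.2
  simp only at h2
  rw [← h2, Fintype.sum_prod_type]
  have h3 : ∑ x, ∑ z, law P (fun w => (w.1, w.2.2.2)) (x, z) * g x z *
      ∑ y, law P (fun w => (w.2.1, w.2.2.2)) (y, z) / law P (fun w => w.2.2.2) z * r₁ y z ≤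
      ∑ x, ∑ z, law P (fun w => (w.1, w.2.2.2)) (x, z) * g x z :=
    sum_le_sum fun x _ => sum_le_sum fun z _ =>
      mul_le_of_le_one_right (mul_nonneg (law_nonneg hP _ _) (hg x z)) (hr₁ z)
  have h4 : 0 ≤ ∑ x, ∑ z, law P (fun w => (w.1, w.2.2.2)) (x, z) * g x z :=
    sum_nonneg fun x _ => sum_nonneg fun z _ => mul_nonneg (law_nonneg hP _ _) (hg x z)
  calc _ ≤ (∑ x, ∑ z, law P (fun w => (w.1, w.2.2.2)) (x, z) * g x z) * _ :=
        mul_le_mul_of_nonneg_right h3 h0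
    _ ≤ _ := mul_le_of_le_one_right h4 hr₂

lemma sum_condLaw_le_one (P : X × Y₁ × Y₂ × Z₁ → ℝ) (z : Z₁) :
    ∑ y, law P (fun w => (w.2.1, w.2.2.2)) (y, z) / law P (fun w => w.2.2.2) z * 1 ≤ 1 := by
  simp_rw [mul_one]
  rw [← sum_div, law_snd]
  exact div_self_le_one _

end Alt

/-! ### The position-averaged joint law of codeword symbols and letters. -/

section AvgLaw

variable {X U W : Type*} [Fintype X] [Fintype U] [Fintype W] {b : ℕ}

lemma sum_iidPmf_coord {P : W → ℝ} (hP : ∑ w, P w = 1) (i : Fin b) (g : W → ℝ) :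
    ∑ v, iidPmf P b v * g (v i) = ∑ w, P w * g w := by
  have h1 : ∀ v : Fin b → W, iidPmf P b v * g (v i) =
      ∏ j, (P (v j) * if j = i then g (v j) else 1) := fun v => by
    rw [prod_mul_distrib, prod_ite_eq' univ i]; simp [iidPmf]
  simp_rw [h1]
  rw [sum_prod_eq fun j w => P w * if j = i then g w else 1, prod_eq_single i]
  · simp
  · intro j _ hj; simp [hj, hP]
  · simp

/-- The average over the positions of the joint law of the reproduction symbol `a x i` and the
letter at position `i`, where `x` is the image of the word under `π`. -/
def avgLaw (P : W → ℝ) (π : W → X) (a : (Fin b → X) → Fin b → U) (t : U × W) : ℝ :=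
  (∑ v, iidPmf P b v * ∑ i, ind ((a (fun j => π (v j)) i, v i) = t)) / b

variable {P : W → ℝ} {π : W → X} {a : (Fin b → X) → Fin b → U}

lemma sum_avgLaw_mul (hb : 0 < b) (h : U × W → ℝ) :
    ∑ v, iidPmf P b v * ∑ i, h (a (fun j => π (v j)) i, v i) =
      b * ∑ t, avgLaw P π a t * h t := by
  have hb' : (b : ℝ) ≠ 0 := by exact_mod_cast hb.ne'
  unfold avgLaw
  simp_rw [div_mul_eq_mul_div, ← sum_div, mul_div_cancel₀ _ hb', sum_mul]
  rw [sum_comm]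
  refine sum_congr rfl fun v _ => ?_
  simp_rw [mul_assoc, ← mul_sum, sum_mul]
  rw [sum_comm]
  congr 1
  refine sum_congr rfl fun i _ => ?_
  simp_rw [mul_comm (ind _)]
  rw [sum_mul_ind_eq]

lemma avgLaw_nonneg (hP : ∀ w, 0 ≤ P w) (t : U × W) : 0 ≤ avgLaw P π a t :=
  div_nonneg (sum_nonneg fun v _ => mul_nonneg (iidPmf_nonneg hP v)
    (sum_nonneg fun _ _ => ind_nonneg _)) b.cast_nonneg

lemma law_avgLaw_snd (hP : P ∈ stdSimplex ℝ W) (hb : 0 < b) :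
    law (avgLaw P π a) (fun t => t.2) = P := by
  have hb' : (b : ℝ) ≠ 0 := by exact_mod_cast hb.ne'
  ext w
  have h := sum_avgLaw_mul (P := P) (π := π) (a := a) hb fun t => ind (t.2 = w)
  rw [law_eq, ← mul_right_inj' hb', ← h]
  simp_rw [mul_sum]
  rw [sum_comm, sum_congr rfl fun i _ => sum_iidPmf_coord hP.2 i fun w' => ind (w' = w)]
  rw [← law_eq P (fun w => w), law_id]
  simp

lemma avgLaw_mem (hP : P ∈ stdSimplex ℝ W) (hb : 0 < b) :
    avgLaw P π a ∈ stdSimplex ℝ (U × W) := by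
  refine ⟨avgLaw_nonneg hP.1, ?_⟩
  rw [← sum_law _ fun t => t.2, law_avgLaw_snd hP hb, hP.2]

/-- A word of positive probability contributes its own symbol pairs to the average. Hence densities
built from `avgLaw` are positive on every such word and their logarithms can be split. -/
lemma avgLaw_pos (hP : ∀ w, 0 ≤ P w) (hb : 0 < b) {v : Fin b → W} (hv : 0 < iidPmf P b v)
    (i : Fin b) : 0 < avgLaw P π a (a (fun j => π (v j)) i, v i) := by
  refine div_pos (hv.trans_le ?_) (by exact_mod_cast hb)
  refine le_trans ?_ (single_le_sum (fun v _ => mul_nonneg (iidPmf_nonneg hP v)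
    (sum_nonneg fun i _ => ind_nonneg _)) (mem_univ v))
  refine le_mul_of_one_le_right hv.le ?_
  rw [← ind_of (rfl : (a (fun j => π (v j)) i, v i) = (a (fun j => π (v j)) i, v i))]
  exact single_le_sum (f := fun i' => ind ((a (fun j => π (v j)) i', v i') =
    (a (fun j => π (v j)) i, v i))) (fun i _ => ind_nonneg _) (mem_univ i)

/-- The codeword is a function of the projected word, and given that word the i-th letter depends
only on its i-th projection. So the averaged law satisfies the Markov chain U → π(W) → W exactly,
for every `a`. -/
lemma avgLaw_mul (P : W → ℝ) (π : W → X) (a : (Fin b → X) → Fin b → U) (u : U) (w : W) :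
    avgLaw P π a (u, w) * law P π (π w) =
      (∑ x, iidPmf (law P π) b x * ∑ i, ind ((a x i, x i) = (u, π w))) / b * P w := by
  unfold avgLaw
  rw [div_mul_eq_mul_div, div_mul_eq_mul_div]
  congr 1
  simp_rw [mul_sum, sum_mul]
  rw [sum_comm, sum_comm (s := univ (α := Fin b → X))]
  refine sum_congr rfl fun i _ => ?_
  have h1 : ∀ v : Fin b → W, iidPmf P b v * ind ((a (fun j => π (v j)) i, v i) = (u, w)) =
      ind (a (fun j => π (v j)) i = u) * ∏ j, (P (v j) * if j = i then ind (v j = w) else 1) :=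
    fun v => by
      rw [prod_mul_distrib, prod_ite_eq' univ i, Prod.mk.injEq, ind_and]
      simp only [mem_univ, if_true, iidPmf]; ring
  simp_rw [← sum_mul, h1]
  rw [sum_prod_fiber π (fun x => ind (a x i = u))
    (fun _ j w' => P w' * if j = i then ind (w' = w) else 1), sum_mul, sum_mul]
  refine sum_congr rfl fun x _ => ?_
  have h2 : ∀ j, ∑ w', (P w' * if j = i then ind (w' = w) else 1) * ind (π w' = x j) =
      if j = i then P w * ind (π w = x i) else law P π (x j) := fun j => by
    split_ifs with hj
    · subst hj
      rw [← sum_mul_ind_eq (fun w' => P w' * ind (π w' = x j)) w]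
      refine sum_congr rfl fun w' _ => ?_
      rw [eq_comm (a := w)]; ring
    · rw [law_eq]; simp
  simp_rw [h2, Prod.mk.injEq, ind_and]
  unfold iidPmf
  rw [← mul_prod_erase univ _ (mem_univ i), ← mul_prod_erase univ (fun j => law P π (x j))
    (mem_univ i), if_pos rfl]
  have h3 : ∏ j ∈ univ.erase i, (if j = i then P w * ind (π w = x i) else law P π (x j)) =
      ∏ j ∈ univ.erase i, law P π (x j) :=
    prod_congr rfl fun j hj => if_neg (ne_of_mem_erase hj)
  rw [h3]
  by_cases hx : π w = x i
  · rw [ind_of hx, ind_of hx.symm, hx]; ring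
  · rw [ind_of_not hx, ind_of_not (Ne.symm hx)]; ring

end AvgLaw

lemma law_mid {Ω A B C : Type*} [Fintype Ω] [Fintype A] [Fintype B] [Fintype C] (Q : Ω → ℝ)
    (f : Ω → A) (g : Ω → B) (h : Ω → C) (a : A) (c : C) :
    ∑ b, law Q (fun ω => (f ω, g ω, h ω)) (a, b, c) = law Q (fun ω => (f ω, h ω)) (a, c) := by
  rw [← law_snd Q g (fun ω => (f ω, h ω))]
  refine sum_congr rfl fun b _ => ?_
  exact law_comp_injective Q (fun ω => (g ω, f ω, h ω)) (e := fun t => (t.2.1, t.1, t.2.2))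
    (fun s t h => by simp only [Prod.mk.injEq] at h; ext <;> simp [h]) (b, a, c)

/-! ### Tensorization and the receivers' likelihood ratios. -/

section Words

variable {X Y₁ Y₂ Z₁ U B : Type*} [Fintype X] [Fintype Y₁] [Fintype Y₂] [Fintype Z₁] [Fintype U]
  [Fintype B] {b : ℕ} {P : X × Y₁ × Y₂ × Z₁ → ℝ}

/-- Tensorization of one-letter bounds under the alternative hypothesis. -/
lemma sum_iidPmf_altPmf_le (hP : ∀ w, 0 ≤ P w) (π : X × Y₁ × Y₂ × Z₁ → B)
    {φ : (Fin b → B) → ℝ} (hφ : ∀ s, 0 ≤ φ s)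
    {h : (Fin b → B) → Fin b → X × Y₁ × Y₂ × Z₁ → ℝ} (hh0 : ∀ s i w, 0 ≤ h s i w)
    (hh : ∀ s i, ∑ w, altPmf P w * h s i w * ind (π w = s i) ≤ law P π (s i)) :
    ∑ v, iidPmf (altPmf P) b v * (φ (fun i => π (v i)) * ∏ i, h (fun i => π (v i)) i (v i)) ≤
      ∑ s, iidPmf (law P π) b s * φ s := by
  calc _ = ∑ v : Fin b → _, φ (fun i => π (v i)) *
          ∏ i, (fun s i w => altPmf P w * h s i w) (fun i => π (v i)) i (v i) := by
        refine sum_congr rfl fun v _ => ?_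
        simp only [prod_mul_distrib, iidPmf]; ring
    _ = _ := sum_prod_fiber π φ fun s i w => altPmf P w * h s i w
    _ ≤ _ := by
        refine sum_le_sum fun s _ => ?_
        rw [mul_comm]
        refine mul_le_mul_of_nonneg_right (prod_le_prod (fun i _ => ?_) fun i _ => hh s i) (hφ s)
        exact sum_nonneg fun w _ => mul_nonneg (mul_nonneg (altPmf_nonneg hP w) (hh0 _ _ _))
          (ind_nonneg _)

/-- The symbols of a codeword are dependent, but the expected logarithm of a product over positions
only sees the averaged law. This is the single-letterization used for all the densities. -/
lemma sum_iidPmf_logb_prod {W : Type*} [Fintype W] {P : W → ℝ} (hP : ∀ w, 0 ≤ P w) (hb : 0 < b)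
    {π : W → X} {a : (Fin b → X) → Fin b → U} {ρ : U × W → ℝ}
    (hρ : ∀ t, 0 < avgLaw P π a t → 0 < ρ t) :
    ∑ v, iidPmf P b v * Real.logb 2 (∏ i, ρ (a (fun j => π (v j)) i, v i)) =
      b * ∑ t, avgLaw P π a t * Real.logb 2 (ρ t) := by
  rw [← sum_avgLaw_mul hb fun t => Real.logb 2 (ρ t)]
  refine sum_congr rfl fun v _ => ?_
  rcases (iidPmf_nonneg hP v).eq_or_lt with h0 | h0
  · simp [← h0]
  · rw [logb_prod fun i => hρ _ (avgLaw_pos hP hb h0 i)]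

end Words

section Densities

variable {X Y₁ Y₂ Z₁ U₀ U₁ : Type*} [Fintype X] [Fintype Y₁] [Fintype Y₂] [Fintype Z₁]
  [Fintype U₀] [Fintype U₁] {P : X × Y₁ × Y₂ × Z₁ → ℝ} {b m₀ m₁ : ℕ}

/-- The likelihood ratio used by Receiver 2. -/
lemma exists_density₂ (hP : P ∈ stdSimplex ℝ (X × Y₁ × Y₂ × Z₁)) (hb : 0 < b)
    (c₀ : Fin m₀ → Fin b → U₀) (c₁ : Fin m₀ → Fin m₁ → Fin b → U₁)
    (f₀ : (Fin b → X) → Fin m₀) (f₁ : (Fin b → X) → Fin m₁)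
    {R : (U₀ × U₁) × X × Y₁ × Y₂ × Z₁ → ℝ}
    (hR : R = avgLaw P (fun w => w.1) fun x i => (c₀ (f₀ x) i, c₁ (f₀ x) (f₁ x) i)) :
    ∃ d : Fin m₀ → (Fin b → Y₂) → ℝ, (∀ k y, 0 ≤ d k y) ∧
      (∀ v, 0 < iidPmf P b v → 0 < d (f₀ fun i => (v i).1) fun i => (v i).2.2.1) ∧
      ∑ v, iidPmf (altPmf P) b v * d (f₀ fun i => (v i).1) (fun i => (v i).2.2.1) ≤ 1 ∧
      ∑ v, iidPmf P b v * Real.logb 2 (d (f₀ fun i => (v i).1) fun i => (v i).2.2.1) =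
        b * mutualInfo R (fun ω => ω.1.1) (fun ω => ω.2.2.2.1) := by
  have hRm : R ∈ stdSimplex ℝ _ := hR ▸ avgLaw_mem hP hb
  have hRW : law R (fun ω => ω.2) = P := hR ▸ law_avgLaw_snd hP hb
  have hRY : law R (fun ω => ω.2.2.2.1) = law P fun w => w.2.2.1 := by
    rw [← hRW, law_law]
  -- This is P(y|u)/P(y) under the averaged law; for each fixed u its P_{Y₂}-mean is at most one.
  set r : U₀ → Y₂ → ℝ := fun u y => law R (fun ω => (ω.1.1, ω.2.2.2.1)) (u, y) /
    (law R (fun ω => ω.1.1) u * law R (fun ω => ω.2.2.2.1) y) with hr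
  have r0 : ∀ u y, 0 ≤ r u y := fun u y => div_nonneg (law_nonneg hRm.1 _ _)
    (mul_nonneg (law_nonneg hRm.1 _ _) (law_nonneg hRm.1 _ _))
  have rpos : ∀ t, 0 < R t → 0 < r t.1.1 t.2.2.2.1 := fun t ht =>
    div_pos (law_pos hRm.1 (fun ω => (ω.1.1, ω.2.2.2.1)) ht)
      (mul_pos (law_pos hRm.1 (fun ω => ω.1.1) ht) (law_pos hRm.1 (fun ω => ω.2.2.2.1) ht))
  have hr₂ : ∀ u, ∑ y, law P (fun w => w.2.2.1) y * r u y ≤ 1 := fun u => by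
    calc _ ≤ ∑ y, law R (fun ω => (ω.1.1, ω.2.2.2.1)) (u, y) / law R (fun ω => ω.1.1) u := by
          refine sum_le_sum fun y _ => ?_
          simp only [hr]
          rw [hRY]
          rcases eq_or_ne (law P (fun w => w.2.2.1) y) 0 with h | h
          · rw [h, zero_mul]; exact div_nonneg (law_nonneg hRm.1 _ _) (law_nonneg hRm.1 _ _)
          · refine le_of_eq ?_
            rw [← div_div]; field_simp
      _ ≤ 1 := by rw [← sum_div, law_fst]; exact div_self_le_one _
  refine ⟨fun k y => ∏ i, r (c₀ k i) (y i), fun k y => prod_nonneg fun i _ => r0 _ _,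
    fun v hv => prod_pos fun i _ => ?_, ?_, ?_⟩
  · have := avgLaw_pos (π := fun w : X × Y₁ × Y₂ × Z₁ => w.1)
      (a := fun x i => (c₀ (f₀ x) i, c₁ (f₀ x) (f₁ x) i)) hP.1 hb hv i
    rw [← hR] at this
    exact rpos _ this
  · have := sum_iidPmf_altPmf_le (b := b) hP.1 (fun w => w.1) (φ := fun _ => 1)
      (fun _ => zero_le_one)
      (h := fun x i w => r (c₀ (f₀ x) i) w.2.2.1) (fun s i w => r0 _ _) (fun s i => by
        have := sum_altPmf_mul_le hP.1 (g := fun x _ => ind (x = s i)) (r₁ := fun _ _ => 1)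
          (r₂ := r (c₀ (f₀ s) i)) (fun _ _ => ind_nonneg _) (r0 _) (sum_condLaw_le_one P) (hr₂ _)
        rw [law_eq]
        refine le_trans (le_of_eq (sum_congr rfl fun w _ => ?_)) this
        ring)
    simp only [one_mul, mul_one] at this
    refine this.trans (iidPmf_mem (law_mem hP _) b).2.le
  · rw [mutualInfo_eq_sum]
    have := sum_iidPmf_logb_prod (P := P) (π := fun w => w.1)
      (a := fun x i => (c₀ (f₀ x) i, c₁ (f₀ x) (f₁ x) i)) hP.1 hb
      (ρ := fun t => r t.1.1 t.2.2.2.1) (fun t ht => rpos t (hR ▸ ht))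
    rw [← hR] at this
    exact this

/-- The likelihood ratio used by Receiver 1, together with its one-sided tensorization for an
arbitrary, possibly incorrect, second index. -/
lemma exists_density₁ (hP : P ∈ stdSimplex ℝ (X × Y₁ × Y₂ × Z₁)) (hb : 0 < b)
    (c₀ : Fin m₀ → Fin b → U₀) (c₁ : Fin m₀ → Fin m₁ → Fin b → U₁)
    (f₀ : (Fin b → X) → Fin m₀) (f₁ : (Fin b → X) → Fin m₁)
    {R : (U₀ × U₁) × X × Y₁ × Y₂ × Z₁ → ℝ}
    (hR : R = avgLaw P (fun w => w.1) fun x i => (c₀ (f₀ x) i, c₁ (f₀ x) (f₁ x) i)) :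
    ∃ d : Fin m₀ → Fin m₁ → (Fin b → Y₁) → (Fin b → Z₁) → ℝ, (∀ k a y z, 0 ≤ d k a y z) ∧
      (∀ v, 0 < iidPmf P b v → 0 < d (f₀ fun i => (v i).1) (f₁ fun i => (v i).1)
        (fun i => (v i).2.1) fun i => (v i).2.2.2) ∧
      (∀ (a : (Fin b → X) → Fin m₁) (φ : (Fin b → X) → (Fin b → Z₁) → ℝ), (∀ x z, 0 ≤ φ x z) →
        ∑ v, iidPmf (altPmf P) b v * (φ (fun i => (v i).1) (fun i => (v i).2.2.2) *
          d (f₀ fun i => (v i).1) (a fun i => (v i).1) (fun i => (v i).2.1)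
            (fun i => (v i).2.2.2)) ≤
        ∑ v, iidPmf P b v * φ (fun i => (v i).1) (fun i => (v i).2.2.2)) ∧
      ∑ v, iidPmf P b v * Real.logb 2 (d (f₀ fun i => (v i).1) (f₁ fun i => (v i).1)
        (fun i => (v i).2.1) fun i => (v i).2.2.2) =
        b * condMutualInfo R (fun ω => ω.1) (fun ω => ω.2.2.1) (fun ω => ω.2.2.2.2) := by
  have hRm : R ∈ stdSimplex ℝ _ := hR ▸ avgLaw_mem hP hb
  have hRW : law R (fun ω => ω.2) = P := hR ▸ law_avgLaw_snd hP hb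
  have hRZ : law R (fun ω => ω.2.2.2.2) = law P fun w => w.2.2.2 := by
    rw [← hRW, law_law]
  have hRYZ : law R (fun ω => (ω.2.2.1, ω.2.2.2.2)) = law P fun w => (w.2.1, w.2.2.2) := by
    rw [← hRW, law_law]
  -- This is P(y|u,z)/P(y|z). It is normalized for every u separately, not just for the codeword
  -- that the encoder selected, and so the second label can be arbitrary.
  set r : U₀ × U₁ → Y₁ → Z₁ → ℝ := fun u y z => law R (fun ω => ω.2.2.2.2) z *
    law R (fun ω => (ω.1, ω.2.2.1, ω.2.2.2.2)) (u, y, z) /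
    (law R (fun ω => (ω.1, ω.2.2.2.2)) (u, z) *
      law R (fun ω => (ω.2.2.1, ω.2.2.2.2)) (y, z)) with hr
  have r0 : ∀ u y z, 0 ≤ r u y z := fun u y z =>
    div_nonneg (mul_nonneg (law_nonneg hRm.1 _ _) (law_nonneg hRm.1 _ _))
      (mul_nonneg (law_nonneg hRm.1 _ _) (law_nonneg hRm.1 _ _))
  have rpos : ∀ t, 0 < R t → 0 < r t.1 t.2.2.1 t.2.2.2.2 := fun t ht =>
    div_pos (mul_pos (law_pos hRm.1 (fun ω => ω.2.2.2.2) ht)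
      (law_pos hRm.1 (fun ω => (ω.1, ω.2.2.1, ω.2.2.2.2)) ht))
      (mul_pos (law_pos hRm.1 (fun ω => (ω.1, ω.2.2.2.2)) ht)
        (law_pos hRm.1 (fun ω => (ω.2.2.1, ω.2.2.2.2)) ht))
  have hr₁ : ∀ u z, ∑ y, law P (fun w => (w.2.1, w.2.2.2)) (y, z) /
      law P (fun w => w.2.2.2) z * r u y z ≤ 1 := fun u z => by
    calc _ ≤ ∑ y, law R (fun ω => (ω.1, ω.2.2.1, ω.2.2.2.2)) (u, y, z) /
            law R (fun ω => (ω.1, ω.2.2.2.2)) (u, z) := by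
          refine sum_le_sum fun y _ => ?_
          simp only [hr]
          rw [hRYZ, hRZ]
          have hn : 0 ≤ law R (fun ω => (ω.1, ω.2.2.1, ω.2.2.2.2)) (u, y, z) /
            law R (fun ω => (ω.1, ω.2.2.2.2)) (u, z) :=
            div_nonneg (law_nonneg hRm.1 _ _) (law_nonneg hRm.1 _ _)
          rcases eq_or_ne (law P (fun w => (w.2.1, w.2.2.2)) (y, z)) 0 with h | h
          · rw [h, zero_div, zero_mul]; exact hn
          rcases eq_or_ne (law P (fun w => w.2.2.2) z) 0 with h' | h'
          · rw [h', div_zero, zero_mul]; exact hn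
          · refine le_of_eq ?_
            field_simp
      _ ≤ 1 := by
          rw [← sum_div, law_mid R (fun ω => ω.1) (fun ω => ω.2.2.1) fun ω => ω.2.2.2.2]
          exact div_self_le_one _
  refine ⟨fun k a y z => ∏ i, r (c₀ k i, c₁ k a i) (y i) (z i),
    fun k a y z => prod_nonneg fun i _ => r0 _ _ _,
    fun v hv => prod_pos fun i _ => ?_, fun a φ hφ => ?_, ?_⟩
  · have := avgLaw_pos (π := fun w : X × Y₁ × Y₂ × Z₁ => w.1)
      (a := fun x i => (c₀ (f₀ x) i, c₁ (f₀ x) (f₁ x) i)) hP.1 hb hv i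
    rw [← hR] at this
    exact rpos _ this
  -- Both x and z are held fixed while Y₁ is summed out, because `φ` and the labels depend on these
  -- words only.
  · have := sum_iidPmf_altPmf_le (b := b) hP.1 (fun w => (w.1, w.2.2.2))
      (φ := fun s => φ (fun i => (s i).1) fun i => (s i).2) (fun _ => hφ _ _)
      (h := fun s i w => r (c₀ (f₀ fun i => (s i).1) i,
        c₁ (f₀ fun i => (s i).1) (a fun i => (s i).1) i) w.2.1 w.2.2.2)
      (fun s i w => r0 _ _ _) (fun s i => by
        have := sum_altPmf_mul_le hP.1 (g := fun x z => ind ((x, z) = s i))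
          (r₁ := r (c₀ (f₀ fun i => (s i).1) i,
            c₁ (f₀ fun i => (s i).1) (a fun i => (s i).1) i)) (r₂ := fun _ => 1)
          (fun _ _ => ind_nonneg _) (fun _ => zero_le_one) (hr₁ _)
          (by simpa using (law_mem hP fun w => w.2.2.1).2.le)
        rw [law_eq]
        refine le_trans (le_of_eq (sum_congr rfl fun w _ => ?_)) this
        ring)
    refine this.trans_eq ?_
    exact (sum_iidPmf_fiber P (fun w => (w.1, w.2.2.2))
      fun s => φ (fun i => (s i).1) fun i => (s i).2).symm
  · rw [condMutualInfo_eq_sum]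
    have := sum_iidPmf_logb_prod (P := P) (π := fun w => w.1)
      (a := fun x i => (c₀ (f₀ x) i, c₁ (f₀ x) (f₁ x) i)) hP.1 hb
      (ρ := fun t => r t.1 t.2.2.1 t.2.2.2.2) (fun t ht => rpos t (hR ▸ ht))
    rw [← hR] at this
    exact this

end Densities

/-! ### Entropy of the first label with the side information, and the bin density. -/

section LabelEntropy

variable {X Y₁ Y₂ Z₁ U₀ U₁ : Type*} [Fintype X] [Fintype Y₁] [Fintype Y₂] [Fintype Z₁]
  [Fintype U₀] [Fintype U₁] {P : X × Y₁ × Y₂ × Z₁ → ℝ} {b m₀ m₁ : ℕ}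

lemma sum_mul_logb_law_div {Ω A B : Type*} [Fintype Ω] [Fintype A] [Fintype B] {R : Ω → ℝ}
    (hR : ∀ ω, 0 ≤ R ω) (f : Ω → A) (g : Ω → B) :
    ∑ ω, R ω * Real.logb 2 (law R f (f ω) / law R g (g ω)) = ent R g - ent R f := by
  unfold ent
  rw [neg_sub_neg, ← sum_sub_distrib]
  refine sum_congr rfl fun ω _ => ?_
  rcases (hR ω).eq_or_lt with h0 | h0
  · simp [← h0]
  · rw [Real.logb_div (law_pos hR f h0).ne' (law_pos hR g h0).ne']; ring

/-- A lower bound on the joint entropy of the first label and the side information. -/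
lemma le_ent_label (hP : P ∈ stdSimplex ℝ (X × Y₁ × Y₂ × Z₁)) (hb : 0 < b)
    (c₀ : Fin m₀ → Fin b → U₀) (c₁ : Fin m₀ → Fin m₁ → Fin b → U₁)
    (f₀ : (Fin b → X) → Fin m₀) (f₁ : (Fin b → X) → Fin m₁)
    {R : (U₀ × U₁) × X × Y₁ × Y₂ × Z₁ → ℝ}
    (hR : R = avgLaw P (fun w => w.1) fun x i => (c₀ (f₀ x) i, c₁ (f₀ x) (f₁ x) i)) :
    b * (ent R (fun ω => (ω.2.1, ω.2.2.2.2)) + ent R (fun ω => (ω.1.1, ω.2.2.2.2)) -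
      ent R (fun ω => (ω.1.1, ω.2.1, ω.2.2.2.2))) ≤
    ent (iidPmf P b) fun v => (f₀ fun i => (v i).1, fun i => (v i).2.2.2) := by
  have hRm : R ∈ stdSimplex ℝ _ := hR ▸ avgLaw_mem hP hb
  have hRW : law R (fun ω => ω.2) = P := hR ▸ law_avgLaw_snd hP hb
  have hRXZ : law R (fun ω => (ω.2.1, ω.2.2.2.2)) = law P fun w => (w.1, w.2.2.2) := by
    rw [← hRW, law_law]
  have hD := iidPmf_mem hP b
  set G := law (iidPmf P b) fun v => (f₀ fun i => (v i).1, fun i => (v i).2.2.2) with hG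
  have hGm : G ∈ stdSimplex ℝ (Fin m₀ × (Fin b → Z₁)) := law_mem hD _
  set p := law R (fun ω => (ω.2.1, ω.2.2.2.2)) with hp
  set κ : U₀ → X × Z₁ → ℝ := fun u s => law R (fun ω => (ω.1.1, ω.2.1, ω.2.2.2.2)) (u, s) /
    law R (fun ω => (ω.1.1, ω.2.2.2.2)) (u, s.2) with hκ
  have κ0 : ∀ u s, 0 ≤ κ u s := fun u s => div_nonneg (law_nonneg hRm.1 _ _)
    (law_nonneg hRm.1 _ _)
  have κpos : ∀ t, 0 < R t → 0 < κ t.1.1 (t.2.1, t.2.2.2.2) := fun t ht =>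
    div_pos (law_pos hRm.1 (fun ω => (ω.1.1, ω.2.1, ω.2.2.2.2)) ht)
      (law_pos hRm.1 (fun ω => (ω.1.1, ω.2.2.2.2)) ht)
  have ppos : ∀ t, 0 < R t → 0 < p (t.2.1, t.2.2.2.2) := fun t ht =>
    law_pos hRm.1 (fun ω => (ω.2.1, ω.2.2.2.2)) ht
  have p0 : ∀ s, 0 ≤ p s := law_nonneg hRm.1 _
  have κ1 : ∀ u z, ∑ s, κ u s * ind (s.2 = z) ≤ 1 := fun u z => by
    rw [Fintype.sum_prod_type]
    have : ∀ x, ∑ z', κ u (x, z') * ind (z' = z) = κ u (x, z) := fun x => by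
      simpa only [eq_comm] using sum_mul_ind_eq (fun z' => κ u (x, z')) z
    simp_rw [this, hκ]
    rw [← sum_div, law_mid R (fun ω => ω.1.1) (fun ω => ω.2.1) fun ω => ω.2.2.2.2]
    exact div_self_le_one _
  -- Gibbs' inequality compares the law of the words (X, Z₁) with G(k, z)∏κ, where κ is P(x|u₀,z)
  -- under the averaged law. It says that the entropy of the first label and the word of Z₁ is at
  -- least b H(X,Z₁) - b H(X|U₀,Z₁).
  have key := sum_mul_logb_nonpos hD
    (r := fun v => G (f₀ fun i => (v i).1, fun i => (v i).2.2.2) *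
      ∏ i, (κ (c₀ (f₀ fun i => (v i).1) i) ((v i).1, (v i).2.2.2) / p ((v i).1, (v i).2.2.2)))
    (fun v hv => mul_pos
      (law_pos hD.1 (fun v => (f₀ fun i => (v i).1, fun i => (v i).2.2.2)) hv)
      (prod_pos fun i _ => by
        have := avgLaw_pos (π := fun w : X × Y₁ × Y₂ × Z₁ => w.1)
          (a := fun x i => (c₀ (f₀ x) i, c₁ (f₀ x) (f₁ x) i)) hP.1 hb hv i
        rw [← hR] at this
        exact div_pos (κpos _ this) (ppos _ this))) ?_
  · have e1 : ∑ v, iidPmf P b v * Real.logb 2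
        (G (f₀ fun i => (v i).1, fun i => (v i).2.2.2) * ∏ i,
          (κ (c₀ (f₀ fun i => (v i).1) i) ((v i).1, (v i).2.2.2) / p ((v i).1, (v i).2.2.2))) =
        ∑ v, iidPmf P b v * Real.logb 2 (G (f₀ fun i => (v i).1, fun i => (v i).2.2.2)) +
        ∑ v, iidPmf P b v * Real.logb 2 (∏ i,
          (κ (c₀ (f₀ fun i => (v i).1) i) ((v i).1, (v i).2.2.2) / p ((v i).1, (v i).2.2.2))) := by
      rw [← sum_add_distrib]
      refine sum_congr rfl fun v _ => ?_
      rcases (hD.1 v).eq_or_lt with h0 | h0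
      · simp [← h0]
      · rw [Real.logb_mul, mul_add]
        · exact (law_pos hD.1 (fun v => (f₀ fun i => (v i).1, fun i => (v i).2.2.2)) h0).ne'
        · refine prod_ne_zero_iff.2 fun i _ => ?_
          have := avgLaw_pos (π := fun w : X × Y₁ × Y₂ × Z₁ => w.1)
            (a := fun x i => (c₀ (f₀ x) i, c₁ (f₀ x) (f₁ x) i)) hP.1 hb h0 i
          rw [← hR] at this
          exact (div_pos (κpos _ this) (ppos _ this)).ne'
    have e2 := sum_iidPmf_logb_prod (P := P) (π := fun w => w.1)
      (a := fun x i => (c₀ (f₀ x) i, c₁ (f₀ x) (f₁ x) i)) hP.1 hb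
      (ρ := fun t => κ t.1.1 (t.2.1, t.2.2.2.2) / p (t.2.1, t.2.2.2.2))
      (fun t ht => div_pos (κpos t (hR ▸ ht)) (ppos t (hR ▸ ht)))
    rw [← hR] at e2
    have e3 : ∑ t, R t * Real.logb 2 (κ t.1.1 (t.2.1, t.2.2.2.2) / p (t.2.1, t.2.2.2.2)) =
        ent R (fun ω => (ω.1.1, ω.2.2.2.2)) - ent R (fun ω => (ω.1.1, ω.2.1, ω.2.2.2.2)) +
          ent R (fun ω => (ω.2.1, ω.2.2.2.2)) := by
      rw [← sum_mul_logb_law_div hRm.1]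
      unfold ent
      rw [← sub_eq_add_neg, ← sum_sub_distrib]
      refine sum_congr rfl fun t _ => ?_
      rcases (hRm.1 t).eq_or_lt with h0 | h0
      · simp [← h0]
      · rw [Real.logb_div (κpos t h0).ne' (ppos t h0).ne', mul_sub]
    rw [e3] at e2
    rw [e1] at key
    simp only at e2
    rw [e2] at key
    unfold ent at key ⊢
    rw [← hG] 
    linarith
  · have e := sum_iidPmf_fiber P (fun w => (w.1, w.2.2.2)) (n := b) fun s =>
      G (f₀ fun i => (s i).1, fun i => (s i).2) *
        ∏ i, (κ (c₀ (f₀ fun i => (s i).1) i) (s i) / p (s i))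
    refine e.trans_le ?_
    rw [← hRXZ]
    -- The label determined by x is replaced by a sum over all k. With k free of x, the sum over x
    -- factors over positions.
    calc _ ≤ ∑ s : Fin b → X × Z₁, ∑ k, G (k, fun i => (s i).2) * ∏ i, κ (c₀ k i) (s i) := by
          refine sum_le_sum fun s _ => ?_
          refine le_trans ?_ (single_le_sum (f := fun k => G (k, fun i => (s i).2) *
            ∏ i, κ (c₀ k i) (s i)) (fun k _ => mul_nonneg (hGm.1 _)
              (prod_nonneg fun i _ => κ0 _ _)) (mem_univ (f₀ fun i => (s i).1)))
          rw [mul_left_comm]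
          refine mul_le_mul_of_nonneg_left ?_ (hGm.1 _)
          unfold iidPmf
          rw [← prod_mul_distrib]
          refine prod_le_prod (fun i _ => mul_nonneg (p0 _) (div_nonneg (κ0 _ _) (p0 _)))
            fun i _ => ?_
          rcases (p0 (s i)).eq_or_lt with h | h
          · rw [← h, zero_mul]; exact κ0 _ _
          · rw [mul_div_cancel₀ _ h.ne']
      _ = ∑ k, ∑ z : Fin b → Z₁, G (k, z) * ∏ i, ∑ s, κ (c₀ k i) s * ind (s.2 = z i) := by
          rw [sum_comm]
          refine sum_congr rfl fun k _ => ?_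
          exact sum_prod_fiber (fun s : X × Z₁ => s.2) (fun z => G (k, z))
            fun _ i s => κ (c₀ k i) s
      _ ≤ ∑ k, ∑ z : Fin b → Z₁, G (k, z) := by
          refine sum_le_sum fun k _ => sum_le_sum fun z _ => ?_
          exact mul_le_of_le_one_right (hGm.1 _) (prod_le_one
            (fun i _ => sum_nonneg fun s _ => mul_nonneg (κ0 _ _) (ind_nonneg _))
            fun i _ => κ1 _ _)
      _ = 1 := by rw [← Fintype.sum_prod_type']; exact hGm.2

/-- The codeword-counting density used by Receiver 1 to rule out the wrong codewords in a bin. -/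
lemma exists_binDensity (hP : P ∈ stdSimplex ℝ (X × Y₁ × Y₂ × Z₁)) (hb : 0 < b)
    (hm₀ : 0 < m₀) (hm₁ : 0 < m₁)
    (c₀ : Fin m₀ → Fin b → U₀) (c₁ : Fin m₀ → Fin m₁ → Fin b → U₁)
    (f₀ : (Fin b → X) → Fin m₀) (f₁ : (Fin b → X) → Fin m₁)
    {R : (U₀ × U₁) × X × Y₁ × Y₂ × Z₁ → ℝ}
    (hR : R = avgLaw P (fun w => w.1) fun x i => (c₀ (f₀ x) i, c₁ (f₀ x) (f₁ x) i)) :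
    ∃ d : Fin m₀ → Fin m₁ → (Fin b → Z₁) → ℝ, (∀ k a z, 0 ≤ d k a z) ∧
      (∀ v, 0 < iidPmf P b v →
        0 < d (f₀ fun i => (v i).1) (f₁ fun i => (v i).1) fun i => (v i).2.2.2) ∧
      ∑ a, ∑ v, iidPmf P b v * d (f₀ fun i => (v i).1) a (fun i => (v i).2.2.2) ≤ 1 ∧
      b * (ent R (fun ω => ω.1) - ent R (fun ω => (ω.1, ω.2.2.2.2)) +
        ent R (fun ω => (ω.2.1, ω.2.2.2.2)) + ent R (fun ω => (ω.1.1, ω.2.2.2.2)) -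
        ent R (fun ω => (ω.1.1, ω.2.1, ω.2.2.2.2))) - Real.logb 2 m₀ - Real.logb 2 m₁ ≤
      ∑ v, iidPmf P b v * Real.logb 2
        (d (f₀ fun i => (v i).1) (f₁ fun i => (v i).1) fun i => (v i).2.2.2) := by
  have hRm : R ∈ stdSimplex ℝ _ := hR ▸ avgLaw_mem hP hb
  have hD := iidPmf_mem hP b
  have hent := le_ent_label hP hb c₀ c₁ f₀ f₁ hR
  unfold ent at hent
  set G := law (iidPmf P b) fun v => (f₀ fun i => (v i).1, fun i => (v i).2.2.2) with hG
  have hGm : G ∈ stdSimplex ℝ (Fin m₀ × (Fin b → Z₁)) := law_mem hD _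
  have hm₀' : (0 : ℝ) < m₀ := by exact_mod_cast hm₀
  have hm₁' : (0 : ℝ) < m₁ := by exact_mod_cast hm₁
  set κ : U₀ × U₁ → Z₁ → ℝ := fun u z => law R (fun ω => (ω.1, ω.2.2.2.2)) (u, z) /
    law R (fun ω => ω.1) u with hκ
  have κ0 : ∀ u s, 0 ≤ κ u s := fun u s => div_nonneg (law_nonneg hRm.1 _ _)
    (law_nonneg hRm.1 _ _)
  have κpos : ∀ t, 0 < R t → 0 < κ t.1 t.2.2.2.2 := fun t ht =>
    div_pos (law_pos hRm.1 (fun ω => (ω.1, ω.2.2.2.2)) ht)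
      (law_pos hRm.1 (fun ω => ω.1) ht)
  have κ1 : ∀ u, ∑ z, κ u z ≤ 1 := fun u => by
    simp_rw [hκ]; rw [← sum_div, law_fst]; exact div_self_le_one _
  have hpp : ∀ v, 0 < iidPmf P b v → 0 < ∏ i, κ (c₀ (f₀ fun i => (v i).1) i,
      c₁ (f₀ fun i => (v i).1) (f₁ fun i => (v i).1) i) (v i).2.2.2 := fun v hv =>
    prod_pos fun i _ => by
      have := avgLaw_pos (π := fun w : X × Y₁ × Y₂ × Z₁ => w.1)
        (a := fun x i => (c₀ (f₀ x) i, c₁ (f₀ x) (f₁ x) i)) hP.1 hb hv i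
      rw [← hR] at this
      exact κpos _ this
  have hGpos : ∀ v, 0 < iidPmf P b v → 0 < G (f₀ fun i => (v i).1, fun i => (v i).2.2.2) :=
    fun v hv => law_pos hD.1 (fun v => (f₀ fun i => (v i).1, fun i => (v i).2.2.2)) hv
  -- Here κ is P(z|u) under the averaged law. Division by G cancels the law of the first label and
  -- the word of Z₁ on averaging, so each of the m₀m₁ label pairs contributes at most 1/(m₀m₁).
  refine ⟨fun k a z => (∏ i, κ (c₀ k i, c₁ k a i) (z i)) / (m₀ * m₁ * G (k, z)),
    fun k a z => div_nonneg (prod_nonneg fun i _ => κ0 _ _)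
      (mul_nonneg (by positivity) (hGm.1 _)),
    fun v hv => div_pos (hpp v hv) (mul_pos (by positivity) (hGpos v hv)), ?_, ?_⟩
  · calc _ ≤ ∑ a : Fin m₁, ∑ k : Fin m₀, ∑ z : Fin b → Z₁,
          (∏ i, κ (c₀ k i, c₁ k a i) (z i)) / (m₀ * m₁) := by
          refine sum_le_sum fun a _ => ?_
          rw [← sum_law_mul (iidPmf P b) (fun v => (f₀ fun i => (v i).1, fun i => (v i).2.2.2))
            fun t => (∏ i, κ (c₀ t.1 i, c₁ t.1 a i) (t.2 i)) / (m₀ * m₁ * G t),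
            Fintype.sum_prod_type]
          refine sum_le_sum fun k _ => sum_le_sum fun z _ => ?_
          rw [← hG]
          rcases (hGm.1 (k, z)).eq_or_lt with h | h
          · rw [← h, zero_mul]
            exact div_nonneg (prod_nonneg fun i _ => κ0 _ _) (by positivity)
          · refine le_of_eq ?_
            rw [← div_div]; field_simp
      _ ≤ ∑ a : Fin m₁, ∑ k : Fin m₀, 1 / ((m₀ : ℝ) * m₁) := by
          refine sum_le_sum fun a _ => sum_le_sum fun k _ => ?_
          rw [← sum_div]
          refine div_le_div_of_nonneg_right ?_ (by positivity)
          exact sum_prod_le_one (fun i => κ (c₀ k i, c₁ k a i)) (fun _ => κ0 _) fun _ => κ1 _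
      _ = 1 := by simp; field_simp
  · have e1 : ∑ v, iidPmf P b v * Real.logb 2 ((∏ i, κ (c₀ (f₀ fun i => (v i).1) i,
        c₁ (f₀ fun i => (v i).1) (f₁ fun i => (v i).1) i) (v i).2.2.2) /
          (m₀ * m₁ * G (f₀ fun i => (v i).1, fun i => (v i).2.2.2))) =
        ∑ v, iidPmf P b v * Real.logb 2 (∏ i, κ (c₀ (f₀ fun i => (v i).1) i,
          c₁ (f₀ fun i => (v i).1) (f₁ fun i => (v i).1) i) (v i).2.2.2) -
        (Real.logb 2 m₀ + Real.logb 2 m₁) -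
        ∑ v, iidPmf P b v * Real.logb 2 (G (f₀ fun i => (v i).1, fun i => (v i).2.2.2)) := by
      conv_rhs => rw [← one_mul (Real.logb 2 m₀ + Real.logb 2 m₁), ← hD.2, sum_mul]
      rw [← sum_sub_distrib, ← sum_sub_distrib]
      refine sum_congr rfl fun v _ => ?_
      rcases (hD.1 v).eq_or_lt with h0 | h0
      · simp [← h0]
      · rw [Real.logb_div (hpp v h0).ne' (mul_pos (by positivity) (hGpos v h0)).ne',
          Real.logb_mul (by positivity) (hGpos v h0).ne', Real.logb_mul hm₀'.ne' hm₁'.ne']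
        ring
    have e2 := sum_iidPmf_logb_prod (P := P) (π := fun w => w.1)
      (a := fun x i => (c₀ (f₀ x) i, c₁ (f₀ x) (f₁ x) i)) hP.1 hb
      (ρ := fun t => κ t.1 t.2.2.2.2) (fun t ht => κpos t (hR ▸ ht))
    rw [← hR] at e2
    have e3 := sum_mul_logb_law_div hRm.1 (fun ω => (ω.1, ω.2.2.2.2)) fun ω => ω.1
    simp only [hκ] at e2
    rw [e3] at e2
    rw [e1]
    simp only [hκ]
    rw [e2]
    unfold ent
    linarith

end LabelEntropy

/-! ### Block schemes: labels and test densities for one block. -/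

section Scheme

variable {X Y₁ Y₂ Z₁ U₀ U₁ : Type*} [Fintype X] [Fintype Y₁] [Fintype Y₂] [Fintype Z₁]
  [Fintype U₀] [Fintype U₁]

/-- Labels `f₀`, `f₁` of source words of length `b` and test densities, normalized under the
alternative hypothesis, whose expected logarithms under the null hypothesis are the exponents. The
density `e` bounds the number of wrong second labels that look plausible to Receiver 1. -/
structure BlockScheme (P : X × Y₁ × Y₂ × Z₁ → ℝ) (b m₀ m₁ : ℕ) (E₁ E₂ r : ℝ) where
  f₀ : (Fin b → X) → Fin m₀
  f₁ : (Fin b → X) → Fin m₁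
  d : Fin m₀ → Fin m₁ → (Fin b → Y₁) → (Fin b → Z₁) → ℝ
  e : Fin m₀ → Fin m₁ → (Fin b → Y₁) → (Fin b → Z₁) → ℝ
  d₂ : Fin m₀ → (Fin b → Y₂) → ℝ
  d_nonneg : ∀ k a y z, 0 ≤ d k a y z
  e_nonneg : ∀ k a y z, 0 ≤ e k a y z
  d₂_nonneg : ∀ k y, 0 ≤ d₂ k y
  d_pos : ∀ v, 0 < iidPmf P b v → 0 < d (f₀ fun i => (v i).1) (f₁ fun i => (v i).1)
    (fun i => (v i).2.1) fun i => (v i).2.2.2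
  e_pos : ∀ v, 0 < iidPmf P b v → 0 < e (f₀ fun i => (v i).1) (f₁ fun i => (v i).1)
    (fun i => (v i).2.1) fun i => (v i).2.2.2
  d₂_pos : ∀ v, 0 < iidPmf P b v → 0 < d₂ (f₀ fun i => (v i).1) fun i => (v i).2.2.1
  sum_d : ∑ v, iidPmf (altPmf P) b v * d (f₀ fun i => (v i).1) (f₁ fun i => (v i).1)
    (fun i => (v i).2.1) (fun i => (v i).2.2.2) ≤ 1
  sum_e : ∑ v, iidPmf (altPmf P) b v * ∑ a, e (f₀ fun i => (v i).1) a
    (fun i => (v i).2.1) (fun i => (v i).2.2.2) ≤ 1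
  sum_d₂ : ∑ v, iidPmf (altPmf P) b v * d₂ (f₀ fun i => (v i).1) (fun i => (v i).2.2.1) ≤ 1
  le_d : E₁ ≤ ∑ v, iidPmf P b v * Real.logb 2 (d (f₀ fun i => (v i).1) (f₁ fun i => (v i).1)
    (fun i => (v i).2.1) fun i => (v i).2.2.2)
  le_e : E₁ - r ≤ ∑ v, iidPmf P b v * Real.logb 2 (e (f₀ fun i => (v i).1)
    (f₁ fun i => (v i).1) (fun i => (v i).2.1) fun i => (v i).2.2.2)
  le_d₂ : E₂ ≤ ∑ v, iidPmf P b v * Real.logb 2 (d₂ (f₀ fun i => (v i).1) fun i => (v i).2.2.1)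

variable {P : X × Y₁ × Y₂ × Z₁ → ℝ} {Q : (U₀ × U₁) × X × Y₁ × Y₂ × Z₁ → ℝ}

lemma exists_forall_close_lt {Ω ι : Type*} [Fintype Ω] [Finite ι] (Q : Ω → ℝ)
    (F : ι → (Ω → ℝ) → ℝ) (hF : ∀ j, Continuous (F j)) {γ : ℝ} (hγ : 0 < γ) :
    ∃ δ > 0, ∀ R : Ω → ℝ, (∀ t, |R t - Q t| ≤ δ) → ∀ j, F j Q - γ < F j R := by
  have h : ∀ᶠ R in 𝓝 Q, ∀ j, F j Q - γ < F j R :=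
    eventually_all.2 fun j => ((hF j).tendsto Q).eventually_const_lt (by linarith)
  obtain ⟨ε, hε, h⟩ := Metric.eventually_nhds_iff.1 h
  refine ⟨ε / 2, by positivity, fun R hR => h ?_⟩
  refine lt_of_le_of_lt ((dist_pi_le_iff (by positivity)).2 fun t => ?_) (half_lt_self hε)
  rw [Real.dist_eq]; exact hR t

/-- The average joint law is close to `Q` when the joint law of reproduction and source is. -/
lemma abs_avgLaw_sub_le (hQ : Q ∈ stdSimplex ℝ ((U₀ × U₁) × X × Y₁ × Y₂ × Z₁))
    (hQP : law Q (fun ω => ω.2) = P)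
    (hM : IsMarkovChain Q (fun ω => ω.1) (fun ω => ω.2.1) fun ω => ω.2.2)
    {b : ℕ} (hb : 0 < b) {a : (Fin b → X) → Fin b → U₀ × U₁} {δ : ℝ}
    (ha : ∀ t, |∑ x, iidPmf (law P fun w => w.1) b x * ∑ i, ind ((a x i, x i) = t) -
      b * law Q (fun ω => (ω.1, ω.2.1)) t| ≤ b * δ) (t : (U₀ × U₁) × X × Y₁ × Y₂ × Z₁) :
    |avgLaw P (fun w => w.1) a t - Q t| ≤ δ := by
  obtain ⟨u, w⟩ := t
  have hP : P ∈ stdSimplex ℝ (X × Y₁ × Y₂ × Z₁) := hQP ▸ law_mem hQ _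
  have hb' : (0 : ℝ) < b := by exact_mod_cast hb
  have hδ : 0 ≤ δ := by
    have := (abs_nonneg _).trans (ha (u, w.1))
    exact nonneg_of_mul_nonneg_right this hb'
  have hRm := avgLaw_mem (π := fun w : X × Y₁ × Y₂ × Z₁ => w.1) (a := a) hP hb
  have hRW := law_avgLaw_snd (π := fun w : X × Y₁ × Y₂ × Z₁ => w.1) (a := a) hP hb
  rcases (law_nonneg hP.1 (fun w => w.1) w.1).eq_or_lt with h0 | h0
  · have hPw : P w = 0 := le_antisymm ((le_law hP.1 (fun w => w.1) w).trans h0.symm.le) (hP.1 w)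
    have h1 : avgLaw P (fun w => w.1) a (u, w) = 0 := by
      refine le_antisymm ?_ (hRm.1 _)
      have := le_law hRm.1 (fun t => t.2) (u, w)
      rwa [hRW, hPw] at this
    have h2 : Q (u, w) = 0 := by
      refine le_antisymm ?_ (hQ.1 _)
      have := le_law hQ.1 (fun t => t.2) (u, w)
      rwa [hQP, hPw] at this
    rw [h1, h2]; simpa using hδ
  -- Both laws are the joint law of (U, X) times the same factor P(w)/P_X(x), which is at most one.
  -- The error of the (U, X) law is therefore not enlarged.
  · have h1 := avgLaw_mul P (fun w => w.1) a u w
    have h2 : Q (u, w) * law P (fun w => w.1) w.1 = law Q (fun ω => (ω.1, ω.2.1)) (u, w.1) * P w := by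
      have e1 : law Q (fun ω => (ω.1, ω.2.1, ω.2.2)) (u, w.1, w.2) = Q (u, w) :=
        congrFun (law_id Q) (u, w)
      have e2 : law Q (fun ω => (ω.2.1, ω.2.2)) (w.1, w.2) = P w := congrFun hQP w
      have e3 : law Q (fun ω => ω.2.1) = law P fun w => w.1 := by rw [← hQP, law_law]
      rw [← e1, ← e2, ← e3]
      exact hM u w.1 w.2
    have hle : P w ≤ law P (fun w => w.1) w.1 := le_law hP.1 (fun w => w.1) w
    refine le_of_mul_le_mul_right ?_ h0
    calc _ = |(∑ x, iidPmf (law P fun w => w.1) b x * ∑ i, ind ((a x i, x i) = (u, w.1)) -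
          b * law Q (fun ω => (ω.1, ω.2.1)) (u, w.1))| / b * P w := by
          conv_lhs => rw [← abs_of_pos h0]
          rw [← abs_mul, sub_mul, h1, h2, ← sub_mul, abs_mul, abs_of_nonneg (hP.1 w)]
          congr 1
          nth_rewrite 3 [← abs_of_pos hb']
          rw [← abs_div]
          congr 1
          field_simp
      _ ≤ b * δ / b * P w := by
          refine mul_le_mul_of_nonneg_right ?_ (hP.1 w)
          exact div_le_div_of_nonneg_right (ha _) hb'.le
      _ = δ * P w := by field_simp
      _ ≤ _ := mul_le_mul_of_nonneg_left hle hδ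

/-- The density for wrong labels is e = d·g, with g from `exists_binDensity`. Its logarithm loses
log m₀ + log m₁ ≈ b I(U₀,U₁;X), of which the entropy terms recover all but b I(U₁;X|U₀,Z₁), thanks
to the Markov chain. -/
lemma exists_blockScheme (hQ : Q ∈ stdSimplex ℝ ((U₀ × U₁) × X × Y₁ × Y₂ × Z₁))
    (hQP : law Q (fun ω => ω.2) = P)
    (hM : IsMarkovChain Q (fun ω => ω.1) (fun ω => ω.2.1) fun ω => ω.2.2)
    {δ : ℝ} (hδ : 0 < δ) :
    ∃ b m₀ m₁ : ℕ, 0 < b ∧ 0 < m₀ ∧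
      Real.logb 2 m₀ ≤ b * (mutualInfo Q (fun ω => ω.1.1) (fun ω => ω.2.1) + δ) ∧
      Nonempty (BlockScheme P b m₀ m₁
        (b * (condMutualInfo Q (fun ω => ω.1) (fun ω => ω.2.2.1) (fun ω => ω.2.2.2.2) - δ))
        (b * (mutualInfo Q (fun ω => ω.1.1) (fun ω => ω.2.2.2.1) - δ))
        (b * (condMutualInfo Q (fun ω => ω.1.2) (fun ω => ω.2.1)
          (fun ω => (ω.1.1, ω.2.2.2.2)) + δ))) := by
  have hP : P ∈ stdSimplex ℝ (X × Y₁ × Y₂ × Z₁) := hQP ▸ law_mem hQ _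
  -- The two exponents and the per-letter gain of the bin density, in terms of entropies so that
  -- they are visibly continuous in the law.
  let F : Fin 3 → ((U₀ × U₁) × X × Y₁ × Y₂ × Z₁ → ℝ) → ℝ := ![
    fun R => ent R (fun ω => (ω.1, ω.2.2.2.2)) + ent R (fun ω => (ω.2.2.1, ω.2.2.2.2)) -
      ent R (fun ω => ω.2.2.2.2) - ent R (fun ω => (ω.1, ω.2.2.1, ω.2.2.2.2)),
    fun R => ent R (fun ω => ω.1.1) + ent R (fun ω => ω.2.2.2.1) -
      ent R (fun ω => (ω.1.1, ω.2.2.2.1)),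
    fun R => ent R (fun ω => ω.1) - ent R (fun ω => (ω.1, ω.2.2.2.2)) +
        ent R (fun ω => (ω.2.1, ω.2.2.2.2)) + ent R (fun ω => (ω.1.1, ω.2.2.2.2)) -
        ent R (fun ω => (ω.1.1, ω.2.1, ω.2.2.2.2))]
  have hF : ∀ j, Continuous (F j) := by
    intro j
    fin_cases j
    · exact (((continuous_ent _).add (continuous_ent _)).sub (continuous_ent _)).sub
        (continuous_ent _)
    · exact ((continuous_ent _).add (continuous_ent _)).sub (continuous_ent _)
    · exact ((((continuous_ent _).sub (continuous_ent _)).add (continuous_ent _)).add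
        (continuous_ent _)).sub (continuous_ent _)
  obtain ⟨ε, hε, hclose⟩ := exists_forall_close_lt Q F hF (half_pos hδ)
  obtain ⟨b, m₀, m₁, c₀, c₁, f₀, f₁, hb, hm₀, hm₁, hr₀, hr₁, ht⟩ :=
    exists_quantizer (law_mem hQ fun ω => (ω.1, ω.2.1)) (δ := min ε (δ / 4)) (by positivity)
  have hbR : (0 : ℝ) < b := by exact_mod_cast hb
  have hε1 : min ε (δ / 4) ≤ ε := min_le_left _ _
  have hε2 : min ε (δ / 4) ≤ δ / 4 := min_le_right _ _
  have hX : law (law Q fun ω => (ω.1, ω.2.1)) (fun ω => ω.2) = law P fun w => w.1 := by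
    rw [law_law, ← hQP, law_law]
  rw [hX] at ht
  have hcl := abs_avgLaw_sub_le hQ hQP hM hb
    (a := fun x i => (c₀ (f₀ x) i, c₁ (f₀ x) (f₁ x) i)) ht
  set R := avgLaw P (fun w => w.1) fun x i => (c₀ (f₀ x) i, c₁ (f₀ x) (f₁ x) i) with hR
  have hRm : R ∈ stdSimplex ℝ _ := hR ▸ avgLaw_mem hP hb
  have hFR := hclose R fun t => (hcl t).trans hε1
  have hF0 := hFR 0
  have hF1 := hFR 1
  have hF2 := hFR 2
  simp only [F, Matrix.cons_val_zero, Matrix.cons_val_one, Matrix.cons_val_two,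
    Matrix.head_cons, Matrix.tail_cons] at hF0 hF1 hF2
  have hqm := law_mem hQ fun ω => (ω.1, ω.2.1)
  rw [mutualInfo_eq hqm.1, ent_law, ent_law, ent_law] at hr₀
  rw [condMutualInfo_eq hqm.1, ent_law, ent_law, ent_law, ent_law] at hr₁
  simp only at hr₀ hr₁
  have p1 := ent_comp_injective Q (fun ω => ω.1) (e := Prod.swap) Prod.swap_injective
  have p2 := ent_comp_injective Q (fun ω => (ω.1.1, ω.2.1)) (e := Prod.swap) Prod.swap_injective
  have p3 := ent_comp_injective Q (fun ω => (ω.1, ω.2.1)) (e := fun t => (t.1.2, t.2, t.1.1))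
    (fun s t h => by simp only [Prod.mk.injEq] at h; ext <;> simp [h])
  have p4 := ent_comp_injective Q (fun ω => (ω.1, ω.2.2.2.2))
    (e := fun t => (t.1.2, t.1.1, t.2))
    (fun s t h => by simp only [Prod.mk.injEq] at h; ext <;> simp [h])
  have p5 := ent_comp_injective Q (fun ω => (ω.1.1, ω.2.1, ω.2.2.2.2))
    (e := fun t => (t.2.1, t.1, t.2.2))
    (fun s t h => by simp only [Prod.mk.injEq] at h; ext <;> simp [h])
  have p6 := ent_comp_injective Q (fun ω => (ω.1, ω.2.1, ω.2.2.2.2))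
    (e := fun t => (t.1.2, t.2.1, t.1.1, t.2.2))
    (fun s t h => by simp only [Prod.mk.injEq] at h; ext <;> simp [h])
  have hMe := (hM.comp_right fun s => s.2.2).ent_eq hQ.1
  simp only [Prod.swap] at p1 p2 p3 p4 p5 p6 hMe
  have hI₁ := condMutualInfo_eq hQ.1 (fun ω => ω.1.2) (fun ω => ω.2.1)
    (fun ω => (ω.1.1, ω.2.2.2.2))
  have hI₀ := mutualInfo_eq hQ.1 (fun ω => ω.1.1) (fun ω => ω.2.1)
  have hJ₁ := condMutualInfo_eq hQ.1 (fun ω => ω.1) (fun ω => ω.2.2.1) (fun ω => ω.2.2.2.2)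
  have hJ₂ := mutualInfo_eq hQ.1 (fun ω => ω.1.1) (fun ω => ω.2.2.2.1)
  obtain ⟨d₂, d₂0, d₂pos, d₂sum, d₂log⟩ := exists_density₂ hP hb c₀ c₁ f₀ f₁ hR
  obtain ⟨d, d0, dpos, dsum, dlog⟩ := exists_density₁ hP hb c₀ c₁ f₀ f₁ hR
  obtain ⟨g, g0, gpos, gsum, glog⟩ := exists_binDensity hP hb hm₀ hm₁ c₀ c₁ f₀ f₁ hR
  rw [mutualInfo_eq hRm.1] at d₂log
  rw [condMutualInfo_eq hRm.1] at dlog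
  have hD := iidPmf_mem hP b
  have hle_d : b * (condMutualInfo Q (fun ω => ω.1) (fun ω => ω.2.2.1) (fun ω => ω.2.2.2.2) -
      δ / 2) ≤ ∑ v, iidPmf P b v * Real.logb 2 (d (f₀ fun i => (v i).1) (f₁ fun i => (v i).1)
        (fun i => (v i).2.1) fun i => (v i).2.2.2) := by
    rw [dlog]
    exact mul_le_mul_of_nonneg_left (by linarith) hbR.le
  refine ⟨b, m₀, m₁, hb, hm₀, hr₀.trans ?_, ⟨{
    f₀ := f₀
    f₁ := f₁
    d := d
    e := fun k a y z => d k a y z * g k a z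
    d₂ := d₂
    d_nonneg := d0
    e_nonneg := fun k a y z => mul_nonneg (d0 _ _ _ _) (g0 _ _ _)
    d₂_nonneg := d₂0
    d_pos := dpos
    e_pos := fun v hv => mul_pos (dpos v hv) (gpos v hv)
    d₂_pos := d₂pos
    sum_d := ?_
    sum_e := ?_
    sum_d₂ := d₂sum
    le_d := le_trans (mul_le_mul_of_nonneg_left (by linarith) hbR.le) hle_d
    le_e := ?_
    le_d₂ := ?_ }⟩⟩
  · rw [hI₀]
    exact mul_le_mul_of_nonneg_left (by linarith) hbR.le
  · have := dsum f₁ (fun _ _ => 1) fun _ _ => zero_le_one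
    simp only [one_mul, mul_one] at this
    exact this.trans hD.2.le
  -- For each fixed second label, `d` integrates out under the alternative and leaves g averaged
  -- under the null.
  · refine le_trans ?_ gsum
    simp_rw [mul_sum]
    rw [sum_comm]
    refine sum_le_sum fun a _ => ?_
    have := dsum (fun _ => a) (fun x z => g (f₀ x) a z) fun _ _ => g0 _ _ _
    simpa only [mul_comm (g _ _ _)] using this
  · have e1 : ∑ v, iidPmf P b v * Real.logb 2 (d (f₀ fun i => (v i).1) (f₁ fun i => (v i).1)
        (fun i => (v i).2.1) (fun i => (v i).2.2.2) *
          g (f₀ fun i => (v i).1) (f₁ fun i => (v i).1) fun i => (v i).2.2.2) =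
        ∑ v, iidPmf P b v * Real.logb 2 (d (f₀ fun i => (v i).1) (f₁ fun i => (v i).1)
          (fun i => (v i).2.1) (fun i => (v i).2.2.2)) +
        ∑ v, iidPmf P b v * Real.logb 2 (g (f₀ fun i => (v i).1) (f₁ fun i => (v i).1)
          fun i => (v i).2.2.2) := by
      rw [← sum_add_distrib]
      refine sum_congr rfl fun v _ => ?_
      rcases (hD.1 v).eq_or_lt with h0 | h0
      · simp [← h0]
      · rw [Real.logb_mul (dpos v h0).ne' (gpos v h0).ne', mul_add]
    rw [e1]
    have h2 := mul_le_mul_of_nonneg_left hF2.le hbR.le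
    have h3 := mul_le_mul_of_nonneg_left hε2 hbR.le
    rw [hI₁]
    rw [p1, p2, p3] at hr₁
    rw [p4, p5, p6]
    -- By the Markov chain, I(U₀;X) + I(U₁;X|U₀) minus the third functional equals I(U₁;X|U₀,Z₁).
    -- The per-letter errors are δ/2 for `d`, δ/2 for `g` and at most δ/4 for each label rate,
    -- within the 2δ allowed.
    have h4 : (b : ℝ) * (ent Q (fun ω => (ω.1, ω.2.1, ω.2.2.2.2)) + ent Q fun ω => ω.2.1) =
      b * (ent Q (fun ω => (ω.1, ω.2.1)) + ent Q fun ω => (ω.2.1, ω.2.2.2.2)) := by rw [hMe]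
    have h5 := mul_pos hbR hδ
    linarith
  · rw [d₂log]
    exact mul_le_mul_of_nonneg_left (by linarith) hbR.le

end Scheme

/-! ### Threshold tests and random binning. -/

section Tests

variable {V A : Type*} [Fintype V] [Fintype A] {D₀ D₁ : V → ℝ}

lemma ind_le_mul_rpow {t G : ℝ} (hG : 0 ≤ G) : ind ((2 : ℝ) ^ t ≤ G) ≤ G * (2 : ℝ) ^ (-t) := by
  by_cases h : (2 : ℝ) ^ t ≤ G
  · rw [ind_of h]
    calc (1 : ℝ) = (2 : ℝ) ^ t * (2 : ℝ) ^ (-t) := by rw [← Real.rpow_add (by norm_num)]; simp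
      _ ≤ _ := mul_le_mul_of_nonneg_right h (by positivity)
  · rw [ind_of_not h]; positivity

/-- Markov's inequality for the likelihood-ratio test of i.i.d. data. -/
lemma sum_iidPmf_ind_le (hD₁ : ∀ v, 0 ≤ D₁ v) {g : V → ℝ} (hg : ∀ v, 0 ≤ g v)
    (hsum : ∑ v, D₁ v * g v ≤ 1) (k : ℕ) (t : ℝ) :
    ∑ w, iidPmf D₁ k w * ind ((2 : ℝ) ^ t ≤ ∏ i, g (w i)) ≤ (2 : ℝ) ^ (-t) := by
  calc _ ≤ ∑ w, iidPmf D₁ k w * ((∏ i, g (w i)) * (2 : ℝ) ^ (-t)) := sum_le_sum fun w _ =>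
        mul_le_mul_of_nonneg_left (ind_le_mul_rpow (prod_nonneg fun i _ => hg _))
          (iidPmf_nonneg hD₁ w)
    _ = (∑ v, D₁ v * g v) ^ k * (2 : ℝ) ^ (-t) := by
        rw [Fintype.sum_pow, sum_mul]
        refine sum_congr rfl fun w _ => ?_
        rw [prod_mul_distrib, iidPmf, mul_assoc]
    _ ≤ _ := mul_le_of_le_one_left (by positivity)
        (pow_le_one₀ (sum_nonneg fun v _ => mul_nonneg (hD₁ v) (hg v)) hsum)

/-- The likelihood-ratio test accepts i.i.d. data from the null hypothesis. -/
lemma tendsto_sum_iidPmf_reject (hD₀ : D₀ ∈ stdSimplex ℝ V) {g : V → ℝ}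
    (hg : ∀ v, 0 < D₀ v → 0 < g v) {E δ : ℝ} (hE : E ≤ ∑ v, D₀ v * Real.logb 2 (g v))
    (hδ : 0 < δ) :
    Tendsto (fun k : ℕ => ∑ w, iidPmf D₀ k w *
      ind (¬(2 : ℝ) ^ ((k : ℝ) * (E - δ)) ≤ ∏ i, g (w i))) atTop (𝓝 0) := by
  refine squeeze_zero (fun k => sum_nonneg fun w _ => mul_nonneg (iidPmf_nonneg hD₀.1 w)
    (ind_nonneg _)) (fun k => sum_le_sum fun w _ => ?_)
    (tendsto_sum_iidPmf_deviation hD₀ (fun (_ : Unit) v => Real.logb 2 (g v)) hδ)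
  rcases (iidPmf_nonneg hD₀.1 w).eq_or_lt with h0 | h0
  · simp [← h0]
  refine mul_le_mul_of_nonneg_left (ind_mono fun h => ⟨(), ?_⟩) h0.le
  by_contra! hdev
  refine h ?_
  rw [← rpow_sum_logb fun i => hg _ (pos_of_iidPmf_pos hD₀.1 h0 i)]
  refine Real.rpow_le_rpow_of_exponent_le (by norm_num) ?_
  have h1 := (abs_le.1 hdev).1
  have h2 := mul_le_mul_of_nonneg_left hE k.cast_nonneg
  linarith

/-- Two distinct points collide under a uniform random map with probability 1/B: once all values off
`a` are fixed, exactly one value at `a` collides. -/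
lemma card_mul_sum_ind_eq [DecidableEq A] {B : ℕ} {a a' : A} (h : a ≠ a') :
    (B : ℝ) * ∑ f : A → Fin B, ind (f a = f a') = Fintype.card (A → Fin B) := by
  rw [← (Equiv.funSplitAt a (Fin B)).symm.sum_comp, Fintype.sum_prod_type, sum_comm]
  have h1 : ∀ (g : {j // j ≠ a} → Fin B) (c : Fin B),
      ind ((Equiv.funSplitAt a (Fin B)).symm (c, g) a =
        (Equiv.funSplitAt a (Fin B)).symm (c, g) a') = ind (g ⟨a', h.symm⟩ = c) := fun g c => by
    simp [Equiv.funSplitAt, Equiv.piSplitAt, h, eq_comm]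
  have h2 : ∀ g : {j // j ≠ a} → Fin B, ∑ c, ind (g ⟨a', h.symm⟩ = c) = 1 := fun g => by
    simpa using sum_mul_ind_eq (fun _ => (1 : ℝ)) (g ⟨a', h.symm⟩)
  simp_rw [h1, h2]
  rw [Fintype.card_congr (Equiv.funSplitAt a (Fin B)), Fintype.card_prod]
  simp

/-- Random binning: some bin assignment makes a plausible wrong label in the bin unlikely. -/
lemma exists_binning (hD₁ : ∀ v, 0 ≤ D₁ v) (F : V → A) {e : V → A → ℝ} (he : ∀ v a, 0 ≤ e v a)
    (hsum : ∑ v, D₁ v * ∑ a, e v a ≤ 1) (k : ℕ) {B : ℕ} (hB : 0 < B) (t : ℝ) :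
    ∃ h : (Fin k → A) → Fin B, ∑ w, iidPmf D₁ k w *
      ind (∃ a, a ≠ (fun i => F (w i)) ∧ h a = h (fun i => F (w i)) ∧
        (2 : ℝ) ^ t ≤ ∏ i, e (w i) (a i)) ≤ (B : ℝ)⁻¹ * (2 : ℝ) ^ (-t) := by
  classical
  have : Nonempty (Fin B) := ⟨⟨0, hB⟩⟩
  have hB' : (0 : ℝ) < B := by exact_mod_cast hB
  set N : ℝ := (Fintype.card ((Fin k → A) → Fin B) : ℝ) with hN
  have hN0 : 0 < N := Nat.cast_pos.2 Fintype.card_pos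
  refine exists_le_of_sum_mul_le (w := fun _ => N⁻¹) ⟨fun _ => (inv_pos.2 hN0).le, ?_⟩ ?_
  · rw [sum_const, card_univ, nsmul_eq_mul, ← hN, mul_inv_cancel₀ hN0.ne']
  have hav : ∀ (w : Fin k → V) (a : Fin k → A), ∑ h : (Fin k → A) → Fin B,
      N⁻¹ * (ind (a ≠ (fun i => F (w i))) * ind (h a = h (fun i => F (w i)))) ≤ (B : ℝ)⁻¹ :=
    fun w a => by
      by_cases hne : a = fun i => F (w i)
      · rw [ind_of_not (not_not.2 hne)]; simp
      · rw [ind_of hne]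
        have := card_mul_sum_ind_eq (B := B) hne
        rw [← hN] at this
        simp_rw [one_mul, ← mul_sum]
        refine le_of_eq ?_
        field_simp
        rw [mul_comm]; exact this
  calc _ ≤ ∑ h : (Fin k → A) → Fin B, N⁻¹ * ∑ w, iidPmf D₁ k w * ∑ a : Fin k → A,
          (ind (a ≠ (fun i => F (w i))) * ind (h a = h (fun i => F (w i)))) *
            ((∏ i, e (w i) (a i)) * (2 : ℝ) ^ (-t)) := by
        refine sum_le_sum fun h _ => mul_le_mul_of_nonneg_left (sum_le_sum fun w _ =>
          mul_le_mul_of_nonneg_left ((ind_exists_le _).trans (sum_le_sum fun a _ => ?_))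
            (iidPmf_nonneg hD₁ w)) (inv_pos.2 hN0).le
        rw [ind_and, ind_and, ← mul_assoc]
        exact mul_le_mul_of_nonneg_left (ind_le_mul_rpow (prod_nonneg fun i _ => he _ _))
          (mul_nonneg (ind_nonneg _) (ind_nonneg _))
    _ = ∑ w, iidPmf D₁ k w * ∑ a : Fin k → A, (∑ h : (Fin k → A) → Fin B,
          N⁻¹ * (ind (a ≠ (fun i => F (w i))) * ind (h a = h (fun i => F (w i))))) *
            ((∏ i, e (w i) (a i)) * (2 : ℝ) ^ (-t)) := by
        simp_rw [mul_sum, sum_mul, mul_sum]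
        rw [sum_comm]
        refine sum_congr rfl fun w _ => ?_
        rw [sum_comm]
        refine sum_congr rfl fun a _ => sum_congr rfl fun h _ => by ring
    _ ≤ ∑ w, iidPmf D₁ k w * ∑ a : Fin k → A, (B : ℝ)⁻¹ *
            ((∏ i, e (w i) (a i)) * (2 : ℝ) ^ (-t)) := by
        refine sum_le_sum fun w _ => mul_le_mul_of_nonneg_left (sum_le_sum fun a _ =>
          mul_le_mul_of_nonneg_right (hav w a) ?_) (iidPmf_nonneg hD₁ w)
        exact mul_nonneg (prod_nonneg fun i _ => he _ _) (by positivity)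
    _ = (B : ℝ)⁻¹ * ((∑ v, D₁ v * ∑ a, e v a) ^ k * (2 : ℝ) ^ (-t)) := by
        rw [Fintype.sum_pow, sum_mul, mul_sum]
        refine sum_congr rfl fun w _ => ?_
        rw [prod_mul_distrib, ← sum_prod_eq fun i a => e (w i) a, ← mul_sum, ← sum_mul]
        unfold iidPmf
        ring
    _ ≤ _ := by
        refine mul_le_mul_of_nonneg_left (mul_le_of_le_one_left (by positivity) ?_)
          (by positivity)
        exact pow_le_one₀ (sum_nonneg fun v _ =>
          mul_nonneg (hD₁ v) (sum_nonneg fun a _ => he v a)) hsum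

end Tests

/-! ### Tests on several blocks. -/

section Superblock

variable {X Y₁ Y₂ Z₁ : Type*} [Fintype X] [Fintype Y₁] [Fintype Y₂] [Fintype Z₁]
  {P : X × Y₁ × Y₂ × Z₁ → ℝ} {b m₀ m₁ : ℕ} {E₁ E₂ r : ℝ}

/-- Tests on `k` blocks, based on the first labels and the bin of the second labels. -/
lemma BlockScheme.exists_tests (S : BlockScheme P b m₀ m₁ E₁ E₂ r)
    (hP : P ∈ stdSimplex ℝ (X × Y₁ × Y₂ × Z₁)) {δ : ℝ} (hδ : 0 < δ) :
    ∃ η : ℕ → ℝ, Tendsto η atTop (𝓝 0) ∧ ∀ k B : ℕ, (2 : ℝ) ^ ((k : ℝ) * r) ≤ B →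
      ∃ (h : (Fin k → Fin m₁) → Fin B)
        (T₁ : (Fin k → Fin m₀) → Fin B → (Fin k → Fin b → Y₁) → (Fin k → Fin b → Z₁) → Prop)
        (T₂ : (Fin k → Fin m₀) → (Fin k → Fin b → Y₂) → Prop),
        ∑ w, iidPmf (iidPmf P b) k w * ind (¬T₁ (fun j => S.f₀ fun i => (w j i).1)
          (h fun j => S.f₁ fun i => (w j i).1) (fun j i => (w j i).2.1)
          fun j i => (w j i).2.2.2) ≤ η k ∧
        ∑ w, iidPmf (iidPmf P b) k w * ind (¬T₂ (fun j => S.f₀ fun i => (w j i).1)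
          fun j i => (w j i).2.2.1) ≤ η k ∧
        ∑ w, iidPmf (iidPmf (altPmf P) b) k w * ind (T₁ (fun j => S.f₀ fun i => (w j i).1)
          (h fun j => S.f₁ fun i => (w j i).1) (fun j i => (w j i).2.1)
          fun j i => (w j i).2.2.2) ≤ 2 * (2 : ℝ) ^ (-((k : ℝ) * (E₁ - δ))) ∧
        ∑ w, iidPmf (iidPmf (altPmf P) b) k w * ind (T₂ (fun j => S.f₀ fun i => (w j i).1)
          fun j i => (w j i).2.2.1) ≤ 2 * (2 : ℝ) ^ (-((k : ℝ) * (E₂ - δ))) := by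
  have hD := iidPmf_mem hP b
  have hA : ∀ v : Fin b → _, 0 ≤ iidPmf (altPmf P) b v := iidPmf_nonneg (altPmf_nonneg hP.1)
  have t1 := tendsto_sum_iidPmf_reject hD S.d_pos S.le_d hδ
  have t2 := tendsto_sum_iidPmf_reject hD S.e_pos S.le_e hδ
  have t3 := tendsto_sum_iidPmf_reject hD S.d₂_pos S.le_d₂ hδ
  have t := (t1.add t2).add t3
  rw [add_zero, add_zero] at t
  refine ⟨_, t, fun k B hB => ?_⟩
  have hB0 : (0 : ℝ) < B := lt_of_lt_of_le (by positivity) hB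
  obtain ⟨h, hh⟩ := exists_binning hA (fun v => S.f₁ fun i => (v i).1)
    (e := fun v a => S.e (S.f₀ fun i => (v i).1) a (fun i => (v i).2.1) fun i => (v i).2.2.2)
    (fun v a => S.e_nonneg _ _ _ _) S.sum_e k (by exact_mod_cast hB0) ((k : ℝ) * (E₁ - r - δ))
  -- Receiver 1 accepts when some label sequence in the announced bin passes both thresholds. The
  -- first bounds false acceptance through the true sequence, the second through all other
  -- sequences.
  refine ⟨h, fun f c y z => ∃ a, h a = c ∧
      (2 : ℝ) ^ ((k : ℝ) * (E₁ - δ)) ≤ ∏ j, S.d (f j) (a j) (y j) (z j) ∧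
      (2 : ℝ) ^ ((k : ℝ) * (E₁ - r - δ)) ≤ ∏ j, S.e (f j) (a j) (y j) (z j),
    fun f y => (2 : ℝ) ^ ((k : ℝ) * (E₂ - δ)) ≤ ∏ j, S.d₂ (f j) (y j), ?_, ?_, ?_, ?_⟩
  · refine le_trans ?_ (le_add_of_nonneg_right (sum_nonneg fun w _ =>
      mul_nonneg (iidPmf_nonneg hD.1 w) (ind_nonneg _)))
    rw [← sum_add_distrib]
    refine sum_le_sum fun w _ => ?_
    rw [← mul_add]
    refine mul_le_mul_of_nonneg_left (le_trans (ind_mono fun hn => ?_) (ind_or_le _ _))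
      (iidPmf_nonneg hD.1 w)
    by_contra! hc
    exact hn ⟨fun j => S.f₁ fun i => (w j i).1, rfl, hc.1, hc.2⟩
  · refine le_add_of_nonneg_left (add_nonneg ?_ ?_) <;>
    exact sum_nonneg fun w _ => mul_nonneg (iidPmf_nonneg hD.1 w) (ind_nonneg _)
  · have m1 := sum_iidPmf_ind_le hA (g := fun v => S.d (S.f₀ fun i => (v i).1)
      (S.f₁ fun i => (v i).1) (fun i => (v i).2.1) fun i => (v i).2.2.2)
      (fun v => S.d_nonneg _ _ _ _) S.sum_d k ((k : ℝ) * (E₁ - δ))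
    -- With at least 2^(kr) bins, the collision probability makes up for the loss of r in the
    -- exponent of the second density.
    have m2 : (B : ℝ)⁻¹ * (2 : ℝ) ^ (-((k : ℝ) * (E₁ - r - δ))) ≤
        (2 : ℝ) ^ (-((k : ℝ) * (E₁ - δ))) := by
      rw [inv_mul_le_iff₀ hB0]
      calc _ = (2 : ℝ) ^ ((k : ℝ) * r) * (2 : ℝ) ^ (-((k : ℝ) * (E₁ - δ))) := by
            rw [← Real.rpow_add (by norm_num)]; congr 1; ring
        _ ≤ _ := mul_le_mul_of_nonneg_right hB (by positivity)
    rw [two_mul]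
    refine le_trans ?_ (add_le_add m1 (hh.trans m2))
    rw [← sum_add_distrib]
    refine sum_le_sum fun w _ => ?_
    rw [← mul_add]
    refine mul_le_mul_of_nonneg_left (le_trans (ind_mono ?_) (ind_or_le _ _))
      (iidPmf_nonneg hA w)
    rintro ⟨a, ha, hd, he⟩
    by_cases hne : a = fun j => S.f₁ fun i => (w j i).1
    · subst hne; exact Or.inl hd
    · exact Or.inr ⟨a, hne, ha, he⟩
  · have m1 := sum_iidPmf_ind_le hA (g := fun v => S.d₂ (S.f₀ fun i => (v i).1)
      fun i => (v i).2.2.1) (fun v => S.d₂_nonneg _ _) S.sum_d₂ k ((k : ℝ) * (E₂ - δ))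
    refine m1.trans ?_
    have : (0 : ℝ) < (2 : ℝ) ^ (-((k : ℝ) * (E₂ - δ))) := by positivity
    linarith

end Superblock

/-! ### Restriction of a word to disjoint blocks. -/

section Marginal

variable {A : Type*} [Fintype A]

/-- Marginalization of an i.i.d. word to the positions in the range of `e`. -/
lemma sum_iidPmf_restrict {ι : Type*} [Fintype ι] [DecidableEq ι] {D : A → ℝ}
    (hD : ∑ a, D a = 1) {N : ℕ} (e : ι ↪ Fin N) (φ : (ι → A) → ℝ) :
    ∑ w, iidPmf D N w * φ (fun i => w (e i)) = ∑ v : ι → A, (∏ i, D (v i)) * φ v := by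
  have h1 : ∀ w : Fin N → A, iidPmf D N w * φ (fun i => w (e i)) =
      ∑ v : ι → A, φ v * ∏ n, (D (w n) * ind (∀ i, e i = n → w n = v i)) := fun w => by
    rw [← sum_mul_ind_eq φ (fun i => w (e i)), mul_sum]
    refine sum_congr rfl fun v _ => ?_
    rw [prod_mul_distrib, prod_ind]
    have : ((fun i => w (e i)) = v) ↔ ∀ n i, e i = n → w n = v i :=
      ⟨fun h n i hn => by rw [← h, ← hn], fun h => funext fun i => h _ i rfl⟩
    rw [this, iidPmf]; ring
  simp_rw [h1]
  rw [sum_comm]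
  refine sum_congr rfl fun v _ => ?_
  rw [← mul_sum, mul_comm, sum_prod_eq fun n a => D a * ind (∀ i, e i = n → a = v i)]
  congr 1
  refine (Fintype.prod_of_injective e e.injective _ _ (fun n hn => ?_) fun i => ?_).symm
  · rw [← hD]
    refine sum_congr rfl fun a _ => ?_
    rw [ind_of fun i hi => absurd ⟨i, hi⟩ hn, mul_one]
  · rw [← sum_mul_ind_eq D (v i)]
    refine sum_congr rfl fun a _ => ?_
    congr 2
    refine propext ⟨fun h i' hi => ?_, fun h => (h i rfl).symm⟩
    rw [← h, e.injective hi]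

lemma sum_iidPmf_blocks {D : A → ℝ} (hD : ∑ a, D a = 1) {N k b : ℕ} (e : Fin k × Fin b ↪ Fin N)
    (φ : (Fin k → Fin b → A) → ℝ) :
    ∑ w, iidPmf D N w * φ (fun j i => w (e (j, i))) = ∑ v, iidPmf (iidPmf D b) k v * φ v := by
  rw [sum_iidPmf_restrict hD e fun v => φ fun j i => v (j, i),
    ← (Equiv.curry (Fin k) (Fin b) A).sum_comp]
  refine sum_congr rfl fun v _ => ?_
  unfold iidPmf
  rw [Fintype.prod_prod_type]
  rfl

end Marginal

/-! ### Lower bounds on the extended-real exponent. -/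

section Exponent

lemma le_errorExponent {β : ℕ → ℝ} {θ : ℝ}
    (h : ∀ᶠ N : ℕ in atTop, β N ≤ (2 : ℝ) ^ (-((N : ℝ) * θ))) :
    (θ : EReal) ≤ errorExponent β := by
  unfold errorExponent
  rw [EReal.le_neg]
  refine limsup_le_of_le ?_ ?_
  · exact isCobounded_le_of_bot
  filter_upwards [h, eventually_gt_atTop 0] with N hN hpos
  have hl2 : 0 < Real.log 2 := Real.log_pos (by norm_num)
  have hN' : (0 : ℝ) < N := by exact_mod_cast hpos
  have h1 : ENNReal.log (ENNReal.ofReal (β N)) ≤ ((-((N : ℝ) * θ) * Real.log 2 : ℝ) : EReal) := by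
    refine (ENNReal.log_monotone (ENNReal.ofReal_le_ofReal hN)).trans ?_
    rw [ENNReal.log_ofReal_of_pos (by positivity), Real.log_rpow (by norm_num)]
  calc _ ≤ ((1 / (N : ℝ) : ℝ) : EReal) *
        (((-((N : ℝ) * θ) * Real.log 2 : ℝ) : EReal) / ((Real.log 2 : ℝ) : EReal)) := by
        refine mul_le_mul_of_nonneg_left ?_ (by exact_mod_cast (by positivity : 0 ≤ 1 / (N : ℝ)))
        exact EReal.div_le_div_right_of_nonneg (by exact_mod_cast hl2.le) h1
    _ = ((-θ : ℝ) : EReal) := by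
        rw [← EReal.coe_div, ← EReal.coe_mul]
        congr 1
        field_simp
    _ ≤ _ := by simp

end Exponent

/-! ### Codes built from tests. -/

section Coding

variable {X Y₁ Y₂ Z₁ : Type*} [Fintype X] [Fintype Y₁] [Fintype Y₂] [Fintype Z₁]
  {P : X × Y₁ × Y₂ × Z₁ → ℝ} {R : ℝ}

lemma altPmf_mem (hP : P ∈ stdSimplex ℝ (X × Y₁ × Y₂ × Z₁)) :
    altPmf P ∈ stdSimplex ℝ (X × Y₁ × Y₂ × Z₁) := by
  refine ⟨altPmf_nonneg hP.1, ?_⟩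
  have h := sum_altPmf_mul P (fun _ _ => 1) (fun _ _ => 1) fun _ => 1
  simp only [mul_one] at h
  rw [h, (law_mem hP _).2, mul_one, sum_comm]
  have h1 := (law_mem hP fun w => w.2.2.2).2
  rw [← h1]
  refine sum_congr rfl fun z _ => ?_
  rw [← sum_mul, ← sum_div, law_snd, law_snd, ← mul_div_assoc, mul_self_div_self]

lemma Code.prob₁_le_one {N : ℕ} (c : Code X Y₁ Y₂ Z₁ R N) {D : X × Y₁ × Y₂ × Z₁ → ℝ}
    (hD : D ∈ stdSimplex ℝ (X × Y₁ × Y₂ × Z₁)) (h : Fin 2) : c.prob₁ D h ≤ 1 := by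
  have hi := iidPmf_mem hD N
  rw [← hi.2]
  refine sum_le_sum fun w _ => mul_le_of_le_one_right (hi.1 w) ?_
  rw [← (c.enc_mem fun i => (w i).1).2]
  refine sum_le_sum fun m _ => ?_
  have := (c.enc_mem fun i => (w i).1).1 m
  split_ifs <;> simp [this]

lemma Code.prob₂_le_one {N : ℕ} (c : Code X Y₁ Y₂ Z₁ R N) {D : X × Y₁ × Y₂ × Z₁ → ℝ}
    (hD : D ∈ stdSimplex ℝ (X × Y₁ × Y₂ × Z₁)) (h : Fin 2) : c.prob₂ D h ≤ 1 := by
  have hi := iidPmf_mem hD N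
  rw [← hi.2]
  refine sum_le_sum fun w _ => mul_le_of_le_one_right (hi.1 w) ?_
  rw [← (c.enc_mem fun i => (w i).1).2]
  refine sum_le_sum fun m _ => ?_
  have := (c.enc_mem fun i => (w i).1).1 m
  split_ifs <;> simp [this]

lemma zero_le_errorExponent₁ (c : ∀ N, Code X Y₁ Y₂ Z₁ R N) {D : X × Y₁ × Y₂ × Z₁ → ℝ}
    (hD : D ∈ stdSimplex ℝ (X × Y₁ × Y₂ × Z₁)) :
    ((0 : ℝ) : EReal) ≤ errorExponent fun N => (c N).prob₁ D 0 :=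
  le_errorExponent (Eventually.of_forall fun N => by simpa using (c N).prob₁_le_one hD 0)

lemma zero_le_errorExponent₂ (c : ∀ N, Code X Y₁ Y₂ Z₁ R N) {D : X × Y₁ × Y₂ × Z₁ → ℝ}
    (hD : D ∈ stdSimplex ℝ (X × Y₁ × Y₂ × Z₁)) :
    ((0 : ℝ) : EReal) ≤ errorExponent fun N => (c N).prob₂ D 0 :=
  le_errorExponent (Eventually.of_forall fun N => by simpa using (c N).prob₂_le_one hD 0)

open scoped Classical in
/-- The code with a deterministic encoder and given acceptance regions. -/
def Code.ofTests {N : ℕ} (f : (Fin N → X) → Message R N)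
    (T₁ : Message R N → (Fin N → Y₁) → (Fin N → Z₁) → Prop)
    (T₂ : Message R N → (Fin N → Y₂) → Prop) : Code X Y₁ Y₂ Z₁ R N where
  enc x m := ind (f x = m)
  enc_mem x := ⟨fun m => ind_nonneg _, by
    simpa using sum_mul_ind_eq (fun _ => (1 : ℝ)) (f x)⟩
  dec₁ y z m := if T₁ m y z then 0 else 1
  dec₂ y m := if T₂ m y then 0 else 1

lemma Code.prob₁_ofTests {N : ℕ} (f : (Fin N → X) → Message R N)
    (T₁ : Message R N → (Fin N → Y₁) → (Fin N → Z₁) → Prop)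
    (T₂ : Message R N → (Fin N → Y₂) → Prop) (D : X × Y₁ × Y₂ × Z₁ → ℝ) :
    (Code.ofTests f T₁ T₂).prob₁ D 0 = ∑ w, iidPmf D N w *
      ind (T₁ (f fun i => (w i).1) (fun i => (w i).2.1) fun i => (w i).2.2.2) ∧
    (Code.ofTests f T₁ T₂).prob₁ D 1 = ∑ w, iidPmf D N w *
      ind (¬T₁ (f fun i => (w i).1) (fun i => (w i).2.1) fun i => (w i).2.2.2) := by
  constructor
  · refine sum_congr rfl fun w _ => ?_
    rw [← sum_mul_ind_eq (fun m => ind (T₁ m (fun i => (w i).2.1) fun i => (w i).2.2.2))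
      (f fun i => (w i).1)]
    refine congrArg _ (sum_congr rfl fun m _ => ?_)
    by_cases h : T₁ m (fun i => (w i).2.1) fun i => (w i).2.2.2 <;> simp [Code.ofTests, h, ind]
  · refine sum_congr rfl fun w _ => ?_
    rw [← sum_mul_ind_eq (fun m => ind (¬T₁ m (fun i => (w i).2.1) fun i => (w i).2.2.2))
      (f fun i => (w i).1)]
    refine congrArg _ (sum_congr rfl fun m _ => ?_)
    by_cases h : T₁ m (fun i => (w i).2.1) fun i => (w i).2.2.2 <;> simp [Code.ofTests, h, ind]

lemma Code.prob₂_ofTests {N : ℕ} (f : (Fin N → X) → Message R N)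
    (T₁ : Message R N → (Fin N → Y₁) → (Fin N → Z₁) → Prop)
    (T₂ : Message R N → (Fin N → Y₂) → Prop) (D : X × Y₁ × Y₂ × Z₁ → ℝ) :
    (Code.ofTests f T₁ T₂).prob₂ D 0 = ∑ w, iidPmf D N w *
      ind (T₂ (f fun i => (w i).1) fun i => (w i).2.2.1) ∧
    (Code.ofTests f T₁ T₂).prob₂ D 1 = ∑ w, iidPmf D N w *
      ind (¬T₂ (f fun i => (w i).1) fun i => (w i).2.2.1) := by
  constructor
  · refine sum_congr rfl fun w _ => ?_
    rw [← sum_mul_ind_eq (fun m => ind (T₂ m fun i => (w i).2.2.1))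
      (f fun i => (w i).1)]
    refine congrArg _ (sum_congr rfl fun m _ => ?_)
    by_cases h : T₂ m fun i => (w i).2.2.1 <;> simp [Code.ofTests, h, ind]
  · refine sum_congr rfl fun w _ => ?_
    rw [← sum_mul_ind_eq (fun m => ind (¬T₂ m fun i => (w i).2.2.1))
      (f fun i => (w i).1)]
    refine congrArg _ (sum_congr rfl fun m _ => ?_)
    by_cases h : T₂ m fun i => (w i).2.2.1 <;> simp [Code.ofTests, h, ind]

lemma achievable_zero (hP : P ∈ stdSimplex ℝ (X × Y₁ × Y₂ × Z₁)) {ε : ℝ} (hε : 0 < ε) :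
    Achievable P ε 0 0 R := by
  refine ⟨fun N => Code.ofTests (fun _ => 0) (fun _ _ _ => True) fun _ _ => True, ?_,
    zero_le_errorExponent₁ _ (altPmf_mem hP), zero_le_errorExponent₂ _ (altPmf_mem hP)⟩
  refine Eventually.of_forall fun N => ?_
  rw [(Code.prob₁_ofTests _ _ _ _).2, (Code.prob₂_ofTests _ _ _ _).2]
  simp [ind, hε.le]

end Coding

/-! ### From block schemes to codes of every blocklength. -/

section Achievability

variable {X Y₁ Y₂ Z₁ : Type*} [Fintype X] [Fintype Y₁] [Fintype Y₂] [Fintype Z₁]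
  {P : X × Y₁ × Y₂ × Z₁ → ℝ} {b m₀ m₁ : ℕ} {E₁ E₂ r R ρ : ℝ}

/-- The ceiling at most doubles the number of bins; this is the one bit reserved in kρ ≤ NR - 1. -/
lemma pow_mul_ceil_le {k N : ℕ} (hm₀ : 0 < m₀) (hr : 0 ≤ r) (hρ : Real.logb 2 m₀ + r ≤ ρ)
    (hk : k * ρ ≤ N * R - 1) :
    m₀ ^ k * ⌈(2 : ℝ) ^ ((k : ℝ) * r)⌉₊ ≤ ⌊(2 : ℝ) ^ ((N : ℝ) * R)⌋₊ + 1 := by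
  refine (Nat.le_floor ?_).trans (Nat.le_succ _)
  have hm₀' : (0 : ℝ) < m₀ := by exact_mod_cast hm₀
  have h1 : (m₀ : ℝ) ^ k = (2 : ℝ) ^ ((k : ℝ) * Real.logb 2 m₀) := by
    rw [mul_comm, Real.rpow_mul (by norm_num), Real.rpow_logb (by norm_num) (by norm_num) hm₀',
      Real.rpow_natCast]
  have h2 : (1 : ℝ) ≤ (2 : ℝ) ^ ((k : ℝ) * r) :=
    Real.one_le_rpow (by norm_num) (by positivity)
  have h3 : (⌈(2 : ℝ) ^ ((k : ℝ) * r)⌉₊ : ℝ) ≤ (2 : ℝ) ^ ((k : ℝ) * r + 1) := by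
    have := Nat.ceil_lt_add_one (zero_le_one.trans h2)
    rw [Real.rpow_add_one (by norm_num)]
    linarith
  have h4 := mul_le_mul_of_nonneg_left hρ (k.cast_nonneg (α := ℝ))
  push_cast
  calc _ ≤ (2 : ℝ) ^ ((k : ℝ) * Real.logb 2 m₀) * (2 : ℝ) ^ ((k : ℝ) * r + 1) := by
        rw [h1]; exact mul_le_mul_of_nonneg_left h3 (by positivity)
    _ = (2 : ℝ) ^ ((k : ℝ) * (Real.logb 2 m₀ + r) + 1) := by
        rw [← Real.rpow_add (by norm_num)]; congr 1; ring
    _ ≤ _ := Real.rpow_le_rpow_of_exponent_le (by norm_num) (by linarith)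

/-- A code that applies the block scheme to the first `k` blocks of a word. -/
lemma BlockScheme.exists_code (S : BlockScheme P b m₀ m₁ E₁ E₂ r)
    (hP : P ∈ stdSimplex ℝ (X × Y₁ × Y₂ × Z₁)) (hm₀ : 0 < m₀) (hr : 0 ≤ r)
    (hR : 0 < R) (hρ : Real.logb 2 m₀ + r ≤ ρ) (hbρ : b * R ≤ ρ) {δ : ℝ} (hδ : 0 < δ) :
    ∃ η : ℕ → ℝ, Tendsto η atTop (𝓝 0) ∧ ∀ k N : ℕ, k * ρ ≤ N * R - 1 →
      ∃ c : Code X Y₁ Y₂ Z₁ R N, c.prob₁ P 1 ≤ η k ∧ c.prob₂ P 1 ≤ η k ∧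
        c.prob₁ (altPmf P) 0 ≤ 2 * (2 : ℝ) ^ (-((k : ℝ) * (E₁ - δ))) ∧
        c.prob₂ (altPmf P) 0 ≤ 2 * (2 : ℝ) ^ (-((k : ℝ) * (E₂ - δ))) := by
  obtain ⟨η, hη, htests⟩ := S.exists_tests hP hδ
  refine ⟨η, hη, fun k N hk => ?_⟩
  obtain ⟨h, T₁, T₂, hα₁, hα₂, hβ₁, hβ₂⟩ := htests k ⌈(2 : ℝ) ^ ((k : ℝ) * r)⌉₊ (Nat.le_ceil _)
  -- The k blocks fit into the word because kbR ≤ kρ ≤ NR.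
  have hkb : k * b ≤ N := by
    have h1 : ((k * b : ℕ) : ℝ) * R ≤ N * R := by
      have := mul_le_mul_of_nonneg_left hbρ (k.cast_nonneg (α := ℝ))
      push_cast
      linarith
    exact_mod_cast le_of_mul_le_mul_right h1 hR
  let e : Fin k × Fin b ↪ Fin N := finProdFinEquiv.toEmbedding.trans (Fin.castLEEmb hkb)
  obtain ⟨ι⟩ : Nonempty ((Fin k → Fin m₀) × Fin ⌈(2 : ℝ) ^ ((k : ℝ) * r)⌉₊ ↪ Message R N) :=
    Function.Embedding.nonempty_of_card_le (by
      simpa using pow_mul_ceil_le hm₀ hr hρ hk)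
  have hA := altPmf_mem hP
  let c : Code X Y₁ Y₂ Z₁ R N := Code.ofTests
    (fun x => ι (fun j => S.f₀ fun i => x (e (j, i)), h fun j => S.f₁ fun i => x (e (j, i))))
    (fun m y z => ∃ p, ι p = m ∧ T₁ p.1 p.2 (fun j i => y (e (j, i))) fun j i => z (e (j, i)))
    (fun m y => ∃ p, ι p = m ∧ T₂ p.1 fun j i => y (e (j, i)))
  refine ⟨c, ?_, ?_, ?_, ?_⟩
  · rw [(Code.prob₁_ofTests _ _ _ _).2]
    simp only [ι.injective.eq_iff, exists_eq_left]
    exact (sum_iidPmf_blocks hP.2 e fun w => ind (¬T₁ (fun j => S.f₀ fun i => (w j i).1)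
      (h fun j => S.f₁ fun i => (w j i).1) (fun j i => (w j i).2.1)
      fun j i => (w j i).2.2.2)).trans_le hα₁
  · rw [(Code.prob₂_ofTests _ _ _ _).2]
    simp only [ι.injective.eq_iff, exists_eq_left]
    exact (sum_iidPmf_blocks hP.2 e fun w => ind (¬T₂ (fun j => S.f₀ fun i => (w j i).1)
      fun j i => (w j i).2.2.1)).trans_le hα₂
  · rw [(Code.prob₁_ofTests _ _ _ _).1]
    simp only [ι.injective.eq_iff, exists_eq_left]
    exact (sum_iidPmf_blocks hA.2 e fun w => ind (T₁ (fun j => S.f₀ fun i => (w j i).1)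
      (h fun j => S.f₁ fun i => (w j i).1) (fun j i => (w j i).2.1)
      fun j i => (w j i).2.2.2)).trans_le hβ₁
  · rw [(Code.prob₂_ofTests _ _ _ _).1]
    simp only [ι.injective.eq_iff, exists_eq_left]
    exact (sum_iidPmf_blocks hA.2 e fun w => ind (T₂ (fun j => S.f₀ fun i => (w j i).1)
      fun j i => (w j i).2.2.1)).trans_le hβ₂

/-- Rounding down to whole blocks and the factor 2 cost only a constant in the exponent, while the
strict inequality provides a gap growing linearly in N. -/
lemma eventually_two_mul_rpow_le {θ E : ℝ} (hρ : 0 < ρ) (hR : 0 < R) (hθ : 0 ≤ θ)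
    (h : θ < R / ρ * E) :
    ∀ᶠ N : ℕ in atTop, 2 * (2 : ℝ) ^ (-((⌊(N * R - 1) / ρ⌋₊ : ℝ) * E)) ≤
      (2 : ℝ) ^ (-((N : ℝ) * θ)) := by
  have hE : 0 < E := pos_of_mul_pos_right (hθ.trans_lt h) (by positivity)
  have hlim : Tendsto (fun N : ℕ => (N : ℝ) * (R / ρ * E - θ)) atTop atTop :=
    tendsto_natCast_atTop_atTop.atTop_mul_const (sub_pos.2 h)
  filter_upwards [hlim.eventually_ge_atTop (1 + (1 / ρ + 1) * E)] with N hN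
  have h1 : (2 : ℝ) * (2 : ℝ) ^ (-((⌊(N * R - 1) / ρ⌋₊ : ℝ) * E)) =
      (2 : ℝ) ^ (-((⌊(N * R - 1) / ρ⌋₊ : ℝ) * E) + 1) := by
    rw [Real.rpow_add_one (by norm_num), mul_comm]
  rw [h1]
  refine Real.rpow_le_rpow_of_exponent_le (by norm_num) ?_
  have h2 := Nat.lt_floor_add_one ((N * R - 1) / ρ)
  have h3 := mul_le_mul_of_nonneg_right h2.le hE.le
  have h4 : (N * R - 1) / ρ * E = N * (R / ρ * E) - 1 / ρ * E := by ring
  rw [h4] at h3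
  linarith

/-- A zero target exponent is kept as a separate case: it holds for any code, even when E is not
positive. -/
lemma exists_slack {θ c E : ℝ} (hc : 0 < c) (h : θ = 0 ∨ θ < c * E) :
    ∃ δ > 0, ∀ δ' ≤ δ, θ = 0 ∨ θ < c * (E - δ') := by
  rcases h with h | h
  · exact ⟨1, one_pos, fun _ _ => Or.inl h⟩
  · refine ⟨(E - θ / c) / 2, half_pos (sub_pos.2 ((div_lt_iff₀' hc).2 h)), fun δ' hδ' =>
      Or.inr ?_⟩
    have h1 : θ / c < E := (div_lt_iff₀' hc).2 h
    rw [← div_lt_iff₀' hc]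
    linarith

lemma BlockScheme.achievable (S : BlockScheme P b m₀ m₁ E₁ E₂ r)
    (hP : P ∈ stdSimplex ℝ (X × Y₁ × Y₂ × Z₁)) (hb : 0 < b) (hm₀ : 0 < m₀) (hr : 0 ≤ r)
    (hR : 0 < R) (hρ : Real.logb 2 m₀ + r ≤ ρ) (hbρ : b * R ≤ ρ) {θ₁ θ₂ ε : ℝ}
    (hθ₁ : 0 ≤ θ₁) (hθ₂ : 0 ≤ θ₂) (h₁ : θ₁ = 0 ∨ θ₁ < R / ρ * E₁)
    (h₂ : θ₂ = 0 ∨ θ₂ < R / ρ * E₂) (hε : 0 < ε) : Achievable P ε θ₁ θ₂ R := by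
  have hρ0 : 0 < ρ := lt_of_lt_of_le (mul_pos (by exact_mod_cast hb) hR) hbρ
  obtain ⟨δ₁, hδ₁, hs₁⟩ := exists_slack (by positivity : 0 < R / ρ) h₁
  obtain ⟨δ₂, hδ₂, hs₂⟩ := exists_slack (by positivity : 0 < R / ρ) h₂
  obtain ⟨η, hη, hcode⟩ := S.exists_code hP hm₀ hr hR hρ hbρ (lt_min hδ₁ hδ₂)
  have hlim : Tendsto (fun N : ℕ => (N : ℝ) * R - 1) atTop atTop :=
    tendsto_atTop_add_const_right _ _ (tendsto_natCast_atTop_atTop.atTop_mul_const hR)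
  have hk : Tendsto (fun N : ℕ => ⌊(N * R - 1) / ρ⌋₊) atTop atTop :=
    tendsto_nat_floor_atTop.comp (hlim.atTop_div_const hρ0)
  have hc : ∀ N : ℕ, ∃ c : Code X Y₁ Y₂ Z₁ R N, 0 ≤ (N : ℝ) * R - 1 →
      c.prob₁ P 1 ≤ η ⌊(N * R - 1) / ρ⌋₊ ∧ c.prob₂ P 1 ≤ η ⌊(N * R - 1) / ρ⌋₊ ∧
        c.prob₁ (altPmf P) 0 ≤
          2 * (2 : ℝ) ^ (-((⌊(N * R - 1) / ρ⌋₊ : ℝ) * (E₁ - min δ₁ δ₂))) ∧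
        c.prob₂ (altPmf P) 0 ≤
          2 * (2 : ℝ) ^ (-((⌊(N * R - 1) / ρ⌋₊ : ℝ) * (E₂ - min δ₁ δ₂))) := fun N => by
    by_cases hN : 0 ≤ (N : ℝ) * R - 1
    · obtain ⟨c, hc⟩ := hcode ⌊(N * R - 1) / ρ⌋₊ N (by
        rw [← le_div_iff₀ hρ0]
        exact Nat.floor_le (div_nonneg hN hρ0.le))
      exact ⟨c, fun _ => hc⟩
    -- Only finitely many N have NR < 1, so any code serves there.
    · exact ⟨Code.ofTests (fun _ => 0) (fun _ _ _ => True) fun _ _ => True, fun h => absurd h hN⟩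
  choose c hc using hc
  have hlarge := hlim.eventually_ge_atTop 0
  refine ⟨c, ?_, ?_, ?_⟩
  · filter_upwards [hlarge, (hη.comp hk).eventually_le_const hε] with N hN hηN
    exact ⟨(hc N hN).1.trans hηN, (hc N hN).2.1.trans hηN⟩
  · rcases hs₁ _ (min_le_left _ _) with h | h
    · rw [h]; exact zero_le_errorExponent₁ c (altPmf_mem hP)
    · refine le_errorExponent ?_
      filter_upwards [hlarge, eventually_two_mul_rpow_le hρ0 hR hθ₁ h] with N hN hβ
      exact (hc N hN).2.2.1.trans hβ
  · rcases hs₂ _ (min_le_right _ _) with h | h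
    · rw [h]; exact zero_le_errorExponent₂ c (altPmf_mem hP)
    · refine le_errorExponent ?_
      filter_upwards [hlarge, eventually_two_mul_rpow_le hρ0 hR hθ₂ h] with N hN hβ
      exact (hc N hN).2.2.2.trans hβ

end Achievability

/-! ### Exponents are bounded by the rate; the limiting argument. -/

section Region

variable {X Y₁ Y₂ Z₁ U₀ U₁ : Type*} [Fintype X] [Fintype Y₁] [Fintype Y₂] [Fintype Z₁]
  [Fintype U₀] [Fintype U₁] {Q : (U₀ × U₁) × X × Y₁ × Y₂ × Z₁ → ℝ}

/-- Data processing gives I(U₀,U₁;Y₁|Z₁) ≤ I(U₀,U₁;X|Z₁). The chain rule and I(U₀;X|Z₁) = I(U₀;X) -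
I(U₀;Z₁) then bound this by the rate expression. The bound serves to settle R ≤ 0 in the main
theorem. -/
lemma condMutualInfo_le_rate (hQ : Q ∈ stdSimplex ℝ ((U₀ × U₁) × X × Y₁ × Y₂ × Z₁))
    (hM : IsMarkovChain Q (fun ω => ω.1) (fun ω => ω.2.1) fun ω => ω.2.2) :
    condMutualInfo Q (fun ω => ω.1) (fun ω => ω.2.2.1) (fun ω => ω.2.2.2.2) ≤
      mutualInfo Q (fun ω => ω.1.1) (fun ω => ω.2.1) +
        condMutualInfo Q (fun ω => ω.1.2) (fun ω => ω.2.1) (fun ω => (ω.1.1, ω.2.2.2.2)) := by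
  have h1 := condMutualInfo_nonneg hQ (fun ω => ω.1) (fun ω => ω.2.1)
    fun ω => (ω.2.2.1, ω.2.2.2.2)
  have h2 := mutualInfo_nonneg hQ (fun ω => ω.1.1) fun ω => ω.2.2.2.2
  have m1 := (hM.comp_right fun s => (s.1, s.2.2)).ent_eq hQ.1
  have m2 := (hM.comp_right fun s => s.2.2).ent_eq hQ.1
  have m3 := ((hM.comp_right fun s => s.2.2).comp_left fun u => u.1).ent_eq hQ.1
  rw [condMutualInfo_eq hQ.1] at h1 ⊢
  rw [mutualInfo_eq hQ.1] at h2 ⊢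
  rw [condMutualInfo_eq hQ.1]
  have p1 := ent_comp_injective Q (fun ω => (ω.1, ω.2.2.2.2))
    (e := fun t => (t.1.2, t.1.1, t.2))
    (fun s t h => by simp only [Prod.mk.injEq] at h; ext <;> simp [h])
  have p2 := ent_comp_injective Q (fun ω => (ω.1.1, ω.2.1, ω.2.2.2.2))
    (e := fun t => (t.2.1, t.1, t.2.2))
    (fun s t h => by simp only [Prod.mk.injEq] at h; ext <;> simp [h])
  have p3 := ent_comp_injective Q (fun ω => (ω.1, ω.2.1, ω.2.2.2.2))
    (e := fun t => (t.1.2, t.2.1, t.1.1, t.2.2))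
    (fun s t h => by simp only [Prod.mk.injEq] at h; ext <;> simp [h])
  simp only at p1 p2 p3 m1 m2 m3
  linarith

lemma mutualInfo_le_rate (hQ : Q ∈ stdSimplex ℝ ((U₀ × U₁) × X × Y₁ × Y₂ × Z₁))
    (hM : IsMarkovChain Q (fun ω => ω.1) (fun ω => ω.2.1) fun ω => ω.2.2) :
    mutualInfo Q (fun ω => ω.1.1) (fun ω => ω.2.2.2.1) ≤
      mutualInfo Q (fun ω => ω.1.1) (fun ω => ω.2.1) +
        condMutualInfo Q (fun ω => ω.1.2) (fun ω => ω.2.1) (fun ω => (ω.1.1, ω.2.2.2.2)) := by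
  have h0 := condMutualInfo_nonneg hQ (fun ω => ω.1.2) (fun ω => ω.2.1)
    fun ω => (ω.1.1, ω.2.2.2.2)
  have h1 := condMutualInfo_nonneg hQ (fun ω => ω.1.1) (fun ω => ω.2.1) fun ω => ω.2.2.2.1
  have m := ((hM.comp_right fun s => s.2.1).comp_left fun u => u.1).ent_eq hQ.1
  rw [condMutualInfo_eq hQ.1] at h1
  rw [mutualInfo_eq hQ.1, mutualInfo_eq hQ.1]
  linarith

end Region

theorem innerRegion_subset_exponentsRegion
    {X Y₁ Y₂ Z₁ : Type*} [Fintype X] [Fintype Y₁] [Fintype Y₂] [Fintype Z₁]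
    {P : X × Y₁ × Y₂ × Z₁ → ℝ} (hP : P ∈ stdSimplex ℝ (X × Y₁ × Y₂ × Z₁)) (R : ℝ) :
    innerRegion P R ⊆ exponentsRegion P R := by
  rintro ⟨θ₁, θ₂⟩ ⟨hθ₁, hθ₂, k₀, k₁, Q, hQ, hQP, hM, hI₁, hI₂, hrate⟩
  have hQP' : law Q (fun ω => ω.2) = P := hQP
  have hM' : IsMarkovChain Q (fun ω => ω.1) (fun ω => ω.2.1) fun ω => ω.2.2 := hM
  simp only at hθ₁ hθ₂ hI₁ hI₂ hrate
  have hR₁ := (hI₁.trans (condMutualInfo_le_rate hQ hM')).trans hrate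
  have hR₂ := (hI₂.trans (mutualInfo_le_rate hQ hM')).trans hrate
  -- If R = 0, both exponents vanish and tests that always accept suffice.
  rcases (hθ₁.trans hR₁).eq_or_lt with hR | hR
  · have e₁ : θ₁ = 0 := by linarith
    have e₂ : θ₂ = 0 := by linarith
    subst e₁ e₂
    exact subset_closure ⟨le_rfl, le_rfl, fun ε hε => achievable_zero hP hε.1⟩
  -- R/(R + 2δ) accounts for the part of the word left unused, θ - δ for the loss of the block
  -- scheme, and the last -δ makes the inequality strict. The maximum keeps the exponents
  -- nonnegative.
  let f : ℝ → ℝ × ℝ := fun δ => (max 0 (R / (R + 2 * δ) * (θ₁ - δ) - δ),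
    max 0 (R / (R + 2 * δ) * (θ₂ - δ) - δ))
  have hf : Tendsto f (𝓝[>] 0) (𝓝 (θ₁, θ₂)) := by
    have h1 : f 0 = (θ₁, θ₂) := by
      simp [f, div_self hR.ne', hθ₁, hθ₂]
    rw [← h1]
    refine ContinuousAt.continuousWithinAt ?_
    have hne : R + 2 * 0 ≠ 0 := by simpa using hR.ne'
    have hc : ContinuousAt (fun δ : ℝ => R / (R + 2 * δ)) 0 :=
      ContinuousAt.div (by fun_prop) (by fun_prop) hne
    have hl : ∀ θ : ℝ,
        ContinuousAt (fun δ : ℝ => max 0 (R / (R + 2 * δ) * (θ - δ) - δ)) 0 := fun θ =>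
      continuousAt_const.max
        ((hc.mul (continuousAt_const.sub continuousAt_id)).sub continuousAt_id)
    exact (hl θ₁).prodMk (hl θ₂)
  refine mem_closure_of_tendsto hf ?_
  filter_upwards [self_mem_nhdsWithin] with δ hδ
  have hδ : 0 < δ := hδ
  refine ⟨le_max_left _ _, le_max_left _ _, fun ε hε => ?_⟩
  obtain ⟨b, m₀, m₁, hb, hm₀, hm₀r, ⟨S⟩⟩ := exists_blockScheme hQ hQP' hM' hδ
  have hbR : (0 : ℝ) < b := by exact_mod_cast hb
  have hI := condMutualInfo_nonneg hQ (fun ω => ω.1.2) (fun ω => ω.2.1)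
    fun ω => (ω.1.1, ω.2.2.2.2)
  have hbound : ∀ θ J : ℝ, θ ≤ J → max 0 (R / (R + 2 * δ) * (θ - δ) - δ) = 0 ∨
      max 0 (R / (R + 2 * δ) * (θ - δ) - δ) < R / (b * (R + 2 * δ)) * (b * (J - δ)) :=
    fun θ J hJ => by
      have e : R / (b * (R + 2 * δ)) * (b * (J - δ)) = R / (R + 2 * δ) * (J - δ) := by
        field_simp
      rcases max_choice 0 (R / (R + 2 * δ) * (θ - δ) - δ) with h | h
      · exact Or.inl h
      · refine Or.inr ?_
        rw [h, e]
        have := mul_le_mul_of_nonneg_left (sub_le_sub_right hJ δ)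
          (by positivity : 0 ≤ R / (R + 2 * δ))
        linarith
  -- The choice of ρ covers log m₀ ≤ b(I(U₀;X) + δ) and r = b(I(U₁;X|U₀,Z₁) + δ), whose information
  -- terms sum to at most R.
  refine S.achievable hP hb hm₀ (by positivity) hR (ρ := b * (R + 2 * δ)) ?_ ?_
    (le_max_left _ _) (le_max_left _ _) (hbound _ _ hI₁) (hbound _ _ hI₂) hε.1
  · have := mul_le_mul_of_nonneg_left hrate hbR.le
    linarith
  · exact mul_le_mul_of_nonneg_left (by linarith) hbR.le

end

end HeegardBerger

theorem theorem2 {X Y₁ Y₂ Z₁ : Type*} [Fintype X] [Fintype Y₁] [Fintype Y₂] [Fintype Z₁]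
    (P : X × Y₁ × Y₂ × Z₁ → ℝ) (hP : P ∈ stdSimplex ℝ (X × Y₁ × Y₂ × Z₁)) (R : ℝ) :
    HeegardBerger.innerRegion P R ⊆ HeegardBerger.exponentsRegion P R :=
  HeegardBerger.innerRegion_subset_exponentsRegion hP R
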